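/- Let $\omega=\{0,1,2,\ldots\}$ and let $a_0,a_1,\ldots$ be attributes. A decision rule $r$ is an expression $(a_{i_1}=\delta_1)\wedge\cdots\wedge(a_{i_m}=\delta_m)\to\sigma$ with $m\ge 0$, pairwise different attributes $a_{i_j}$ and $\delta_j,\sigma\in\omega$; $K(r)=\{a_{i_1}=\delta_1,\ldots,a_{i_m}=\delta_m\}$, $m$ is the length and $\sigma$ the right-hand side of $r$. Two rules are equal if they have the same set $K(r)$ and the same right-hand side. A decision rule system $S$ is a finite nonempty set of rules; $A(S)$ is the set of attributes occurring in $S$; for $a_i\in A(S)$, $V_S(a_i)$ is the set of all $\delta$ such that the equation $a_i=\delta$ occurs in $S$, and $EV_S(a_i)=V_S(a_i)\cup\{\ast\}$. Let $d(S)$ be the maximum length of a rule of $S$, $k(S)=\max_{a_i\in A(S)}|V_S(a_i)|$ (and $k(S)=0$ if $A(S)=\emptyset$). For $k,d\in\omega\setminus\{0\}$ let $\Sigma(k,d)$ be the set of systems $S$ with $k(S)=k$ and $d(S)=d$. The system $S$ is written as a word over the alphabet $\{(,),a,=,\wedge,\to,0,1,;\}$ with all numbers in binary and the rules separated by ";";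 the size of $S$ is the length of this word. An o-decision tree (e-decision tree) over $S$ is a finite rooted tree in which each working (nonterminal) node is labeled with an attribute $a_i\in A(S)$ and has exactly $|V_S(a_i)|$ (respectively $|EV_S(a_i)|$) leaving edges, labeled with pairwise different elements of $V_S(a_i)$ (respectively $EV_S(a_i)$), and each terminal node is labeled with a subset of $S$. For a complete path $\xi$ from the root to a terminal node, $K(\xi)$ is the set of equations $a_i=\delta$ given by the working nodes of $\xi$ and the edges of $\xi$ leaving them, and $\tau(\xi)$ is the label of its terminal node. A system of equations is inconsistent if it contains $a_i=\delta$ and $a_i=\delta'$ with $\delta\ne\delta'$. A decision tree $\Gamma$ over $S$ solves $AR(S)$, $AD(S)$ or $SR(S)$ (respectively $EAR(S)$, $EAD(S)$ or $ESR(S)$) if it is an o-decision tree (respectively an e-decision tree) and, for each complete path $\xi$ with consistent $K(\xi)$, every $r\in\tau(\xi)$ satisfies $K(r)\subseteq K(\xi)$ and, moreover, - for $AR(S)$ and $EAR(S)$: $K(r)\cup K(\xi)$ is inconsistent for every $r\in S\setminus\tau(\xi)$; - for $AD(S)$ and $EAD(S)$: $K(r)\cup K(\xi)$ is inconsistent for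 every $r\in S\setminus\tau(\xi)$ whose right-hand side is not the right-hand side of any rule of $\tau(\xi)$; - for $SR(S)$ and $ESR(S)$: if $\tau(\xi)=\emptyset$, then $K(r)\cup K(\xi)$ is inconsistent for every $r\in S$. For $C\in\{AR,EAR,AD,EAD,SR,ESR\}$ let $P_{DT}(C)$ be the set of pairs $(k,d)\in(\omega\setminus\{0\})^2$ for which there is an algorithm (a Turing machine that writes out the tree node by node) that, for every $S\in\Sigma(k,d)$, constructs a decision tree solving $C(S)$ in time polynomial in the size of $S$. **Theorem 1.** (a) $P_{DT}(ESR)=\{(k,1):k\in\omega\setminus\{0\}\}$; (b) $P_{DT}(SR)=\{(k,1),(1,d):k,d\in\omega\setminus\{0\}\}$; (c) $P_{DT}(EAD)=P_{DT}(EAR)=\emptyset$; (d) $P_{DT}(AD)=P_{DT}(AR)=\{(1,d):d\in\omega\setminus\{0\}\}$. -/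

import Mathlib

namespace DecisionRules

/-! ### Decision rule systems -/

/-- A decision rule `(a_{i₁} = δ₁) ∧ ⋯ ∧ (a_{iₘ} = δₘ) → σ`. The pair `(i, δ)` stands for the
equation `a_i = δ`, and `lhs` is the set `K(r)` of equations of the left-hand side. Two rules are
equal iff these sets and the right-hand sides are equal. -/
@[ext] structure Rule where
  lhs : Finset (ℕ × ℕ)
  rhs : ℕ
  /-- the attributes on the left-hand side are pairwise different -/
  attr_ne : ∀ e ∈ lhs, ∀ e' ∈ lhs, e.1 = e'.1 → e = e'

instance : DecidableEq Rule := fun r r' =>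
  decidable_of_iff (r.lhs = r'.lhs ∧ r.rhs = r'.rhs) Rule.ext_iff.symm

/-- The length of a rule (its attributes are pairwise different). -/
def Rule.length (r : Rule) : ℕ := r.lhs.card

/-- `A(S)`, the set of (indices of) attributes occurring in `S`. -/
def attrs (S : Finset Rule) : Finset ℕ := S.biUnion fun r => r.lhs.image Prod.fst

/-- `V_S(a_i)`. -/
def values (S : Finset Rule) (i : ℕ) : Finset ℕ :=
  S.biUnion fun r => (r.lhs.filter fun e => e.1 = i).image Prod.snd

/-- `D(S)`, the set of right-hand sides. -/
def decisions (S : Finset Rule) : Finset ℕ := S.image Rule.rhs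

/-- `d(S)`, the maximum length of a rule. -/
def maxLength (S : Finset Rule) : ℕ := S.sup Rule.length

/-- `k(S)`, the maximum number of values of an attribute (`0` if there are no attributes). -/
def maxValues (S : Finset Rule) : ℕ := (attrs S).sup fun i => (values S i).card

/-- `Σ(k, d)`: the decision rule systems (finite nonempty sets of rules) `S` with `k(S) = k` and
`d(S) = d`. -/
def systems (k d : ℕ) : Set (Finset Rule) :=
  {S | S.Nonempty ∧ maxValues S = k ∧ maxLength S = d}

/-! ### Decision trees -/

/-- A finite rooted tree. A terminal node is labeled with a finite set of rules; a working node is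
labeled with an attribute `a_i`, and its `m` leaving edges are labeled with elements of
`ω ∪ {∗}`, where `none` is the symbol `∗`. -/
inductive DecisionTree where
  | terminal (τ : Finset Rule)
  | working (i : ℕ) (m : ℕ) (label : Fin m → Option ℕ) (child : Fin m → DecisionTree)

/-- The six problems. -/
inductive Problem where
  | AR | EAR | AD | EAD | SR | ESR

/-- The problems `EAR`, `EAD`, `ESR`, which are solved by e-trees. -/
def Problem.IsExtended : Problem → Prop
  | .AR | .AD | .SR => False
  | .EAR | .EAD | .ESR => True

/-- The set of labels of the edges that leave a node labeled with `a_i`: `V_S(a_i)` in an o-tree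
(`¬ ext`), `EV_S(a_i) = V_S(a_i) ∪ {∗}` in an e-tree (`ext`). -/
def edgeLabels (ext : Prop) (S : Finset Rule) (i : ℕ) : Set (Option ℕ) :=
  {x | (∃ δ ∈ values S i, x = some δ) ∨ (ext ∧ x = none)}

/-- `Γ` is a decision tree over `S`: an o-decision tree if `¬ ext`, an e-decision tree if `ext`. -/
def DecisionTree.IsOver (ext : Prop) (S : Finset Rule) : DecisionTree → Prop
  | .terminal τ => τ ⊆ S
  | .working i m label child =>
      i ∈ attrs S ∧ m = (edgeLabels ext S i).ncard ∧ Function.Injective label ∧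
        (∀ j, label j ∈ edgeLabels ext S i) ∧ ∀ j, (child j).IsOver ext S

/-- `Γ.IsCompletePath ξ τ`: there is a complete path of `Γ` with the sequence `ξ` of equations
`a_i = x` (attribute of a working node, label of the edge taken), whose terminal node is labeled
with `τ`. -/
inductive DecisionTree.IsCompletePath :
    DecisionTree → List (ℕ × Option ℕ) → Finset Rule → Prop
  | terminal (τ : Finset Rule) : IsCompletePath (.terminal τ) [] τ
  | working (i m : ℕ) (label : Fin m → Option ℕ) (child : Fin m → DecisionTree) (j : Fin m)
      (ξ : List (ℕ × Option ℕ)) (τ : Finset Rule) (h : IsCompletePath (child j) ξ τ) :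
      IsCompletePath (.working i m label child) ((i, label j) :: ξ) τ

/-- A system of equations is consistent if it does not assign two values to one attribute. -/
def Consistent (E : Set (ℕ × Option ℕ)) : Prop :=
  ∀ i x y, (i, x) ∈ E → (i, y) ∈ E → x = y

/-- The equation system `K(r)`, with values in `ω ∪ {∗}`. -/
def Rule.eqs (r : Rule) : Set (ℕ × Option ℕ) := {e | ∃ p ∈ r.lhs, e = (p.1, some p.2)}

/-- The equation system `K(ξ)` of a path. -/
def pathEqs (ξ : List (ℕ × Option ℕ)) : Set (ℕ × Option ℕ) := {e | e ∈ ξ}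

/-- The second condition in the definition of a tree solving the problem `C(S)`, for a path with
the equation system `K` and the terminal label `τ`. -/
def PathCondition (C : Problem) (S : Finset Rule) (K : Set (ℕ × Option ℕ)) (τ : Finset Rule) :
    Prop :=
  match C with
  | .AR | .EAR => ∀ r ∈ S \ τ, ¬ Consistent (r.eqs ∪ K)
  | .AD | .EAD => ∀ r ∈ S \ τ, r.rhs ∉ decisions τ → ¬ Consistent (r.eqs ∪ K)
  | .SR | .ESR => τ = ∅ → ∀ r ∈ S, ¬ Consistent (r.eqs ∪ K)

/-- `Γ` is a decision tree over `S` that solves the problem `C(S)`. -/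
def DecisionTree.Solves (Γ : DecisionTree) (C : Problem) (S : Finset Rule) : Prop :=
  Γ.IsOver C.IsExtended S ∧
    ∀ ξ τ, Γ.IsCompletePath ξ τ → Consistent (pathEqs ξ) →
      (∀ r ∈ τ, r.eqs ⊆ pathEqs ξ) ∧ PathCondition C S (pathEqs ξ) τ

/-! ### Words representing rule systems and decision trees -/

/-- The alphabet `{ (, ), a, =, ∧, →, 0, 1, ; }` for rule systems. -/
inductive RuleSymbol where
  | lparen | rparen | attr | equal | conj | arrow | zero | one | semicolon
  deriving DecidableEq

/-- Binary representation, most significant digit first, `0` represented by the word `0`. -/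
def binary (n : ℕ) : List RuleSymbol :=
  if n = 0 then [.zero]
  else (Nat.digits 2 n).reverse.map fun b => if b = 0 then .zero else .one

/-- The word `(a i = δ)`. -/
def equationWord (e : ℕ × ℕ) : List RuleSymbol :=
  [.lparen, .attr] ++ binary e.1 ++ [.equal] ++ binary e.2 ++ [.rparen]

/-- `w` is a word `(a i₁ = δ₁) ∧ ⋯ ∧ (a iₘ = δₘ) → σ` for the rule `r`, the equations being
written in any order. -/
def RepresentsRule (w : List RuleSymbol) (r : Rule) : Prop :=
  ∃ l : List (ℕ × ℕ), l.Nodup ∧ l.toFinset = r.lhs ∧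
    w = List.intercalate [.conj] (l.map equationWord) ++ [.arrow] ++ binary r.rhs

/-- `w` is a word representing the finite set `R` of rules: the rules of `R` are written in any
order, each once, and `;` separates two rules. The length of such a word is the size of `R`. -/
def Represents (w : List RuleSymbol) (R : Finset Rule) : Prop :=
  ∃ (l : List Rule) (ws : List (List RuleSymbol)), l.Nodup ∧ l.toFinset = R ∧
    List.Forall₂ RepresentsRule ws l ∧ w = List.intercalate [.semicolon] ws

/-- The alphabet for decision trees: the previous one with the symbols `∗`, `{`, `}`, `[`, `]`. -/
inductive TreeSymbol where
  | rule (s : RuleSymbol)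
  | star | lbrace | rbrace | lbracket | rbracket
  deriving DecidableEq

/-- The word of an edge label. -/
def labelWord : Option ℕ → List TreeSymbol
  | none => [.star]
  | some δ => (binary δ).map .rule

/-- `RepresentsTree u Γ`: `u` is a word representing `Γ`. Nodes are written out one by one (there is
no sharing of subtrees): a terminal node labeled with `τ` is written `{w}`, where the word `w`
represents `τ`, and a working node labeled with `a_i` is written `a i [x₁→u₁ ⋯ xₘ→uₘ]`, where
`x_j` is the label of the `j`-th edge and `u_j` represents the subtree that it enters. -/
inductive RepresentsTree : List TreeSymbol → DecisionTree → Prop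
  | terminal (τ : Finset Rule) (w : List RuleSymbol) (h : Represents w τ) :
      RepresentsTree ([.lbrace] ++ w.map .rule ++ [.rbrace]) (.terminal τ)
  | working (i m : ℕ) (label : Fin m → Option ℕ) (child : Fin m → DecisionTree)
      (u : Fin m → List TreeSymbol) (h : ∀ j, RepresentsTree (u j) (child j)) :
      RepresentsTree
        ([.rule .attr] ++ (binary i).map .rule ++ [.lbracket] ++
          (List.ofFn fun j => labelWord (label j) ++ [.rule .arrow] ++ u j).flatten ++
          [.rbracket])
        (.working i m label child)

/-! ### Polynomial time construction of decision trees -/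

/-- The words over the input alphabet representing systems from `Σ(k, d)`. -/
abbrev InputWord (k d : ℕ) : Type :=
  {w : List RuleSymbol // ∃ S ∈ systems k d, Represents w S}

/-- There is an algorithm (a Turing machine) which, for every `S ∈ Σ(k, d)`, given on input a word
representing `S`, constructs a word representing a decision tree that solves `C(S)`, in time
polynomial in the length of the input word, that is, in the size of `S`. -/
def PolyTimeConstructible (C : Problem) (k d : ℕ) : Prop :=
  ∃ f : InputWord k d → List TreeSymbol,
    Nonempty (Turing.TM2ComputableInPolyTime
      (fun w : InputWord k d => w.1) (fun u : List TreeSymbol => u) f) ∧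
    ∀ (w : InputWord k d), ∀ S ∈ systems k d, Represents w.1 S →
      ∃ Γ : DecisionTree, RepresentsTree (f w) Γ ∧ Γ.Solves C S

/-- `P_DT(C)`. -/
def PDT (C : Problem) : Set (ℕ × ℕ) :=
  {p | 0 < p.1 ∧ 0 < p.2 ∧ PolyTimeConstructible C p.1 p.2}

end DecisionRules

/-! ### Structured programs over stacks, compiled to multi-stack Turing machines -/

namespace StackProgram

open Function Turing

/-! Positive results. If all rules have length at most one, a single working node is enough for
`SR`: in an o-tree every edge of the node carries a value that occurs in some rule, and that rule is
satisfied on the edge (`IsNode.solves`). For `ESR` the node also has an edge `∗`, which refutes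
every rule with this attribute; only this edge needs to be continued, so the tree is a chain of
nodes with leaves attached (`IsChain.solves`). A rule without equations may label a leaf at once. If
every attribute has only one value, an o-tree may be a single path that runs through every equation
of `S`. All rules hold at its end, so the leaf label `S` works for `AR`, `AD` and `SR`
(`polyTimeConstructible_of_one_value`).

The trees have to be written by Turing machines. Small structured programs over stacks are compiled
to such machines (`Exec.steps`, `polyTime_of_runs`), and the rules for `Runs` yield correctness and
running time together. The output depends on the order in which the input word lists the rules.
Unique decoding (`encode_injective`, `HasEquations.unique`) ensures that it is correct for every
system represented by this word.

Negative results. A machine pushes boundedly many symbols per step, so a polynomial-time machine has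
output of polynomial length (`exists_length_le`). A tree is written without sharing, so its word is
at least as long as its number of complete paths. It therefore suffices to find systems of
polynomial size with `2 ^ n` tuples of attribute values, no two of which can follow one path to a
correct leaf (`card_le_of_solves`, `not_polyTimeConstructible`).

For `AD` and `EAD`, take independent attributes and give every equation its own decision: then each
of `n` attributes must be read on every path in question. For `SR` and `ESR` with `d ≥ 2`, take
disjoint rules `a_{2i} = 0 ∧ a_{2i+1} = 0` and tuples in which exactly one attribute of each pair is
nonzero: refuting all rules means reading the nonzero attribute of every pair, which reveals the
tuple. The value other than `0` is `∗` in e-trees and `1` in o-trees, hence the condition `k ≥ 2`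
for the latter. `AR` and `EAR` are at least as hard as `AD` and `EAD`. -/

/-- Elementary actions on a finite state `σ` and stacks indexed by `K`. -/
inductive Act (K σ B : Type) where
  | push (k : K) (f : σ → Option B)
  | pop (k : K) (f : σ → Option B → σ)
  | peek (k : K) (f : σ → Option B → σ)

/-- Structured programs. -/
inductive Prog (K σ B : Type) where
  | acts (l : List (Act K σ B))
  | seq (p q : Prog K σ B)
  | ite (l : List (Act K σ B)) (c : σ → Bool) (p q : Prog K σ B)
  | loop (l : List (Act K σ B)) (c : σ → Bool) (p : Prog K σ B)

variable {K σ A B : Type} [DecidableEq K]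

def Act.run : Act K σ B → σ × (K → List B) → σ × (K → List B)
  | .push k f, c => (c.1, match f c.1 with
      | some b => update c.2 k (b :: c.2 k)
      | none => c.2)
  | .pop k f, c => (f c.1 (c.2 k).head?, update c.2 k (c.2 k).tail)
  | .peek k f, c => (f c.1 (c.2 k).head?, c.2)

def runActs : List (Act K σ B) → σ × (K → List B) → σ × (K → List B)
  | [], c => c
  | a :: l, c => runActs l (a.run c)

/-- `Exec p c c' t`: the program `p` started in `c` stops in `c'` after `t` steps. -/
inductive Exec : Prog K σ B → σ × (K → List B) → σ × (K → List B) → ℕ → Prop where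
  | acts (l c) : Exec (.acts l) c (runActs l c) 1
  | seq {p q c c' c'' t t'} : Exec p c c' t → Exec q c' c'' t' →
      Exec (.seq p q) c c'' (t + t')
  | ite_true {l b p q c c' t} : b (runActs l c).1 = true → Exec p (runActs l c) c' t →
      Exec (.ite l b p q) c c' (1 + t)
  | ite_false {l b p q c c' t} : b (runActs l c).1 = false → Exec q (runActs l c) c' t →
      Exec (.ite l b p q) c c' (1 + t)
  | loop_true {l b p c c' c'' t t'} : b (runActs l c).1 = true → Exec p (runActs l c) c' t →
      Exec (.loop l b p) c' c'' t' → Exec (.loop l b p) c c'' (1 + t + t')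
  | loop_false {l b p c} : b (runActs l c).1 = false →
      Exec (.loop l b p) c (runActs l c) 1

/-- The labels of a compiled program. -/
def Prog.Lab : Prog K σ B → Type
  | .acts _ => Unit
  | .seq p q => p.Lab ⊕ q.Lab
  | .ite _ _ p q => Option (p.Lab ⊕ q.Lab)
  | .loop _ _ p => Option p.Lab

def Prog.entry : (p : Prog K σ B) → p.Lab
  | .acts _ => ()
  | .seq p _ => Sum.inl p.entry
  | .ite _ _ _ _ => (none : Option _)
  | .loop _ _ _ => (none : Option _)

instance Prog.fintypeLab : (p : Prog K σ B) → Fintype p.Lab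
  | .acts _ => inferInstanceAs (Fintype Unit)
  | .seq p q =>
    have := p.fintypeLab
    have := q.fintypeLab
    inferInstanceAs (Fintype (p.Lab ⊕ q.Lab))
  | .ite _ _ p q =>
    have := p.fintypeLab
    have := q.fintypeLab
    inferInstanceAs (Fintype (Option (p.Lab ⊕ q.Lab)))
  | .loop _ _ p =>
    have := p.fintypeLab
    inferInstanceAs (Fintype (Option p.Lab))

/-- The input stack has its own alphabet. -/
abbrev Alphabet (K A B : Type) : Option K → Type
  | none => A
  | some _ => B

def joinStacks (i : List A) (s : K → List B) : ∀ k, List (Alphabet K A B k)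
  | none => i
  | some k => s k

theorem update_joinStacks (i : List A) (s : K → List B) (k : K) (l : List B) :
    update (joinStacks i s) (some k) l = joinStacks i (update s k l) := by
  funext k'
  cases k' with
  | none => rfl
  | some k' =>
    by_cases h : k' = k
    · subst h; simp [joinStacks]
    · simp [joinStacks, h]

/-- `Runs p s s' n`: started with the stacks `s` in any state, `p` stops with the stacks `s'`
after at most `n` steps. -/
def Runs (p : Prog K σ B) (s s' : K → List B) (n : ℕ) : Prop :=
  ∀ v, ∃ v' t, t ≤ n ∧ Exec p (v, s) (v', s') t

theorem Runs.mono {p : Prog K σ B} {s s' : K → List B} {m n : ℕ} (h : Runs p s s' m)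
    (hmn : m ≤ n) : Runs p s s' n := fun v => by
  obtain ⟨v', t, ht, hE⟩ := h v
  exact ⟨v', t, ht.trans hmn, hE⟩

theorem Runs.seq {p q : Prog K σ B} {s s' s'' : K → List B} {m n : ℕ} (h : Runs p s s' m)
    (h' : Runs q s' s'' n) : Runs (.seq p q) s s'' (m + n) := fun v => by
  obtain ⟨v', t, ht, hE⟩ := h v
  obtain ⟨v'', t', ht', hE'⟩ := h' v'
  exact ⟨v'', t + t', add_le_add ht ht', hE.seq hE'⟩

/-- The guard must give the same verdict and the same stacks from every register state. This is what
lets specifications be chained by stacks alone. -/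
theorem Runs.ite_true {l : List (Act K σ B)} {c : σ → Bool} {p q : Prog K σ B}
    {s s₁ s' : K → List B} {n : ℕ} (h : ∀ v, ∃ v', runActs l (v, s) = (v', s₁) ∧ c v' = true)
    (hp : Runs p s₁ s' n) : Runs (.ite l c p q) s s' (1 + n) := fun v => by
  obtain ⟨v₁, h₁, hc⟩ := h v
  obtain ⟨v', t, ht, hE⟩ := hp v₁
  rw [← h₁] at hE
  exact ⟨v', 1 + t, by omega, .ite_true (by rw [h₁]; exact hc) hE⟩

theorem Runs.ite_false {l : List (Act K σ B)} {c : σ → Bool} {p q : Prog K σ B}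
    {s s₁ s' : K → List B} {n : ℕ} (h : ∀ v, ∃ v', runActs l (v, s) = (v', s₁) ∧ c v' = false)
    (hq : Runs q s₁ s' n) : Runs (.ite l c p q) s s' (1 + n) := fun v => by
  obtain ⟨v₁, h₁, hc⟩ := h v
  obtain ⟨v', t, ht, hE⟩ := hq v₁
  rw [← h₁] at hE
  exact ⟨v', 1 + t, by omega, .ite_false (by rw [h₁]; exact hc) hE⟩

theorem Runs.loop_true {l : List (Act K σ B)} {c : σ → Bool} {p : Prog K σ B}
    {s s₁ s₂ s' : K → List B} {m n : ℕ}
    (h : ∀ v, ∃ v', runActs l (v, s) = (v', s₁) ∧ c v' = true)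
    (hp : Runs p s₁ s₂ m) (hl : Runs (.loop l c p) s₂ s' n) :
    Runs (.loop l c p) s s' (1 + m + n) := fun v => by
  obtain ⟨v₁, h₁, hc⟩ := h v
  obtain ⟨v₂, t, ht, hE⟩ := hp v₁
  obtain ⟨v', t', ht', hE'⟩ := hl v₂
  rw [← h₁] at hE
  exact ⟨v', 1 + t + t', by omega, .loop_true (by rw [h₁]; exact hc) hE hE'⟩

theorem Runs.loop_false {l : List (Act K σ B)} {c : σ → Bool} {p : Prog K σ B}
    {s s' : K → List B} (h : ∀ v, ∃ v', runActs l (v, s) = (v', s') ∧ c v' = false) :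
    Runs (.loop l c p) s s' 1 := fun v => by
  obtain ⟨v₁, h₁, hc⟩ := h v
  have hE := Exec.loop_false (l := l) (b := c) (p := p) (c := (v, s)) (by rw [h₁]; exact hc)
  rw [h₁] at hE
  exact ⟨v₁, 1, le_rfl, hE⟩

theorem update_joinStacks_none (i j : List A) (s : K → List B) :
    update (joinStacks i s) none j = joinStacks j s := by
  funext k
  cases k <;> simp [joinStacks]

/-! ### Compilation of programs to TM2 statements -/

variable [Inhabited B] {Λ : Type}

/-- A push may be void, so it becomes a branch with the remaining code in both arms. The component
`Option A` of the state is left alone; it serves only to load the input. -/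
def compileActs : List (Act K σ B) → TM2.Stmt (Alphabet K A B) Λ (Option A × σ) →
    TM2.Stmt (Alphabet K A B) Λ (Option A × σ)
  | [], q => q
  | .push k f :: l, q =>
    .branch (fun v => (f v.2).isSome)
      (.push (some k) (fun v => (f v.2).getD default) (compileActs l q)) (compileActs l q)
  | .pop k f :: l, q => .pop (some k) (fun v b => (v.1, f v.2 b)) (compileActs l q)
  | .peek k f :: l, q => .peek (some k) (fun v b => (v.1, f v.2 b)) (compileActs l q)

/-- A whole block of actions runs inside one statement, hence in a single machine step; this
justifies the cost `1` in `Exec.acts`. -/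
theorem stepAux_compileActs (l : List (Act K σ B))
    (q : TM2.Stmt (Alphabet K A B) Λ (Option A × σ)) (x : Option A) (i : List A)
    (c : σ × (K → List B)) :
    TM2.stepAux (compileActs l q) (x, c.1) (joinStacks i c.2) =
      TM2.stepAux q (x, (runActs l c).1) (joinStacks i (runActs l c).2) := by
  induction l generalizing c with
  | nil => rfl
  | cons a l ih =>
    cases a with
    | push k f =>
      simp only [compileActs, TM2.stepAux, runActs]
      rw [← ih]
      cases h : f c.1 with
      | none => simp [Act.run, h]
      | some b => simp [Act.run, h, update_joinStacks]; rfl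
    | pop k f =>
      simp only [compileActs, TM2.stepAux, runActs]
      rw [← ih, update_joinStacks]
      rfl
    | peek k f =>
      simp only [compileActs, TM2.stepAux, runActs]
      rw [← ih]
      rfl

/-- Here `e` places the labels of the subprogram among those of the machine, and `x` is the label to
jump to on exit. The body of a loop exits to the head of the loop. -/
def Prog.stmt : (p : Prog K σ B) → (p.Lab → Λ) → Λ → p.Lab →
    TM2.Stmt (Alphabet K A B) Λ (Option A × σ)
  | .acts l, _, x, _ => compileActs l (.goto fun _ => x)
  | .seq p q, e, x, l => match l with
    | Sum.inl l => p.stmt (fun l => e (Sum.inl l)) (e (Sum.inr q.entry)) l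
    | Sum.inr l => q.stmt (fun l => e (Sum.inr l)) x l
  | .ite a c p q, e, x, l => match l with
    | none => compileActs a (.branch (fun v => c v.2)
        (.goto fun _ => e (some (Sum.inl p.entry))) (.goto fun _ => e (some (Sum.inr q.entry))))
    | some (Sum.inl l) => p.stmt (fun l => e (some (Sum.inl l))) x l
    | some (Sum.inr l) => q.stmt (fun l => e (some (Sum.inr l))) x l
  | .loop a c p, e, x, l => match l with
    | none => compileActs a (.branch (fun v => c v.2)
        (.goto fun _ => e (some p.entry)) (.goto fun _ => x))
    | some l => p.stmt (fun l => e (some l)) (e none) l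

/-- The machine goes from `a` to `b` in `t` steps. -/
def Steps {C : Type} (f : C → Option C) (t : ℕ) (a b : C) : Prop :=
  (flip bind f)^[t] (some a) = some b

theorem Steps.trans {C : Type} {f : C → Option C} {t t' : ℕ} {a b c : C} (h : Steps f t a b)
    (h' : Steps f t' b c) : Steps f (t + t') a c := by
  unfold Steps at *
  rw [Nat.add_comm, iterate_add_apply, h, h']

theorem Steps.one {C : Type} {f : C → Option C} {a b : C} (h : f a = some b) : Steps f 1 a b := h

/-- The machine `M` is arbitrary except on the image of `e`, so the induction hypotheses apply to
subprograms inside the same machine, each with its own exit label. -/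
theorem Exec.steps {p : Prog K σ B} {c c' : σ × (K → List B)} {t : ℕ} (h : Exec p c c' t)
    {e : p.Lab → Λ} {x : Λ} {M : Λ → TM2.Stmt (Alphabet K A B) Λ (Option A × σ)}
    (hM : ∀ l, M (e l) = p.stmt e x l) (y : Option A) (i : List A) :
    Steps (TM2.step M) t ⟨some (e p.entry), (y, c.1), joinStacks i c.2⟩
      ⟨some x, (y, c'.1), joinStacks i c'.2⟩ := by
  induction h generalizing x with
  | acts l c =>
    apply Steps.one
    simp only [TM2.step, hM, Prog.stmt, stepAux_compileActs]
    rfl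
  | seq _ _ ih ih' =>
    exact (ih (fun l => hM (Sum.inl l))).trans (ih' (fun l => hM (Sum.inr l)))
  | ite_true hb _ ih =>
    refine Steps.trans (Steps.one ?_) (ih (fun l => hM (some (Sum.inl l))))
    refine (congrArg (fun q => some (TM2.stepAux q _ _)) (hM (none : Option _))).trans ?_
    simp only [Prog.stmt, stepAux_compileActs, TM2.stepAux, hb, cond_true]
  | ite_false hb _ ih =>
    refine Steps.trans (Steps.one ?_) (ih (fun l => hM (some (Sum.inr l))))
    refine (congrArg (fun q => some (TM2.stepAux q _ _)) (hM (none : Option _))).trans ?_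
    simp only [Prog.stmt, stepAux_compileActs, TM2.stepAux, hb, cond_false]
  | loop_true hb _ _ ih ih' =>
    refine Steps.trans (Steps.trans (Steps.one ?_) (ih (fun l => hM (some l)))) (ih' hM)
    refine (congrArg (fun q => some (TM2.stepAux q _ _)) (hM (none : Option _))).trans ?_
    simp only [Prog.stmt, stepAux_compileActs, TM2.stepAux, hb, cond_true]
  | loop_false hb =>
    refine Steps.one ?_
    refine (congrArg (fun q => some (TM2.stepAux q _ _)) (hM (none : Option _))).trans ?_
    simp only [Prog.stmt, stepAux_compileActs, TM2.stepAux, hb, cond_false]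

/-! ### From programs to polynomial-time machines -/

section Machine

/-- The machine that moves its input to the stack `kin` (reversing it), runs `p` and stops. -/
def machineStmt (emb : A → B) (kin : K) (v₀ : σ) (p : Prog K σ B) :
    p.Lab ⊕ Bool → TM2.Stmt (Alphabet K A B) (p.Lab ⊕ Bool) (Option A × σ)
  | Sum.inl l => p.stmt Sum.inl (Sum.inr true) l
  | Sum.inr false =>
    .pop none (fun v a => (a, v.2)) <|
    .branch (fun v => v.1.isSome)
      (.push (some kin) (fun v => (v.1.map emb).getD default) <| .goto fun _ => Sum.inr false)
      (.goto fun _ => Sum.inl p.entry)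
  | Sum.inr true => .load (fun _ => (none, v₀)) .halt

/-- One step per input symbol and one more to notice that the input is exhausted. Popping and
pushing reverses the word. -/
theorem steps_load (emb : A → B) (kin : K) (v₀ : σ) (p : Prog K σ B) (w : List A)
    (s : K → List B) (y : Option A) :
    Steps (TM2.step (machineStmt emb kin v₀ p)) (w.length + 1)
      ⟨some (Sum.inr false), (y, v₀), joinStacks w s⟩
      ⟨some (Sum.inl p.entry), (none, v₀),
        joinStacks [] (update s kin ((w.map emb).reverse ++ s kin))⟩ := by
  induction w generalizing s y with
  | nil =>
    apply Steps.one
    simp [TM2.step, machineStmt, TM2.stepAux, update_joinStacks_none]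
    simp [joinStacks]
  | cons a w ih =>
    have h := ih (update s kin (emb a :: s kin)) (some a)
    rw [List.length_cons, Nat.add_comm]
    refine Steps.trans (Steps.one (b := ⟨some (Sum.inr false), (some a, v₀), joinStacks w
      (update s kin (emb a :: s kin))⟩) ?_) ?_
    · simp [TM2.step, machineStmt, TM2.stepAux, update_joinStacks_none]
      simp [joinStacks, ← update_joinStacks]
    · simpa using h

variable [Fintype K] [Fintype σ] [Fintype A]

/-- The machine that runs `p` on its input. -/
def machine (emb : A → B) (kin kout : K) (v₀ : σ) (p : Prog K σ B) : FinTM2 where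
  K := Option K
  k₀ := none
  k₁ := some kout
  Γ := Alphabet K A B
  Λ := p.Lab ⊕ Bool
  main := Sum.inr false
  σ := Option A × σ
  initialState := (none, v₀)
  Γk₀Fin := inferInstanceAs (Fintype A)
  m := machineStmt emb kin v₀ p

theorem initList_machine (emb : A → B) (kin kout : K) (v₀ : σ) (p : Prog K σ B) (w : List A) :
    initList (machine emb kin kout v₀ p) w =
      (⟨some (Sum.inr false), (none, v₀), joinStacks w fun _ => []⟩ :
        TM2.Cfg (Alphabet K A B) (p.Lab ⊕ Bool) (Option A × σ)) := by
  unfold initList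
  refine congrArg (TM2.Cfg.mk (Γ := Alphabet K A B) (some (Sum.inr false)) (none, v₀)) ?_
  funext k
  cases k with
  | none => rfl
  | some k => rfl

theorem haltList_machine (emb : A → B) (kin kout : K) (v₀ : σ) (p : Prog K σ B) (u : List B) :
    haltList (machine emb kin kout v₀ p) u =
      (⟨none, (none, v₀), joinStacks [] (update (fun _ => []) kout u)⟩ :
        TM2.Cfg (Alphabet K A B) (p.Lab ⊕ Bool) (Option A × σ)) := by
  unfold haltList
  refine congrArg (TM2.Cfg.mk (Γ := Alphabet K A B) none (none, v₀)) ?_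
  funext k
  cases k with
  | none => rfl
  | some k =>
    by_cases hk : k = kout
    · subst hk
      rw [joinStacks, update_self]
      exact dif_pos rfl
    · simp [joinStacks, machine, hk]

/-- The time is that of the program plus `length + 1` for loading and `1` for halting. The input is
reversed in the hypothesis because loading turns it over. -/
theorem polyTime_of_runs {α : Type} (ea : α → List A) (f : α → List B) (emb : A → B)
    (kin kout : K) (v₀ : σ) (p : Prog K σ B) (P : Polynomial ℕ)
    (h : ∀ a, Runs p (update (fun _ => []) kin ((ea a).map emb).reverse)
      (update (fun _ => []) kout (f a)) (P.eval (ea a).length)) :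
    Nonempty (TM2ComputableInPolyTime ea (fun u : List B => u) f) := by
  refine ⟨⟨⟨machine emb kin kout v₀ p, Equiv.refl A, Equiv.refl B⟩, P + Polynomial.X + 2,
    fun a => ?_⟩⟩
  -- The machine interface presents the words as images under the identity equivalences of
  -- alphabets; quantifying over equal words absorbs these maps.
  have key : ∀ (w : List A) (u : List B), w = ea a → u = f a →
      ∃ t, t ≤ (P + Polynomial.X + 2).eval (ea a).length ∧
      Steps (machine emb kin kout v₀ p).step t
        (initList (machine emb kin kout v₀ p) w) (haltList (machine emb kin kout v₀ p) u) := by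
    rintro w u rfl rfl
    rw [initList_machine, haltList_machine]
    obtain ⟨v', t, ht, hE⟩ := h a v₀
    refine ⟨(ea a).length + 1 + t + 1, by simp; omega, ?_⟩
    have h1 := steps_load emb kin v₀ p (ea a) (fun _ => []) none
    simp only [List.append_nil] at h1
    have h2 := hE.steps (A := A) (e := Sum.inl) (x := Sum.inr true)
      (M := machineStmt emb kin v₀ p) (fun _ => rfl) none []
    -- The last step resets the registers, because `haltList` demands the initial state.
    have h3 : Steps (TM2.step (machineStmt emb kin v₀ p)) 1
        ⟨some (Sum.inr true), (none, v'), joinStacks [] (update (fun _ => []) kout (f a))⟩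
        ⟨none, (none, v₀), joinStacks [] (update (fun _ => []) kout (f a))⟩ := rfl
    exact (h1.trans h2).trans h3
  have key := key _ _ (List.map_id _) (List.map_id _)
  exact ⟨⟨key.choose, key.choose_spec.2⟩, key.choose_spec.1⟩

end Machine

end StackProgram

/-! ### Basic stack procedures -/

namespace DecisionRules

open Function StackProgram

instance : Fintype RuleSymbol where
  elems := {.lparen, .rparen, .attr, .equal, .conj, .arrow, .zero, .one, .semicolon}
  complete x := by cases x <;> decide

instance : Fintype TreeSymbol where
  elems := Finset.univ.image TreeSymbol.rule ∪ {.star, .lbrace, .rbrace, .lbracket, .rbracket}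
  complete x := by cases x <;> simp

instance : Inhabited TreeSymbol := ⟨.star⟩

/-- The stacks of the machines. -/
inductive Stk where
  | a | m | n | w | r | t | u | o | c | out
  deriving DecidableEq

instance : Fintype Stk where
  elems := {.a, .m, .n, .w, .r, .t, .u, .o, .c, .out}
  complete x := by cases x <;> decide

/-- The contents of the stacks. -/
structure Stacks where
  a : List TreeSymbol := []
  m : List TreeSymbol := []
  n : List TreeSymbol := []
  w : List TreeSymbol := []
  r : List TreeSymbol := []
  t : List TreeSymbol := []
  u : List TreeSymbol := []
  o : List TreeSymbol := []
  c : List TreeSymbol := []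
  out : List TreeSymbol := []

/-- Roles of the stacks in the programs for short rules: `a` holds the rules still to be processed,
`r` the current rule, `m` and `n` the matching and the other rules after a split, `w` rules set
aside; `t` and `u` are scratch, `o` is the output in reverse, `c` collects the closing brackets
still owed. The input is loaded into `t`. -/
def Stacks.get (s : Stacks) : Stk → List TreeSymbol
  | .a => s.a
  | .m => s.m
  | .n => s.n
  | .w => s.w
  | .r => s.r
  | .t => s.t
  | .u => s.u
  | .o => s.o
  | .c => s.c
  | .out => s.out

def Stacks.set (s : Stacks) (k : Stk) (l : List TreeSymbol) : Stacks :=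
  match k with
  | .a => { s with a := l }
  | .m => { s with m := l }
  | .n => { s with n := l }
  | .w => { s with w := l }
  | .r => { s with r := l }
  | .t => { s with t := l }
  | .u => { s with u := l }
  | .o => { s with o := l }
  | .c => { s with c := l }
  | .out => { s with out := l }

theorem Stacks.update_get (s : Stacks) (k : Stk) (l : List TreeSymbol) :
    update s.get k l = (s.set k l).get := by
  funext k'
  cases k <;> cases k' <;> rfl

/-- Two registers. -/
abbrev Regs := Option TreeSymbol × Option TreeSymbol

abbrev Program := Prog Stk Regs TreeSymbol

abbrev popX (k : Stk) : Act Stk Regs TreeSymbol := .pop k fun v b => (b, v.2)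
abbrev popY (k : Stk) : Act Stk Regs TreeSymbol := .pop k fun v b => (v.1, b)
abbrev peekX (k : Stk) : Act Stk Regs TreeSymbol := .peek k fun v b => (b, v.2)
abbrev peekY (k : Stk) : Act Stk Regs TreeSymbol := .peek k fun v b => (v.1, b)
abbrev pushX (k : Stk) : Act Stk Regs TreeSymbol := .push k fun v => v.1
abbrev pushY (k : Stk) : Act Stk Regs TreeSymbol := .push k fun v => v.2
abbrev pushC (k : Stk) (b : TreeSymbol) : Act Stk Regs TreeSymbol := .push k fun _ => some b

/-- `p` transforms the stacks `s` into `s'` within `n` steps. -/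
abbrev Trans (p : Program) (s s' : Stacks) (n : ℕ) : Prop := Runs p s.get s'.get n

def move (j k : Stk) : Program := .loop [popX j] (fun v => v.1.isSome) (.acts [pushX k])

def clear (j : Stk) : Program := .loop [popX j] (fun v => v.1.isSome) (.acts [])

/-- Move the symbols up to `d` (included). -/
def transfer (d : TreeSymbol) (j k : Stk) : Program :=
  .loop [popX j, pushX k] (fun v => !decide (v.1 = some d)) (.acts [])

/-- Move the symbols up to `d` (included) and copy those before `d` to the stack `o`. -/
def transferCopy (d : TreeSymbol) (j k : Stk) : Program :=
  .loop [popX j, pushX k] (fun v => !decide (v.1 = some d)) (.acts [pushX .o])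

/-- The body pushes the symbol that the guard left in a register. Since `Runs` forgets registers,
the induction is on `Exec`. -/
theorem exec_move {j k : Stk} (hjk : j ≠ k) (l : List TreeSymbol) (v : Regs)
    (s : Stk → List TreeSymbol) (hs : s j = l) :
    ∃ v', Exec (move j k) (v, s) (v', update (update s j []) k (l.reverse ++ s k))
      (2 * l.length + 1) := by
  unfold move
  induction l generalizing v s with
  | nil =>
    refine ⟨(none, v.2), ?_⟩
    have h := Exec.loop_false (l := [popX j]) (b := fun v => v.1.isSome)
      (p := Prog.acts [pushX k]) (c := (v, s)) (by simp [runActs, Act.run, hs])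
    have e : runActs [popX j] (v, s) =
        ((none, v.2), update (update s j []) k (([] : List TreeSymbol).reverse ++ s k)) := by
      simp only [runActs, Act.run, hs, List.head?_nil, List.tail_nil, List.reverse_nil,
        List.nil_append]
      rw [← update_of_ne hjk.symm ([] : List TreeSymbol) s, update_eq_self]
    rw [e] at h
    exact h
  | cons b l ih =>
    obtain ⟨v', h⟩ := ih (some b, v.2) (update (update s j l) k (b :: s k)) (by simp [hjk])
    refine ⟨v', ?_⟩
    have h1 := Exec.loop_true (l := [popX j]) (b := fun v => v.1.isSome)
      (p := Prog.acts [pushX k]) (c := (v, s)) (by simp [runActs, Act.run, hs])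
      (Exec.acts _ _) (by simpa [runActs, Act.run, hs, hjk.symm] using h)
    convert h1 using 1
    · rw [update_comm hjk.symm]
      simp
    · simp; ring

theorem trans_move {j k : Stk} (hjk : j ≠ k) (s : Stacks) :
    Trans (move j k) s ((s.set j []).set k ((s.get j).reverse ++ s.get k))
      (2 * (s.get j).length + 1) := fun v => by
  obtain ⟨v', h⟩ := exec_move hjk _ v s.get rfl
  refine ⟨v', _, le_rfl, ?_⟩
  rwa [Stacks.update_get, Stacks.update_get] at h

theorem exec_clear {j : Stk} (l : List TreeSymbol) (v : Regs)
    (s : Stk → List TreeSymbol) (hs : s j = l) :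
    ∃ v', Exec (clear j) (v, s) (v', update s j []) (2 * l.length + 1) := by
  unfold clear
  induction l generalizing v s with
  | nil =>
    refine ⟨(none, v.2), ?_⟩
    have h := Exec.loop_false (l := [popX j]) (b := fun v => v.1.isSome)
      (p := Prog.acts []) (c := (v, s)) (by simp [runActs, Act.run, hs])
    simpa [runActs, Act.run, hs] using h
  | cons b l ih =>
    obtain ⟨v', h⟩ := ih (some b, v.2) (update s j l) (by simp)
    refine ⟨v', ?_⟩
    have h1 := Exec.loop_true (l := [popX j]) (b := fun v => v.1.isSome)
      (p := Prog.acts []) (c := (v, s)) (by simp [runActs, Act.run, hs])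
      (Exec.acts _ _) (by simpa [runActs, Act.run, hs] using h)
    convert h1 using 1
    simp; ring

theorem trans_clear (j : Stk) (s : Stacks) :
    Trans (clear j) s (s.set j []) (2 * (s.get j).length + 1) := fun v => by
  obtain ⟨v', h⟩ := exec_clear _ v s.get rfl
  refine ⟨v', _, le_rfl, ?_⟩
  rwa [Stacks.update_get] at h

theorem exec_transfer {d : TreeSymbol} {j k : Stk} (hjk : j ≠ k) (l l' : List TreeSymbol)
    (hd : d ∉ l) (v : Regs) (s : Stk → List TreeSymbol) (hs : s j = l ++ d :: l') :
    ∃ v', Exec (transfer d j k) (v, s) (v', update (update s j l') k (d :: l.reverse ++ s k))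
      (2 * l.length + 1) := by
  unfold transfer
  induction l generalizing v s with
  | nil =>
    refine ⟨(some d, v.2), ?_⟩
    have h := Exec.loop_false (l := [popX j, pushX k]) (b := fun v => !decide (v.1 = some d))
      (p := Prog.acts []) (c := (v, s)) (by simp [runActs, Act.run, hs])
    simpa [runActs, Act.run, hs, hjk.symm] using h
  | cons b l ih =>
    simp only [List.mem_cons, not_or] at hd
    obtain ⟨v', h⟩ := ih hd.2 (some b, v.2) (update (update s j (l ++ d :: l')) k (b :: s k))
      (by simp [hjk])
    refine ⟨v', ?_⟩
    have h1 := Exec.loop_true (l := [popX j, pushX k]) (b := fun v => !decide (v.1 = some d))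
      (p := Prog.acts []) (c := (v, s)) (by simp [runActs, Act.run, hs, Ne.symm hd.1])
      (Exec.acts _ _) (by simpa [runActs, Act.run, hs, hjk.symm] using h)
    convert h1 using 1
    · rw [update_comm hjk.symm]
      simp
    · simp; ring

theorem trans_transfer {d : TreeSymbol} {j k : Stk} (hjk : j ≠ k) (s : Stacks)
    (l l' : List TreeSymbol) (hd : d ∉ l) (hs : s.get j = l ++ d :: l') :
    Trans (transfer d j k) s ((s.set j l').set k (d :: l.reverse ++ s.get k))
      (2 * l.length + 1) := fun v => by
  obtain ⟨v', h⟩ := exec_transfer hjk l l' hd v s.get hs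
  refine ⟨v', _, le_rfl, ?_⟩
  rwa [Stacks.update_get, Stacks.update_get] at h

theorem exec_transferCopy {d : TreeSymbol} {j k : Stk} (hjk : j ≠ k) (hj : j ≠ .o) (hk : k ≠ .o)
    (l l' : List TreeSymbol) (hd : d ∉ l) (v : Regs) (s : Stk → List TreeSymbol)
    (hs : s j = l ++ d :: l') :
    ∃ v', Exec (transferCopy d j k) (v, s)
      (v', update (update (update s j l') k (d :: l.reverse ++ s k)) .o (l.reverse ++ s .o))
      (2 * l.length + 1) := by
  unfold transferCopy
  induction l generalizing v s with
  | nil =>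
    refine ⟨(some d, v.2), ?_⟩
    have h := Exec.loop_false (l := [popX j, pushX k]) (b := fun v => !decide (v.1 = some d))
      (p := Prog.acts [pushX .o]) (c := (v, s)) (by simp [runActs, Act.run, hs])
    have e : s .o = (update (update s j l') k (d :: s k)) .o := by simp [hj.symm, hk.symm]
    have e' : update (update (update s j l') k (d :: s k)) .o (s .o) =
        update (update s j l') k (d :: s k) := by
      conv_lhs => rw [e]
      rw [update_eq_self]
    simpa [runActs, Act.run, hs, hjk.symm, e'] using h
  | cons b l ih =>
    simp only [List.mem_cons, not_or] at hd
    obtain ⟨v', h⟩ := ih hd.2 (some b, v.2)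
      (update (update (update s j (l ++ d :: l')) k (b :: s k)) .o (b :: s .o))
      (by simp [hjk, hj])
    refine ⟨v', ?_⟩
    have h1 := Exec.loop_true (l := [popX j, pushX k]) (b := fun v => !decide (v.1 = some d))
      (p := Prog.acts [pushX .o]) (c := (v, s)) (by simp [runActs, Act.run, hs, Ne.symm hd.1])
      (Exec.acts _ _)
      (by simpa [runActs, Act.run, hs, hjk.symm, hj.symm, hk.symm] using h)
    convert h1 using 1
    · congr 1
      funext k'
      simp only [update_apply, hjk.symm, hk, if_false, if_true,
        List.reverse_cons, List.append_assoc, List.cons_append, List.nil_append]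
      split_ifs <;> simp_all
    · simp; ring

theorem trans_transferCopy {d : TreeSymbol} {j k : Stk} (hjk : j ≠ k) (hj : j ≠ .o) (hk : k ≠ .o)
    (s : Stacks) (l l' : List TreeSymbol) (hd : d ∉ l) (hs : s.get j = l ++ d :: l') :
    Trans (transferCopy d j k) s
      (((s.set j l').set k (d :: l.reverse ++ s.get k)).set .o (l.reverse ++ s.get .o))
      (2 * l.length + 1) := fun v => by
  obtain ⟨v', h⟩ := exec_transferCopy hjk hj hk l l' hd v s.get hs
  refine ⟨v', _, le_rfl, ?_⟩
  rwa [Stacks.update_get, Stacks.update_get, Stacks.update_get] at h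

theorem trans_push (k : Stk) (b : TreeSymbol) (s : Stacks) :
    Trans (.acts [pushC k b]) s (s.set k (b :: s.get k)) 1 := fun v =>
  ⟨v, 1, le_rfl, by
    have h := Exec.acts [pushC k b] (v, s.get)
    simpa only [runActs, Act.run, Stacks.update_get] using h⟩

/-! ### Splitting a list of words -/

abbrev semi : TreeSymbol := .rule .semicolon

/-- The words `W c`, each followed by a semicolon. -/
def encode {α : Type} (W : α → List TreeSymbol) (L : List α) : List TreeSymbol :=
  L.flatMap fun c => W c ++ [semi]

/-- The words `x` and `y` can be compared up to the delimiter `d`, with the result `b`. -/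
def Compare (d : TreeSymbol) (x y : List TreeSymbol) (b : Bool) : Prop :=
  ∃ p e e' x' y', d ∉ p ∧ x = p ++ e :: x' ∧ y = p ++ e' :: y' ∧
    (e = e' → e = d) ∧ (b = true ↔ e = e')

def compareLoop (d : TreeSymbol) : Program :=
  .loop [popX .a, popY .r, pushX .t, pushY .u] (fun v => v.1 = v.2 ∧ v.1 ≠ some d) (.acts [])

/-- Finish the reading of a word and restore the word of the stack `r`. -/
def restore : Program := .seq (transfer semi .a .t) (move .u .r)

/-- Move the first word of the stack `a` to the stack `m` or `n`, depending on whether it agrees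
with the word of the stack `r` up to `d`. -/
def splitStep (d : TreeSymbol) : Program :=
  .seq (compareLoop d) <|
    .ite [peekX .t, peekY .u] (fun v => v.1 = v.2)
      (.seq restore (move .t .m)) (.seq restore (move .t .n))

def split (d : TreeSymbol) : Program := .loop [peekX .a] (fun v => v.1.isSome) (splitStep d)

/-- The loop stops at the first disagreement or at a common `d`. The two symbols read last lie on
top of `t` and `u`, so the verdict can be read off later, and nothing of either word is lost. -/
theorem trans_compareLoop {d e e' : TreeSymbol} (he : e = e' → e = d) (p x y : List TreeSymbol)
    (hd : d ∉ p) (s : Stacks) (ha : s.a = p ++ e :: x) (hr : s.r = p ++ e' :: y) :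
    Trans (compareLoop d) s { s with
      a := x, r := y, t := e :: p.reverse ++ s.t, u := e' :: p.reverse ++ s.u }
      (2 * p.length + 1) := by
  induction p generalizing s with
  | nil =>
    refine Runs.loop_false fun v => ⟨(some e, some e'), ?_, ?_⟩
    · simp [runActs, Act.run, Stacks.update_get, Stacks.get, Stacks.set, ha, hr]
    · simpa using he
  | cons b p ih =>
    simp only [List.mem_cons, not_or] at hd
    have h := ih hd.2 { s with
      a := p ++ e :: x, r := p ++ e' :: y, t := b :: s.t, u := b :: s.u } rfl rfl
    have h1 := Runs.loop_true (l := [popX .a, popY .r, pushX .t, pushY .u])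
      (c := fun v => v.1 = v.2 ∧ v.1 ≠ some d) (p := .acts []) (s := s.get) (m := 1)
      (fun v => ⟨(some b, some b), by
        simp [runActs, Act.run, Stacks.update_get, Stacks.get, Stacks.set, ha, hr],
        by simpa using Ne.symm hd.1⟩)
      (fun v => ⟨v, 1, le_rfl, Exec.acts _ _⟩) h
    refine Runs.mono ?_ (show 1 + 1 + (2 * p.length + 1) ≤ _ by simp; omega)
    simpa [compareLoop] using h1

theorem trans_restore (s : Stacks) (x A : List TreeSymbol) (hx : semi ∉ x)
    (ha : s.a = x ++ semi :: A) :
    Trans restore s { s with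
      a := A, t := semi :: x.reverse ++ s.t, u := [], r := s.u.reverse ++ s.r }
      (2 * x.length + 1 + (2 * s.u.length + 1)) := by
  refine Runs.seq (trans_transfer (by decide) s x A hx ha) ?_
  simpa [Stacks.set, Stacks.get] using trans_move (j := .u) (k := .r) (by decide)
    { s with a := A, t := semi :: x.reverse ++ s.t }

theorem trans_splitStep {d : TreeSymbol} {x y A : List TreeSymbol} {b : Bool}
    (h : Compare d x y b) (hx : semi ∉ x) {k : ℕ} (hxk : x.length ≤ k) (hyk : y.length ≤ k)
    (s : Stacks)
    (ha : s.a = x ++ semi :: A) (hr : s.r = y ++ [semi]) (ht : s.t = []) (hu : s.u = []) :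
    Trans (splitStep d) s { s with
      a := A
      m := if b then x ++ semi :: s.m else s.m
      n := if b then s.n else x ++ semi :: s.n } (6 * k + 10) := by
  obtain ⟨p, e, e', x', y', hp, rfl, rfl, he, hb⟩ := h
  simp only [List.length_append, List.length_cons] at hxk hyk
  have h1 := trans_compareLoop he p (x' ++ semi :: A) (y' ++ [semi]) hp s (by simp [ha])
    (by simp [hr])
  have h2 := trans_restore { s with
      a := x' ++ semi :: A, r := y' ++ [semi], t := e :: p.reverse ++ s.t,
      u := e' :: p.reverse ++ s.u } x' A (by simp at hx; tauto) rfl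
  rcases s with ⟨sa, sm, sn, sw, sr, st, su, so, sc, sout⟩
  simp only at ha hr ht hu
  subst ha hr ht hu
  simp only [List.append_nil, List.length_cons, List.length_reverse, List.reverse_cons,
    List.reverse_reverse, List.append_assoc, List.cons_append, List.nil_append] at h1 h2 ⊢
  cases b with
  | true =>
    have h3 := trans_move (j := .t) (k := .m) (by decide) ⟨A, sm, sn, sw,
      p ++ e' :: (y' ++ [semi]), semi :: (x'.reverse ++ e :: p.reverse), [], so, sc, sout⟩
    simp only [Stacks.set, Stacks.get, List.reverse_cons, List.reverse_append,
      List.reverse_reverse, List.append_assoc, List.cons_append, List.nil_append] at h3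
    -- The tops `e` and `e'` decide the branch; by `Compare` their equality is the value of `b`.
    refine Runs.mono (Runs.seq h1 (Runs.ite_true (fun v => ⟨(some e, some e'), rfl, ?_⟩)
      (Runs.seq h2 h3))) ?_
    · simpa using hb.1 rfl
    · simp; omega
  | false =>
    have h3 := trans_move (j := .t) (k := .n) (by decide) ⟨A, sm, sn, sw,
      p ++ e' :: (y' ++ [semi]), semi :: (x'.reverse ++ e :: p.reverse), [], so, sc, sout⟩
    simp only [Stacks.set, Stacks.get, List.reverse_cons, List.reverse_append,
      List.reverse_reverse, List.append_assoc, List.cons_append, List.nil_append] at h3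
    refine Runs.mono (Runs.seq h1 (Runs.ite_false (fun v => ⟨(some e, some e'), rfl, ?_⟩)
      (Runs.seq h2 h3))) ?_
    · simpa using hb
    · simp; omega

/-- Stacking the words one by one reverses both sublists. -/
theorem trans_split {α : Type} (W : α → List TreeSymbol) {d : TreeSymbol} {y : List TreeSymbol}
    {k : ℕ} (hy : y.length ≤ k) (f : α → Bool) (L : List α)
    (hW : ∀ c ∈ L, semi ∉ W c ∧ (W c).length ≤ k ∧ Compare d (W c) y (f c)) (s : Stacks)
    (ha : s.a = encode W L) (hr : s.r = y ++ [semi]) (ht : s.t = []) (hu : s.u = []) :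
    Trans (split d) s { s with
      a := []
      m := encode W (L.filter f).reverse ++ s.m
      n := encode W (L.filter fun c => !f c).reverse ++ s.n } (L.length * (6 * k + 11) + 1) := by
  induction L generalizing s with
  | nil =>
    rcases s with ⟨sa, sm, sn, sw, sr, st, su, so, sc, sout⟩
    simp only [encode, List.flatMap_nil] at ha
    subst ha
    exact (Runs.loop_false fun v => ⟨(none, v.2), rfl, rfl⟩).mono (by simp)
  | cons c L ih =>
    obtain ⟨h1, h2, h3⟩ := hW c (by simp)
    have ha' : s.a = W c ++ semi :: encode W L := by simp [ha, encode]
    have hs := trans_splitStep h3 h1 h2 hy s ha' hr ht hu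
    have hl := ih (fun c hc => hW c (by simp [hc])) { s with
      a := encode W L
      m := if f c then W c ++ semi :: s.m else s.m
      n := if f c then s.n else W c ++ semi :: s.n } rfl hr ht hu
    refine Runs.mono (Runs.loop_true (s₁ := s.get)
      (fun v => ⟨(s.a.head?, v.2), rfl, ?_⟩) hs (s' := _) (n := L.length * (6 * k + 11) + 1) ?_) ?_
    · rw [ha']; cases W c <;> rfl
    · cases hfc : f c <;> simpa [split, List.filter_cons, encode, hfc] using hl
    · simp; ring_nf; omega

/-! ### Grouping rules of length at most one -/

/-- The binary representation as a word over the tree alphabet. -/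
def bin (n : ℕ) : List TreeSymbol := (binary n).map .rule

theorem mem_binary {n : ℕ} {x : RuleSymbol} (h : x ∈ binary n) : x = .zero ∨ x = .one := by
  unfold binary at h
  split_ifs at h
  · simp at h; tauto
  · simp only [List.mem_map] at h
    obtain ⟨b, -, rfl⟩ := h
    split_ifs <;> simp

theorem notMem_bin {n : ℕ} {x : TreeSymbol} (h0 : x ≠ .rule .zero) (h1 : x ≠ .rule .one) :
    x ∉ bin n := by
  intro h
  simp only [bin, List.mem_map] at h
  obtain ⟨y, hy, rfl⟩ := h
  rcases mem_binary hy with rfl | rfl <;> simp_all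

theorem binary_injective : Injective binary := by
  have : LeftInverse (fun l : List RuleSymbol =>
      Nat.ofDigits 2 (l.reverse.map fun x => if x = .zero then 0 else 1)) binary := by
    intro n
    unfold binary
    split_ifs with h
    · simp [h]
    · simp only [← List.map_reverse, List.reverse_reverse, List.map_map]
      conv_rhs => rw [← Nat.ofDigits_digits 2 n]
      congr 1
      conv_rhs => rw [← List.map_id (Nat.digits 2 n)]
      refine List.map_congr_left fun b hb => ?_
      have := Nat.digits_lt_base (by norm_num : 1 < 2) hb
      interval_cases b <;> simp
  exact this.injective

theorem bin_injective : Injective bin := fun m n h =>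
  binary_injective (List.map_injective_iff.2 (fun a b h => by simpa using h) h)

/-- A rule of length at most one: the equation, if any, and the right-hand side. -/
abbrev Item := Option (ℕ × ℕ) × ℕ

def itemWord : Item → List TreeSymbol
  | (none, σ) => .rule .arrow :: bin σ
  | (some (i, δ), σ) =>
    .rule .lparen :: .rule .attr :: (bin i ++ .rule .equal :: (bin δ ++ .rule .rparen ::
      .rule .arrow :: bin σ))

theorem semi_notMem_itemWord (c : Item) : semi ∉ itemWord c := by
  rcases c with ⟨_ | ⟨i, δ⟩, σ⟩ <;> simp [itemWord, notMem_bin]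

/-- As `u` and `v` avoid `d`, the first disagreement of `u d …` and `v d …`, if there is one up to
the first `d`, shows `u ≠ v`; if there is none, both words reach `d` together and `u = v`. -/
theorem compare_of_append {d : TreeSymbol} (q u v x y : List TreeSymbol) (hq : d ∉ q)
    (hu : d ∉ u) (hv : d ∉ v) :
    Compare d (q ++ (u ++ d :: x)) (q ++ (v ++ d :: y)) (decide (u = v)) := by
  induction q with
  | nil =>
    induction u generalizing v with
    | nil =>
      cases v with
      | nil => exact ⟨[], d, d, x, y, by simp, by simp, by simp, by simp, by simp⟩
      | cons b v =>
        simp only [List.mem_cons, not_or] at hv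
        exact ⟨[], d, b, x, v ++ d :: y, by simp, by simp, by simp, by simp, by simpa using hv.1⟩
    | cons b u ih =>
      simp only [List.mem_cons, not_or] at hu
      cases v with
      | nil =>
        exact ⟨[], b, d, u ++ d :: x, y, by simp, by simp, by simp, by simp,
          by simpa using Ne.symm hu.1⟩
      | cons b' v =>
        simp only [List.mem_cons, not_or] at hv
        by_cases hb : b = b'
        · subst hb
          obtain ⟨p, e, e', x', y', h1, h2, h3, h4, h5⟩ := ih v hu.2 hv.2
          refine ⟨b :: p, e, e', x', y', by simp [hu.1, h1], by simpa using h2,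
            by simpa using h3, h4, by simpa using h5⟩
        · exact ⟨[], b, b', u ++ d :: x, v ++ d :: y, by simp, by simp, by simp,
            fun h => absurd h hb, by simp [hb]⟩
  | cons b q ih =>
    simp only [List.mem_cons, not_or] at hq
    obtain ⟨p, e, e', x', y', h1, h2, h3, h4, h5⟩ := ih hq.2
    exact ⟨b :: p, e, e', x', y', by simp [hq.1, h1], by simpa using h2,
      by simpa using h3, h4, h5⟩

/-- The sign `=` ends the attribute field, so agreement up to it is equality of attributes. A rule
without equations begins with an arrow and disagrees at once. -/
theorem compare_attr (i δ σ : ℕ) (c : Item) :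
    Compare (.rule .equal) (itemWord c) (itemWord (some (i, δ), σ))
      (decide (c.1.map Prod.fst = some i)) := by
  rcases c with ⟨_ | ⟨i', δ'⟩, σ'⟩
  · exact ⟨[], _, _, _, _, by simp, rfl, rfl, by simp, by simp⟩
  · have := compare_of_append (d := .rule .equal) [.rule .lparen, .rule .attr] (bin i') (bin i)
      (bin δ' ++ .rule .rparen :: .rule .arrow :: bin σ')
      (bin δ ++ .rule .rparen :: .rule .arrow :: bin σ) (by simp) (notMem_bin (by simp) (by simp))
      (notMem_bin (by simp) (by simp))
    simpa [itemWord, bin_injective.eq_iff] using this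

/-- The same comparison, carried on to the closing parenthesis, also takes in the value. -/
theorem compare_equation (i δ σ : ℕ) (c : Item) :
    Compare (.rule .rparen) (itemWord c) (itemWord (some (i, δ), σ))
      (decide (c.1 = some (i, δ))) := by
  rcases c with ⟨_ | ⟨i', δ'⟩, σ'⟩
  · exact ⟨[], _, _, _, _, by simp, rfl, rfl, by simp, by simp⟩
  · have := compare_of_append (d := .rule .rparen) [.rule .lparen, .rule .attr]
      (bin i' ++ .rule .equal :: bin δ') (bin i ++ .rule .equal :: bin δ)
      (.rule .arrow :: bin σ') (.rule .arrow :: bin σ) (by simp)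
      (by simp [notMem_bin]) (by simp [notMem_bin])
    have e : (bin i' ++ .rule .equal :: bin δ' = bin i ++ .rule .equal :: bin δ) ↔
        i' = i ∧ δ' = δ := by
      constructor
      · intro h
        obtain ⟨h1, -, h2⟩ := (List.append_cons_inj_of_notMem (notMem_bin (by simp) (by simp))
          (notMem_bin (by simp) (by simp))).1 h
        exact ⟨bin_injective h1, bin_injective h2⟩
      · rintro ⟨rfl, rfl⟩; rfl
    simpa [itemWord, e] using this

/-- Move the first word of the stack `a` to the stack `r`. -/
def take : Program := .seq (transfer semi .a .t) (move .t .r)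

theorem trans_take (x A : List TreeSymbol) (hx : semi ∉ x) {k : ℕ} (hk : x.length ≤ k) (s : Stacks)
    (ha : s.a = x ++ semi :: A) (hr : s.r = []) (ht : s.t = []) :
    Trans take s { s with a := A, r := x ++ [semi] } (4 * k + 4) := by
  rcases s with ⟨sa, sm, sn, sw, sr, st, su, so, sc, sout⟩
  simp only at ha hr ht
  subst ha hr ht
  have h1 := trans_transfer (j := .a) (k := .t) (by decide)
    ⟨x ++ semi :: A, sm, sn, sw, [], [], su, so, sc, sout⟩ x A hx rfl
  have h2 := trans_move (j := .t) (k := .r) (by decide)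
    ⟨A, sm, sn, sw, [], semi :: x.reverse, su, so, sc, sout⟩
  simp [Stacks.set, Stacks.get] at h1 h2
  exact (h1.seq h2).mono (by omega)

/-- The word of an edge with the label `δ` to a terminal node. -/
def branchWord (i : ℕ) (p : ℕ × ℕ) : List TreeSymbol :=
  bin p.1 ++ .rule .arrow :: .lbrace :: (itemWord (some (i, p.1), p.2) ++ [.rbrace])

def emitBranch : Program :=
  .seq (transfer (.rule .equal) .r .t) <| .seq (transferCopy (.rule .rparen) .r .t) <|
  .seq (.acts [pushC .o (.rule .arrow)]) <| .seq (.acts [pushC .o .lbrace]) <|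
  .seq (move .t .r) <| .seq (transferCopy semi .r .t) <|
  .seq (.acts [pushC .o .rbrace]) (move .t .r)

theorem trans_emitBranch (i δ σ : ℕ) {k : ℕ} (hk : (itemWord (some (i, δ), σ)).length ≤ k)
    (s : Stacks) (hr : s.r = itemWord (some (i, δ), σ) ++ [semi]) (ht : s.t = []) :
    Trans emitBranch s { s with o := (branchWord i (δ, σ)).reverse ++ s.o } (8 * k + 12) := by
  rcases s with ⟨sa, sm, sn, sw, sr, st, su, so, sc, sout⟩
  simp only at hr ht
  subst hr ht
  have h1 := trans_transfer (d := .rule .equal) (j := .r) (k := .t) (by decide)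
    ⟨sa, sm, sn, sw, itemWord (some (i, δ), σ) ++ [semi], [], su, so, sc, sout⟩
    (.rule .lparen :: .rule .attr :: bin i)
    (bin δ ++ .rule .rparen :: .rule .arrow :: (bin σ ++ [semi])) (by simp [notMem_bin])
    (by simp [Stacks.get, itemWord])
  have h2 := trans_transferCopy (d := .rule .rparen) (j := .r) (k := .t) (by decide) (by decide)
    (by decide)
    ⟨sa, sm, sn, sw, bin δ ++ .rule .rparen :: .rule .arrow :: (bin σ ++ [semi]),
      .rule .equal :: (.rule .lparen :: .rule .attr :: bin i).reverse, su, so, sc, sout⟩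
    (bin δ) (.rule .arrow :: (bin σ ++ [semi])) (by simp [notMem_bin]) rfl
  have h3 := trans_push .o (.rule .arrow) ⟨sa, sm, sn, sw, .rule .arrow :: (bin σ ++ [semi]),
    .rule .rparen :: (bin δ).reverse ++
      .rule .equal :: (.rule .lparen :: .rule .attr :: bin i).reverse, su,
    (bin δ).reverse ++ so, sc, sout⟩
  have h4 := trans_push .o .lbrace ⟨sa, sm, sn, sw, .rule .arrow :: (bin σ ++ [semi]),
    .rule .rparen :: (bin δ).reverse ++
      .rule .equal :: (.rule .lparen :: .rule .attr :: bin i).reverse, su,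
    .rule .arrow :: ((bin δ).reverse ++ so), sc, sout⟩
  have h5 := trans_move (j := .t) (k := .r) (by decide)
    ⟨sa, sm, sn, sw, .rule .arrow :: (bin σ ++ [semi]),
    .rule .rparen :: (bin δ).reverse ++
      .rule .equal :: (.rule .lparen :: .rule .attr :: bin i).reverse, su,
    .lbrace :: .rule .arrow :: ((bin δ).reverse ++ so), sc, sout⟩
  have h6 := trans_transferCopy (d := semi) (j := .r) (k := .t) (by decide) (by decide)
    (by decide)
    ⟨sa, sm, sn, sw, itemWord (some (i, δ), σ) ++ [semi], [], su,
      .lbrace :: .rule .arrow :: ((bin δ).reverse ++ so), sc, sout⟩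
    (itemWord (some (i, δ), σ)) [] (semi_notMem_itemWord _) rfl
  have h7 := trans_push .o .rbrace ⟨sa, sm, sn, sw, [],
    semi :: (itemWord (some (i, δ), σ)).reverse, su,
    (itemWord (some (i, δ), σ)).reverse ++ .lbrace :: .rule .arrow :: ((bin δ).reverse ++ so),
    sc, sout⟩
  have h8 := trans_move (j := .t) (k := .r) (by decide) ⟨sa, sm, sn, sw, [],
    semi :: (itemWord (some (i, δ), σ)).reverse, su, .rbrace ::
    ((itemWord (some (i, δ), σ)).reverse ++ .lbrace :: .rule .arrow :: ((bin δ).reverse ++ so)),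
    sc, sout⟩
  simp [Stacks.set, Stacks.get, itemWord] at h1 h2 h3 h4 h5 h6 h7 h8
  simp only [itemWord, List.length_cons, List.length_append] at hk
  have := h1.seq <| h2.seq <| h3.seq <| h4.seq <| h5.seq <| h6.seq <| h7.seq h8
  refine Runs.mono (by simpa [emitBranch, branchWord, itemWord] using this) (by omega)

def headerWord (i : ℕ) : List TreeSymbol := .rule .attr :: (bin i ++ [.lbracket])

def emitHeader : Program :=
  .seq (transfer (.rule .lparen) .r .t) <| .seq (transferCopy (.rule .equal) .r .t) <|
  .seq (.acts [pushC .o .lbracket]) <| .seq (.acts [pushC .c .rbracket]) (move .t .r)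

theorem trans_emitHeader (i δ σ : ℕ) {k : ℕ} (hk : (itemWord (some (i, δ), σ)).length ≤ k)
    (s : Stacks) (hr : s.r = itemWord (some (i, δ), σ) ++ [semi]) (ht : s.t = []) :
    Trans emitHeader s
      { s with o := (headerWord i).reverse ++ s.o, c := .rbracket :: s.c } (4 * k + 12) := by
  rcases s with ⟨sa, sm, sn, sw, sr, st, su, so, sc, sout⟩
  simp only at hr ht
  subst hr ht
  have h1 := trans_transfer (d := .rule .lparen) (j := .r) (k := .t) (by decide)
    ⟨sa, sm, sn, sw, itemWord (some (i, δ), σ) ++ [semi], [], su, so, sc, sout⟩ []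
    (.rule .attr :: (bin i ++ .rule .equal ::
      (bin δ ++ .rule .rparen :: .rule .arrow :: (bin σ ++ [semi])))) (by simp)
    (by simp [Stacks.get, itemWord])
  have h2 := trans_transferCopy (d := .rule .equal) (j := .r) (k := .t) (by decide) (by decide)
    (by decide)
    ⟨sa, sm, sn, sw, .rule .attr :: (bin i ++ .rule .equal ::
      (bin δ ++ .rule .rparen :: .rule .arrow :: (bin σ ++ [semi]))), [.rule .lparen],
      su, so, sc, sout⟩
    (.rule .attr :: bin i) (bin δ ++ .rule .rparen :: .rule .arrow :: (bin σ ++ [semi]))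
    (by simp [notMem_bin]) rfl
  have h3 := trans_push .o .lbracket ⟨sa, sm, sn, sw,
    bin δ ++ .rule .rparen :: .rule .arrow :: (bin σ ++ [semi]),
    .rule .equal :: (.rule .attr :: bin i).reverse ++ [.rule .lparen], su,
    (.rule .attr :: bin i).reverse ++ so, sc, sout⟩
  have h4 := trans_push .c .rbracket ⟨sa, sm, sn, sw,
    bin δ ++ .rule .rparen :: .rule .arrow :: (bin σ ++ [semi]),
    .rule .equal :: (.rule .attr :: bin i).reverse ++ [.rule .lparen], su,
    .lbracket :: ((.rule .attr :: bin i).reverse ++ so), sc, sout⟩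
  have h5 := trans_move (j := .t) (k := .r) (by decide) ⟨sa, sm, sn, sw,
    bin δ ++ .rule .rparen :: .rule .arrow :: (bin σ ++ [semi]),
    .rule .equal :: (.rule .attr :: bin i).reverse ++ [.rule .lparen], su,
    .lbracket :: ((.rule .attr :: bin i).reverse ++ so), .rbracket :: sc, sout⟩
  simp [Stacks.set, Stacks.get] at h1 h2 h3 h4 h5
  simp only [itemWord, List.length_cons, List.length_append] at hk
  have := h1.seq <| h2.seq <| h3.seq <| h4.seq h5
  refine Runs.mono (by simpa [emitHeader, headerWord, itemWord] using this) (by omega)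

/-! ### Machines for systems of rules of length at most one -/

theorem length_encode_le {L : List Item} {k : ℕ} (h : ∀ c ∈ L, (itemWord c).length ≤ k)
    (hL : L.length ≤ k) : (encode itemWord L).length ≤ k * (k + 1) := by
  have : (encode itemWord L).length ≤ L.length * (k + 1) := by
    clear hL
    induction L with
    | nil => simp [encode]
    | cons c L ih =>
      have h1 := h c (by simp)
      have h2 := ih fun c hc => h c (by simp [hc])
      simp only [encode, List.flatMap_cons, List.length_append, List.length_cons,
        List.length_nil] at h2 ⊢
      rw [Nat.add_mul]
      omega
  exact this.trans (Nat.mul_le_mul_right _ hL)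

theorem head?_encode_cons (c : Item) (L : List Item) :
    (encode itemWord (c :: L)).head?.isSome = true := by
  simp [encode]

/-- Write the branches for the items of the stack `a`, whose equations have the same attribute. -/
def branchesStep : Program :=
  .seq take <| .seq emitBranch <| .seq (split (.rule .rparen)) <| .seq (clear .m) <|
  .seq (clear .r) <| .seq (move .n .t) (move .t .a)

def branches : Program := .loop [peekX .a] (fun v => v.1.isSome) branchesStep

/-- After the branch for `δ` is written, the other rules with the same equation are redundant and
are thrown away with stack `m`. Two moves bring `n` back to `a` in the right orientation. -/
theorem trans_branchesStep (i δ σ : ℕ) (L : List Item) {k : ℕ}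
    (hk : ∀ c ∈ (some (i, δ), σ) :: L, (itemWord c).length ≤ k) (hL : L.length ≤ k)
    (w o c out : List TreeSymbol) :
    Trans branchesStep
      { a := encode itemWord ((some (i, δ), σ) :: L), w := w, o := o, c := c, out := out }
      { a := encode itemWord (L.filter fun c => !decide (c.1 = some (i, δ))).reverse, w := w
        o := (branchWord i (δ, σ)).reverse ++ o, c := c, out := out }
      (12 * (k * k) + 41 * k + 40) := by
  have hk1 : (itemWord (some (i, δ), σ)).length ≤ k := hk _ (by simp)
  have hk2 : ∀ c ∈ L, (itemWord c).length ≤ k := fun c hc => hk c (by simp [hc])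
  have h1 := trans_take (itemWord (some (i, δ), σ)) (encode itemWord L)
    (semi_notMem_itemWord _) hk1 
    { a := encode itemWord ((some (i, δ), σ) :: L), w := w, o := o, c := c, out := out }
    (by simp [encode]) rfl rfl
  have h2 := trans_emitBranch i δ σ hk1
    { a := encode itemWord L, w := w, r := itemWord (some (i, δ), σ) ++ [semi], o := o, c := c,
      out := out } rfl rfl
  have h3 := trans_split itemWord (d := .rule .rparen) hk1 (fun c => decide (c.1 = some (i, δ))) L
    (fun c hc => ⟨semi_notMem_itemWord c, hk2 c hc, compare_equation i δ σ c⟩)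
    { a := encode itemWord L, w := w, r := itemWord (some (i, δ), σ) ++ [semi],
      o := (branchWord i (δ, σ)).reverse ++ o, c := c, out := out } rfl rfl rfl rfl
  have h4 := trans_clear .m
    { m := encode itemWord (L.filter fun c => decide (c.1 = some (i, δ))).reverse
      n := encode itemWord (L.filter fun c => !decide (c.1 = some (i, δ))).reverse
      w := w, r := itemWord (some (i, δ), σ) ++ [semi],
      o := (branchWord i (δ, σ)).reverse ++ o, c := c, out := out }
  have h5 := trans_clear .r
    { n := encode itemWord (L.filter fun c => !decide (c.1 = some (i, δ))).reverse
      w := w, r := itemWord (some (i, δ), σ) ++ [semi],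
      o := (branchWord i (δ, σ)).reverse ++ o, c := c, out := out }
  have h6 := trans_move (j := .n) (k := .t) (by decide)
    { n := encode itemWord (L.filter fun c => !decide (c.1 = some (i, δ))).reverse
      w := w, o := (branchWord i (δ, σ)).reverse ++ o, c := c, out := out }
  have h7 := trans_move (j := .t) (k := .a) (by decide)
    { t := (encode itemWord (L.filter fun c => !decide (c.1 = some (i, δ))).reverse).reverse
      w := w, o := (branchWord i (δ, σ)).reverse ++ o, c := c, out := out }
  have e1 : (encode itemWord (L.filter fun c => decide (c.1 = some (i, δ))).reverse).length ≤
      k * (k + 1) := length_encode_le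
    (fun c hc => hk2 c (by simp at hc; exact hc.1))
    (by simpa using (List.length_filter_le _ _).trans hL)
  have e2 : (encode itemWord (L.filter fun c => !decide (c.1 = some (i, δ))).reverse).length ≤
      k * (k + 1) := length_encode_le
    (fun c hc => hk2 c (by simp at hc; exact hc.1))
    (by simpa using (List.length_filter_le _ _).trans hL)
  have e3 : L.length * (6 * k + 11) ≤ k * (6 * k + 11) := Nat.mul_le_mul_right _ hL
  simp only [Stacks.set, Stacks.get, List.append_nil, List.reverse_reverse,
    List.length_append, List.length_reverse, List.length_cons, List.length_nil]
    at h1 h2 h3 h4 h5 h6 h7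
  refine Runs.mono (h1.seq <| h2.seq <| h3.seq <| h4.seq <| h5.seq <| h6.seq h7) ?_
  ring_nf at e1 e2 e3 ⊢
  omega

/-- The list `reps` holds one rule per value. Every round removes all rules with the value just
treated, so the induction is on the number of rules. A branch has at most `2 * k + 3` symbols: the
value and the rule fit in `k` each. -/
theorem trans_branches (i : ℕ) {k : ℕ} (N : ℕ) (L : List Item) (hN : L.length = N)
    (hi : ∀ c ∈ L, ∃ δ, c.1 = some (i, δ))
    (hk : ∀ c ∈ L, (itemWord c).length ≤ k) (hL : L.length ≤ k)
    (w o c out : List TreeSymbol) :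
    ∃ reps : List (ℕ × ℕ), Trans branches
      { a := encode itemWord L, w := w, o := o, c := c, out := out }
      { w := w, o := (reps.flatMap (branchWord i)).reverse ++ o, c := c, out := out }
      (N * (12 * (k * k) + 41 * k + 41) + 1) ∧
      (reps.flatMap (branchWord i)).length ≤ N * (2 * k + 3) ∧
      (∀ p ∈ reps, (some (i, p.1), p.2) ∈ L) ∧ (reps.map Prod.fst).Nodup ∧
      ∀ c ∈ L, ∃ p ∈ reps, c.1 = some (i, p.1) := by
  induction N using Nat.strong_induction_on generalizing L o with
  | _ N ih =>
    rcases L with _ | ⟨⟨x, σ⟩, L⟩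
    · refine ⟨[], ?_, by simp, by simp, by simp, by simp⟩
      exact (Runs.loop_false fun v => ⟨(none, v.2), rfl, rfl⟩).mono (by simp)
    · obtain ⟨δ, hδ⟩ := hi _ (List.mem_cons_self ..)
      simp only at hδ
      subst hδ
      simp only [List.length_cons] at hN hL
      have hlen := List.length_filter_le (fun c : Item => !decide (c.1 = some (i, δ))) L
      obtain ⟨reps, h1, h0, h2, h3, h4⟩ := ih
        (L.filter fun c => !decide (c.1 = some (i, δ))).reverse.length (by simp; omega)
        (L.filter fun c => !decide (c.1 = some (i, δ))).reverse rfl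
        (fun c hc => hi c (by simp at hc; simp [hc.1]))
        (fun c hc => hk c (by simp at hc; simp [hc.1])) (by simp; omega)
        ((branchWord i (δ, σ)).reverse ++ o)
      refine ⟨(δ, σ) :: reps, ?_, ?_, ?_, ?_, ?_⟩
      · have hs := trans_branchesStep i δ σ L hk (by omega) w o c out
        refine (Runs.loop_true (fun v => ⟨(_, v.2), rfl, head?_encode_cons (some (i, δ), σ) L⟩) hs
          (by simpa [branches] using h1)).mono ?_
        have : (L.filter fun c => !decide (c.1 = some (i, δ))).length *
            (12 * (k * k) + 41 * k + 41) ≤ L.length * (12 * (k * k) + 41 * k + 41) :=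
          Nat.mul_le_mul_right _ hlen
        rw [← hN, Nat.add_mul]
        omega
      · have h5 := hk (some (i, δ), σ) (by simp)
        have h6 := h0.trans (Nat.mul_le_mul_right _ (by simpa using hlen))
        rw [← hN, Nat.add_mul]
        simp [branchWord, itemWord] at h5 h6 ⊢
        omega
      · intro p hp
        rcases List.mem_cons.1 hp with rfl | hp
        · simp
        · have := h2 p hp
          simp at this
          simp [this.1]
      · simp only [List.map_cons, List.nodup_cons, h3, and_true]
        intro hm
        obtain ⟨p, hp, hpδ⟩ := List.mem_map.1 hm
        have := h2 p hp
        simp [hpδ] at this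
      · intro c hc
        by_cases hcδ : c.1 = some (i, δ)
        · exact ⟨(δ, σ), by simp, hcδ⟩
        · rcases List.mem_cons.1 hc with rfl | hc
          · exact absurd rfl hcδ
          · obtain ⟨p, hp, h⟩ := h4 c (by simp [hc, hcδ])
            exact ⟨p, by simp [hp], h⟩

/-- Write the working node for the word of the stack `r` up to the last branch, and remove all
rules with the attribute of the node from the stack `a`. -/
def node : Program :=
  .seq emitHeader <| .seq (split (.rule .equal)) <| .seq (move .n .w) <| .seq (move .m .t) <|
  .seq (move .t .a) <| .seq (move .r .t) <| .seq (move .t .a) <| .seq branches (move .w .a)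

/-- The branches `reps` of a working node labeled with `a_i` for the rules `L`. -/
structure IsNode (L : List Item) (i : ℕ) (reps : List (ℕ × ℕ)) : Prop where
  mem : ∀ p ∈ reps, (some (i, p.1), p.2) ∈ L
  nodup : (reps.map Prod.fst).Nodup
  complete : ∀ δ σ, (some (i, δ), σ) ∈ L → δ ∈ reps.map Prod.fst
  ne_nil : reps ≠ []

def nodeWord (i : ℕ) (reps : List (ℕ × ℕ)) : List TreeSymbol :=
  headerWord i ++ reps.flatMap (branchWord i)

/-- The rules without the attribute `i` wait in `w`, since `branches` uses the other stacks. The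
current rule is put back on top of the matching ones, so that its value gets a branch and the node
has at least one. -/
theorem trans_node (i δ σ : ℕ) (L : List Item) {k : ℕ}
    (hk : ∀ c ∈ (some (i, δ), σ) :: L, (itemWord c).length ≤ k) (hL : L.length + 1 ≤ k)
    (o c out : List TreeSymbol) :
    ∃ reps : List (ℕ × ℕ), Trans node
      { a := encode itemWord L, r := itemWord (some (i, δ), σ) ++ [semi], o := o, c := c,
        out := out }
      { a := encode itemWord (L.filter fun c => !decide (c.1.map Prod.fst = some i)).reverse
        o := (nodeWord i reps).reverse ++ o, c := .rbracket :: c, out := out }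
      (12 * (k * k * k) + 55 * (k * k) + 68 * k + 30) ∧
      (nodeWord i reps).length ≤ 2 * (k * k) + 4 * k + 2 ∧
      IsNode ((some (i, δ), σ) :: L) i reps := by
  have hk1 : (itemWord (some (i, δ), σ)).length ≤ k := hk _ (by simp)
  have hk2 : ∀ c ∈ L, (itemWord c).length ≤ k := fun c hc => hk c (by simp [hc])
  set M := (L.filter fun c => decide (c.1.map Prod.fst = some i)).reverse with hM
  set N := (L.filter fun c => !decide (c.1.map Prod.fst = some i)).reverse with hN
  set o' := (headerWord i).reverse ++ o with ho'
  have hlM : M.length + 1 ≤ k := by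
    have := List.length_filter_le (fun c : Item => decide (c.1.map Prod.fst = some i)) L
    simp [hM]; omega
  have hlN : N.length + 1 ≤ k := by
    have := List.length_filter_le (fun c : Item => !decide (c.1.map Prod.fst = some i)) L
    simp [hN]; omega
  have hkM : ∀ c ∈ (some (i, δ), σ) :: M, (itemWord c).length ≤ k := by
    intro c hc
    rcases List.mem_cons.1 hc with rfl | hc
    · exact hk1
    · exact hk2 c (by simp [hM] at hc; exact hc.1)
  have hkN : ∀ c ∈ N, (itemWord c).length ≤ k := 
    fun c hc => hk2 c (by simp [hN] at hc; exact hc.1)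
  have h1 := trans_emitHeader i δ σ hk1
    { a := encode itemWord L, r := itemWord (some (i, δ), σ) ++ [semi], o := o, c := c,
      out := out } rfl rfl
  have h2 := trans_split itemWord (d := .rule .equal) hk1
    (fun c => decide (c.1.map Prod.fst = some i)) L
    (fun c hc => ⟨semi_notMem_itemWord c, hk2 c hc, compare_attr i δ σ c⟩)
    { a := encode itemWord L, r := itemWord (some (i, δ), σ) ++ [semi],
      o := o', c := .rbracket :: c, out := out } rfl rfl rfl rfl
  have h3 := trans_move (j := .n) (k := .w) (by decide)
    { m := encode itemWord M, n := encode itemWord N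
      r := itemWord (some (i, δ), σ) ++ [semi],
      o := o', c := .rbracket :: c, out := out }
  have h4 := trans_move (j := .m) (k := .t) (by decide)
    { m := encode itemWord M, w := (encode itemWord N).reverse
      r := itemWord (some (i, δ), σ) ++ [semi],
      o := o', c := .rbracket :: c, out := out }
  have h5 := trans_move (j := .t) (k := .a) (by decide)
    { t := (encode itemWord M).reverse, w := (encode itemWord N).reverse
      r := itemWord (some (i, δ), σ) ++ [semi],
      o := o', c := .rbracket :: c, out := out }
  have h6 := trans_move (j := .r) (k := .t) (by decide)
    { a := encode itemWord M, w := (encode itemWord N).reverse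
      r := itemWord (some (i, δ), σ) ++ [semi],
      o := o', c := .rbracket :: c, out := out }
  have h7 := trans_move (j := .t) (k := .a) (by decide)
    { a := encode itemWord M, w := (encode itemWord N).reverse
      t := (itemWord (some (i, δ), σ) ++ [semi]).reverse,
      o := o', c := .rbracket :: c, out := out }
  obtain ⟨reps, h8, r0, r1, r2, r3⟩ := trans_branches i (M.length + 1) ((some (i, δ), σ) :: M) rfl
    (by
      intro c hc
      rcases List.mem_cons.1 hc with rfl | hc
      · exact ⟨δ, rfl⟩
      · simp [hM] at hc
        obtain ⟨x, hx⟩ := hc.2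
        exact ⟨x, hx⟩)
    hkM (by simpa using hlM) (encode itemWord N).reverse o' (.rbracket :: c) out
  have h9 := trans_move (j := .w) (k := .a) (by decide)
    { w := (encode itemWord N).reverse
      o := (reps.flatMap (branchWord i)).reverse ++ o', c := .rbracket :: c, out := out }
  have e1 : (encode itemWord M).length ≤ k * (k + 1) :=
    length_encode_le (fun c hc => hkM c (by simp [hc])) (by omega)
  have e2 : (encode itemWord N).length ≤ k * (k + 1) := length_encode_le hkN (by omega)
  have e3 : L.length * (6 * k + 11) ≤ k * (6 * k + 11) := Nat.mul_le_mul_right _ (by omega)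
  have e5 : (M.length + 1) * (12 * (k * k) + 41 * k + 41) ≤ k * (12 * (k * k) + 41 * k + 41) :=
    Nat.mul_le_mul_right _ hlM
  have e8 : encode itemWord ((some (i, δ), σ) :: M) =
      itemWord (some (i, δ), σ) ++ [semi] ++ encode itemWord M := rfl
  rw [e8] at h8
  simp only [Stacks.set, Stacks.get, List.append_nil, List.reverse_reverse,
    List.length_append, List.length_reverse, List.length_cons, List.length_nil]
    at h1 h2 h3 h4 h5 h6 h7 h9
  refine ⟨reps, ?_, ?_, ?_, r2, ?_, ?_⟩
  · have := h1.seq <| h2.seq <| h3.seq <| h4.seq <| h5.seq <| h6.seq <| h7.seq <| h8.seq h9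
    refine Runs.mono (by simpa [node, nodeWord, ho'] using this) ?_
    ring_nf at e1 e2 e3 e5 ⊢
    omega
  · have := r0.trans (Nat.mul_le_mul_right _ hlM)
    simp only [itemWord, List.length_append, List.length_cons] at hk1
    simp only [nodeWord, headerWord, List.length_append, List.length_cons, List.length_nil]
    ring_nf at this ⊢
    omega
  · intro p hp
    rcases List.mem_cons.1 (r1 p hp) with h | h
    · simp [h]
    · simp [hM] at h; simp [h]
  · intro δ' σ' h
    obtain ⟨p, hp, h'⟩ := r3 (some (i, δ'), σ') (by
      rcases List.mem_cons.1 h with h | h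
      · simp [h]
      · simp [hM, h])
    simp at h'
    exact List.mem_map.2 ⟨p, hp, h'.symm⟩
  · rintro rfl
    obtain ⟨p, hp, -⟩ := r3 _ (List.mem_cons_self ..)
    simp at hp

/-- The working nodes on the main path of the tree, and the right-hand side of the rule without
equations at its end, if there is one. -/
structure IsChain (L : List Item) (nodes : List (ℕ × List (ℕ × ℕ))) (fin : Option ℕ) : Prop where
  isNode : ∀ nd ∈ nodes, IsNode L nd.1 nd.2
  fin_mem : ∀ σ ∈ fin, (none, σ) ∈ L
  complete : fin = none → ∀ c ∈ L, ∃ nd ∈ nodes, ∃ δ, c.1 = some (nd.1, δ)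

/-- Some rule of the node survived the filter, so the attribute of the node differs from that of
`c`. Hence no rule relevant to this node was removed. -/
theorem IsNode.cons {L : List Item} {c : Item} {i : ℕ} {reps : List (ℕ × ℕ)}
    (h : IsNode (L.filter fun c' => !decide (c'.1.map Prod.fst = c.1.map Prod.fst)).reverse i
      reps) :
    IsNode (c :: L) i reps := by
  obtain ⟨p, hp⟩ := List.exists_mem_of_ne_nil _ h.ne_nil
  have hpc := h.mem p hp
  simp at hpc
  refine ⟨fun q hq => ?_, h.nodup, fun δ σ hm => h.complete δ σ ?_, h.ne_nil⟩
  · have := h.mem q hq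
    simp at this
    simp [this.1]
  · rcases List.mem_cons.1 hm with rfl | hm
    · simp at hpc
    · simp [hm]
      exact hpc.2

/-- Load the input, with a semicolon at the end. -/
def loadInput : Program := .seq (.acts [pushC .a semi]) (move .t .a)

theorem trans_loadInput (w : List TreeSymbol) :
    Trans loadInput { t := w.reverse } { a := w ++ [semi] } (2 * w.length + 2) := by
  have h1 := trans_push .a semi { t := w.reverse }
  have h2 := trans_move (j := .t) (k := .a) (by decide) { a := [semi], t := w.reverse }
  simp only [Stacks.set, Stacks.get, List.reverse_reverse, List.length_reverse] at h1 h2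
  exact (h1.seq h2).mono (by omega)

/-- Write the output. -/
def writeOutput : Program := .seq (move .c .out) (move .o .out)

theorem trans_writeOutput (o c : List TreeSymbol) :
    Trans writeOutput { o := o, c := c } { out := o.reverse ++ c.reverse }
      (2 * c.length + 1 + (2 * o.length + 1)) := by
  have h1 := trans_move (j := .c) (k := .out) (by decide) { o := o, c := c }
  have h2 := trans_move (j := .o) (k := .out) (by decide) { o := o, out := c.reverse }
  simp only [Stacks.set, Stacks.get, List.append_nil] at h1 h2
  exact h1.seq h2

def finWord : Option ℕ → List TreeSymbol
  | none => []
  | some σ => itemWord (none, σ)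

def finStack : Option ℕ → List TreeSymbol
  | none => []
  | some σ => itemWord (none, σ) ++ [semi]

/-- Write a terminal node for the word of the stack `r`. -/
def emitTerminal : Program :=
  .seq (.acts [pushC .o .lbrace]) <|
  .seq (.ite [peekX .r] (fun v => v.1.isSome) (.seq (transferCopy semi .r .t) (clear .t))
    (.acts [])) (.acts [pushC .o .rbrace])

theorem trans_emitTerminal (x : Option ℕ) {k : ℕ} (hk : (finWord x).length ≤ k)
    (a o c : List TreeSymbol) :
    Trans emitTerminal { a := a, r := finStack x, o := o, c := c }
      { a := a, o := (TreeSymbol.lbrace :: finWord x ++ [TreeSymbol.rbrace]).reverse ++ o, c := c }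
      (4 * k + 7) := by
  have h1 := trans_push .o .lbrace { a := a, r := finStack x, o := o, c := c }
  have h4 := trans_push .o .rbrace
    { a := a, o := (finWord x).reverse ++ .lbrace :: o, c := c }
  cases x with
  | none =>
    have h2 : Trans (.ite [peekX .r] (fun v => v.1.isSome)
        (.seq (transferCopy semi .r .t) (clear .t)) (.acts []))
        { a := a, o := .lbrace :: o, c := c }
        { a := a, o := .lbrace :: o, c := c } 2 :=
      Runs.ite_false (fun v => ⟨(none, v.2), rfl, rfl⟩) fun v => ⟨v, 1, le_rfl, Exec.acts _ _⟩
    simp only [Stacks.set, Stacks.get, finStack, finWord] at h1 h4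
    exact Runs.mono (by simpa [emitTerminal, finWord, finStack] using h1.seq (h2.seq h4)) (by omega)
  | some σ =>
    have h2 := trans_transferCopy (d := semi) (j := .r) (k := .t) (by decide) (by decide)
      (by decide) { a := a, r := itemWord (none, σ) ++ [semi], o := .lbrace :: o, c := c }
      (itemWord (none, σ)) [] (semi_notMem_itemWord _) rfl
    have h3 := trans_clear .t
      { a := a, t := semi :: (itemWord (none, σ)).reverse
        o := (itemWord (none, σ)).reverse ++ .lbrace :: o, c := c }
    simp only [Stacks.set, Stacks.get, List.append_nil, finStack, finWord, List.length_cons,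
      List.length_reverse] at h1 h2 h3 h4 hk
    have h23 := Runs.ite_true (l := [peekX .r]) (c := fun v => v.1.isSome) (q := .acts [])
      (s := Stacks.get { a := a, r := itemWord (none, σ) ++ [semi], o := .lbrace :: o, c := c })
      (fun v => ⟨(some (.rule .arrow), v.2), rfl, rfl⟩) (h2.seq h3)
    exact Runs.mono (by simpa [emitTerminal, finWord, finStack] using h1.seq (h23.seq h4))
      (by omega)

/-- Process the first rule of the stack `a`. A rule without equations stops the loop. -/
def chainStep : Program :=
  .seq take <| .ite [peekX .r] (fun v => v.1 = some (.rule .arrow)) (clear .a) <|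
    .seq node <| .seq (.acts [pushC .o .star]) (.acts [pushC .o (.rule .arrow)])

def chain : Program := .loop [peekX .a] (fun v => v.1.isSome) chainStep

def chainWord (nodes : List (ℕ × List (ℕ × ℕ))) : List TreeSymbol :=
  nodes.flatMap fun nd => nodeWord nd.1 nd.2 ++ [.star, .rule .arrow]

/-- Each round writes one node and drops all rules with its attribute, so there are at most `N`
nodes. Only the edge `∗` is continued, which keeps the word polynomial. Every node leaves one
bracket in `c`. -/
theorem trans_chain {k : ℕ} (N : ℕ) (L : List Item) (hN : L.length = N)
    (hk : ∀ c ∈ L, (itemWord c).length ≤ k) (hL : L.length ≤ k) (o c : List TreeSymbol) :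
    ∃ (nodes : List (ℕ × List (ℕ × ℕ))) (fin : Option ℕ), Trans chain
      { a := encode itemWord L, o := o, c := c }
      { r := finStack fin, o := (chainWord nodes).reverse ++ o,
        c := List.replicate nodes.length .rbracket ++ c }
      (N * (12 * (k * k * k) + 55 * (k * k) + 72 * k + 38) + (2 * (k * k) + 6 * k + 8)) ∧
      IsChain L nodes fin ∧ nodes.length ≤ N ∧
      (chainWord nodes).length ≤ N * (2 * (k * k) + 4 * k + 4) := by
  induction N using Nat.strong_induction_on generalizing L o c with
  | _ N ih =>
    rcases L with _ | ⟨x, L⟩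
    · refine ⟨[], none, ?_, ⟨by simp, by simp, by simp⟩, by simp, by simp [chainWord]⟩
      exact (Runs.loop_false fun v => ⟨(none, v.2), rfl, rfl⟩).mono (by omega)
    · have h1 := trans_take (itemWord x) (encode itemWord L)
        (semi_notMem_itemWord _) (hk x (by simp))
        { a := encode itemWord (x :: L), o := o, c := c } (by simp [encode]) rfl rfl
      have hk2 : ∀ c ∈ L, (itemWord c).length ≤ k := fun c hc => hk c (by simp [hc])
      simp only [List.length_cons] at hN hL
      rcases x with ⟨_ | ⟨i, δ⟩, σ⟩
      -- A rule without equations is satisfied on every path, so it can label the last leaf and the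
      -- remaining rules may be discarded.
      · refine ⟨[], some σ, ?_, ⟨by simp, by simp, by simp⟩, by simp, by simp [chainWord]⟩
        have e1 := length_encode_le hk2 (by omega)
        have h2 := trans_clear .a
          { a := encode itemWord L, r := itemWord (none, σ) ++ [semi], o := o, c := c }
        have h3 := Runs.ite_true (l := [peekX .r])
          (s := Stacks.get
            { a := encode itemWord L, r := itemWord (none, σ) ++ [semi], o := o, c := c })
          (c := fun v => v.1 = some (.rule .arrow))
          (q := .seq node <| .seq (.acts [pushC .o .star]) (.acts [pushC .o (.rule .arrow)]))
          (fun v => ⟨(some (.rule .arrow), v.2), rfl, by simp⟩) h2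
        simp only [Stacks.set, Stacks.get] at h1 h3
        refine (Runs.loop_true (fun v => ⟨(_, v.2), rfl, head?_encode_cons (none, σ) L⟩)
          (h1.seq h3) (Runs.loop_false fun v => ⟨(none, v.2), rfl, rfl⟩)).mono ?_
        ring_nf at e1 ⊢
        have : 1 ≤ N := by omega
        have : 1 * (k * 72) ≤ N * (k * 72) := Nat.mul_le_mul_right _ this
        ring_nf at this
        nlinarith
      · obtain ⟨reps, h2, hlen, hnode⟩ := trans_node i δ σ L hk (by omega) o c []
        have h3 := trans_push .o .star
          { a := encode itemWord (L.filter fun c => !decide (c.1.map Prod.fst = some i)).reverse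
            o := (nodeWord i reps).reverse ++ o, c := .rbracket :: c }
        have h4 := trans_push .o (.rule .arrow)
          { a := encode itemWord (L.filter fun c => !decide (c.1.map Prod.fst = some i)).reverse
            o := .star :: ((nodeWord i reps).reverse ++ o), c := .rbracket :: c }
        have h5 := Runs.ite_false (l := [peekX .r])
          (s := Stacks.get
            { a := encode itemWord L, r := itemWord (some (i, δ), σ) ++ [semi], o := o, c := c })
          (c := fun v => v.1 = some (.rule .arrow)) (p := clear .a)
          (fun v => ⟨(some (.rule .lparen), v.2), rfl, by simp⟩) (h2.seq (h3.seq h4))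
        have hfil := List.length_filter_le
          (fun c : Item => !decide (c.1.map Prod.fst = some i)) L
        obtain ⟨nodes, fin, h6, h7, h8, h9⟩ := ih
          (L.filter fun c => !decide (c.1.map Prod.fst = some i)).length (by omega)
          (L.filter fun c => !decide (c.1.map Prod.fst = some i)).reverse (by simp)
          (fun c hc => hk2 c (by simp at hc; simp [hc.1])) (by simp; omega)
          (.rule .arrow :: .star :: ((nodeWord i reps).reverse ++ o)) (.rbracket :: c)
        refine ⟨(i, reps) :: nodes, fin, ?_, ⟨?_, ?_, ?_⟩, by simp; omega, ?_⟩
        · simp only [Stacks.set, Stacks.get] at h1 h5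
          have := Runs.loop_true (s := Stacks.get
            { a := encode itemWord ((some (i, δ), σ) :: L), o := o, c := c })
            (fun v => ⟨(_, v.2), rfl, head?_encode_cons (some (i, δ), σ) L⟩)
            (h1.seq h5) h6
          refine Runs.mono (by simpa [chain, chainStep, chainWord, List.replicate_succ'] using this)
            ?_
          have := Nat.mul_le_mul_right (12 * (k * k * k) + 55 * (k * k) + 72 * k + 38) hfil
          rw [← hN, Nat.add_mul]
          omega
        · intro nd hnd
          rcases List.mem_cons.1 hnd with rfl | hnd
          · exact hnode
          · exact IsNode.cons (c := (some (i, δ), σ)) (h7.isNode nd hnd)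
        · intro σ' hσ'
          have := h7.fin_mem σ' hσ'
          simp at this
          simp [this]
        · intro hfin c' hc'
          by_cases hi : c'.1.map Prod.fst = some i
          · refine ⟨(i, reps), by simp, ?_⟩
            rcases hx : c'.1 with _ | ⟨i', δ'⟩
            · simp [hx] at hi
            · simp [hx] at hi
              exact ⟨δ', by simp [hi]⟩
          · rcases List.mem_cons.1 hc' with rfl | hc'
            · simp at hi
            · obtain ⟨nd, hnd, h⟩ := h7.complete hfin c' (by simp [hc']; simpa using hi)
              exact ⟨nd, by simp [hnd], h⟩
        · have := h9.trans (Nat.mul_le_mul_right _ hfil)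
          rw [← hN, Nat.add_mul]
          simp only [chainWord, List.flatMap_cons, List.length_append, List.length_cons,
            List.length_nil] at this ⊢
          omega

/-- The construction of a tree solving `ESR`. -/
def chainProgram : Program :=
  .seq loadInput <| .seq chain <| .seq emitTerminal writeOutput

/-- At most `k` rounds of cost cubic in `k` give degree four. The generous constant is shared with
the program for `SR`. -/
theorem trans_chainProgram {k : ℕ} (w : List TreeSymbol) (L : List Item)
    (hw : w ++ [semi] = encode itemWord L)
    (hk : ∀ c ∈ L, (itemWord c).length ≤ k) (hL : L.length ≤ k) :
    ∃ (nodes : List (ℕ × List (ℕ × ℕ))) (fin : Option ℕ), IsChain L nodes fin ∧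
      Trans chainProgram { t := w.reverse }
        { out := chainWord nodes ++ (TreeSymbol.lbrace :: finWord fin ++ [TreeSymbol.rbrace]) ++
          List.replicate nodes.length .rbracket }
        (200 * (k + 1) ^ 4) := by
  have h1 := trans_loadInput w
  rw [hw] at h1
  obtain ⟨nodes, fin, h2, h3, h4, h5⟩ := trans_chain (k := k) L.length L rfl hk hL [] []
  have hfin : (finWord fin).length ≤ k := by
    cases fin with
    | none => simp [finWord]
    | some σ => exact hk _ (h3.fin_mem σ rfl)
  simp only [List.append_nil] at h2
  have h6 := trans_emitTerminal fin hfin [] (chainWord nodes).reverse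
    (List.replicate nodes.length .rbracket)
  have h7 := trans_writeOutput
    ((TreeSymbol.lbrace :: finWord fin ++ [TreeSymbol.rbrace]).reverse ++ (chainWord nodes).reverse)
    (List.replicate nodes.length .rbracket)
  refine ⟨nodes, fin, h3, Runs.mono (h1.seq (h2.seq (h6.seq (by simpa using h7)))) ?_⟩
  have e1 : w.length + 1 ≤ k * (k + 1) := by
    have := length_encode_le hk hL
    rw [← hw] at this
    simpa using this
  have e2 := Nat.mul_le_mul_right (12 * (k * k * k) + 55 * (k * k) + 72 * k + 38) hL
  have e3 := Nat.mul_le_mul_right (2 * (k * k) + 4 * k + 4) hL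
  ring_nf at e1 e2 e3 h5 ⊢
  omega

/-- The construction of a tree solving `SR`. -/
def starProgram : Program :=
  .seq loadInput <| .seq take <|
  .seq (.ite [peekX .r] (fun v => v.1 = some (.rule .arrow)) emitTerminal node) <|
  .seq (clear .a) writeOutput

theorem trans_starProgram_none {k : ℕ} (w : List TreeSymbol) (σ : ℕ) (L : List Item)
    (hw : w ++ [semi] = encode itemWord ((none, σ) :: L))
    (hk : ∀ c ∈ (none, σ) :: L, (itemWord c).length ≤ k) (hL : L.length + 1 ≤ k) :
    Trans starProgram { t := w.reverse }
      { out := TreeSymbol.lbrace :: itemWord (none, σ) ++ [TreeSymbol.rbrace] }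
      (200 * (k + 1) ^ 4) := by
  have h1 := trans_loadInput w
  rw [hw] at h1
  have h2 := trans_take (itemWord (none, σ)) (encode itemWord L)
    (semi_notMem_itemWord _) (hk _ (by simp))
    { a := encode itemWord ((none, σ) :: L) } (by simp [encode]) rfl rfl
  have h3 := trans_emitTerminal (some σ) (hk (none, σ) (by simp)) (encode itemWord L) [] []
  have h4 := Runs.ite_true (l := [peekX .r]) (c := fun v => v.1 = some (.rule .arrow)) (q := node)
    (s := Stacks.get { a := encode itemWord L, r := itemWord (none, σ) ++ [semi] })
    (fun v => ⟨(some (.rule .arrow), v.2), rfl, by simp⟩) h3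
  simp only [List.append_nil] at h4
  have h5 := trans_clear .a
    { a := encode itemWord L,
      o := (TreeSymbol.lbrace :: finWord (some σ) ++ [TreeSymbol.rbrace]).reverse }
  have h6 := trans_writeOutput
    (TreeSymbol.lbrace :: finWord (some σ) ++ [TreeSymbol.rbrace]).reverse []
  simp only [Stacks.set, Stacks.get, List.reverse_reverse, List.length_reverse] at h5 h6
  refine Runs.mono (h1.seq (h2.seq (h4.seq (h5.seq (by simpa [finWord] using h6))))) ?_
  have e1 : w.length + 1 ≤ k * (k + 1) := by
    have := length_encode_le hk hL
    rw [← hw] at this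
    simpa using this
  have e2 := length_encode_le (fun c hc => hk c (List.mem_cons_of_mem _ hc))
    (Nat.le_of_succ_le hL)
  have e3 := hk _ (List.mem_cons_self ..)
  ring_nf at e1 e2 ⊢
  omega

/-- The attribute of the first rule is as good as any other; the remaining rules are cleared. -/
theorem trans_starProgram_some {k : ℕ} (w : List TreeSymbol) (i δ σ : ℕ) (L : List Item)
    (hw : w ++ [semi] = encode itemWord ((some (i, δ), σ) :: L))
    (hk : ∀ c ∈ (some (i, δ), σ) :: L, (itemWord c).length ≤ k) (hL : L.length + 1 ≤ k) :
    ∃ reps, IsNode ((some (i, δ), σ) :: L) i reps ∧ Trans starProgram { t := w.reverse }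
      { out := nodeWord i reps ++ [.rbracket] } (200 * (k + 1) ^ 4) := by
  have h1 := trans_loadInput w
  rw [hw] at h1
  have h2 := trans_take (itemWord (some (i, δ), σ)) (encode itemWord L)
    (semi_notMem_itemWord _) (hk _ (by simp))
    { a := encode itemWord ((some (i, δ), σ) :: L) } (by simp [encode]) rfl rfl
  obtain ⟨reps, h3, hlen, hnode⟩ := trans_node i δ σ L hk hL [] [] []
  have h4 := Runs.ite_false (l := [peekX .r]) (c := fun v => v.1 = some (.rule .arrow))
    (p := emitTerminal)
    (s := Stacks.get { a := encode itemWord L, r := itemWord (some (i, δ), σ) ++ [semi] })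
    (fun v => ⟨(some (.rule .lparen), v.2), rfl, by simp⟩) h3
  simp only [List.append_nil] at h4
  have h5 := trans_clear .a
    { a := encode itemWord (L.filter fun c => !decide (c.1.map Prod.fst = some i)).reverse
      o := (nodeWord i reps).reverse, c := [.rbracket] }
  have h6 := trans_writeOutput (nodeWord i reps).reverse [.rbracket]
  simp only [Stacks.set, Stacks.get, List.reverse_reverse, List.length_reverse] at h5 h6
  refine ⟨reps, hnode, Runs.mono (h1.seq (h2.seq (h4.seq (h5.seq (by simpa using h6))))) ?_⟩
  have e1 : w.length + 1 ≤ k * (k + 1) := by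
    have := length_encode_le hk hL
    rw [← hw] at this
    simpa using this
  have e2 : (encode itemWord (L.filter fun c =>
      !decide (c.1.map Prod.fst = some i)).reverse).length ≤ k * (k + 1) :=
    length_encode_le (fun c hc => hk c (by simp at hc; simp [hc.1]))
      (by have := List.length_filter_le (fun c : Item => !decide (c.1.map Prod.fst = some i)) L
          simp; omega)
  ring_nf at e1 e2 hlen ⊢
  omega

/-! ### Trees for systems of rules of length at most one -/

/-- The rule of an item. -/
def Item.toRule (c : Item) : Rule where
  lhs := c.1.toFinset
  rhs := c.2
  attr_ne e he e' he' _ := by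
    simp only [Option.mem_toFinset, Option.mem_def] at he he'
    exact Option.some_injective _ (he.symm.trans he')

/-- With at most one equation there is no choice of order, so the word of the rule is determined by
the item. -/
theorem exists_item {w : List RuleSymbol} {r : Rule} (hw : RepresentsRule w r)
    (hr : r.length ≤ 1) : ∃ c : Item, Item.toRule c = r ∧ w.map .rule = itemWord c := by
  obtain ⟨l, hl, hlr, rfl⟩ := hw
  have hlen : l.length ≤ 1 := by
    rw [← List.toFinset_card_of_nodup hl, hlr]
    exact hr
  rcases l with _ | ⟨e, _ | ⟨e', l⟩⟩
  · refine ⟨(none, r.rhs), Rule.ext (by simpa [Item.toRule] using hlr) rfl, ?_⟩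
    simp [itemWord, bin]
  · refine ⟨(some e, r.rhs), Rule.ext (by simpa [Item.toRule] using hlr) rfl, ?_⟩
    simp [itemWord, bin, equationWord]
  · simp at hlen

theorem exists_representsRule (c : Item) :
    ∃ w, RepresentsRule w (Item.toRule c) ∧ w.map .rule = itemWord c := by
  rcases c with ⟨_ | e, σ⟩
  · exact ⟨_, ⟨[], by simp, by simp [Item.toRule], rfl⟩, by simp [itemWord, bin, Item.toRule]⟩
  · exact ⟨_, ⟨[e], by simp, by simp [Item.toRule], rfl⟩,
      by simp [itemWord, bin, equationWord, Item.toRule]⟩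

/-- One extra semicolon turns separators into terminators, the form in which the programs read the
rules. -/
theorem intercalate_append_semi {α : Type} (s : α) (ws : List (List α)) (h : ws ≠ []) :
    List.intercalate [s] ws ++ [s] = ws.flatMap fun w => w ++ [s] := by
  induction ws with
  | nil => exact absurd rfl h
  | cons w ws ih =>
    rcases ws with _ | ⟨w', ws⟩
    · simp
    · simp [List.intercalate_cons_cons, ih]

/-- The items of `L` are the rules of `S`. -/
def IsItemList (L : List Item) (S : Finset Rule) : Prop :=
  ∀ r, r ∈ S ↔ ∃ c ∈ L, Item.toRule c = r

theorem exists_itemList {w : List RuleSymbol} {S : Finset Rule} (hw : Represents w S)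
    (hS : S.Nonempty) (h1 : maxLength S ≤ 1) :
    ∃ L : List Item, L ≠ [] ∧ w.map .rule ++ [semi] = encode itemWord L ∧ IsItemList L S := by
  obtain ⟨l, ws, -, rfl, hF, rfl⟩ := hw
  have hlen : ∀ r ∈ l, r.length ≤ 1 := fun r hr =>
    (Finset.le_sup (f := Rule.length) (List.mem_toFinset.2 hr)).trans h1
  have key : ∃ L : List Item, L.map Item.toRule = l ∧
      ws.map (List.map TreeSymbol.rule) = L.map itemWord := by
    clear hS h1
    induction hF with
    | nil => exact ⟨[], rfl, rfl⟩
    | @cons w r ws l hw _ ih =>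
      obtain ⟨L, h1, h2⟩ := ih fun r hr => hlen r (by simp [hr])
      obtain ⟨c, h3, h4⟩ := exists_item hw (hlen r (by simp))
      exact ⟨c :: L, by simp [h1, h3], by simp [h2, h4]⟩
  obtain ⟨L, rfl, hL⟩ := key
  have hne : L ≠ [] := by rintro rfl; simp at hS
  have hws : ws ≠ [] := by rintro rfl; simp at hL; exact hne hL
  refine ⟨L, hne, ?_, fun r => by simp⟩
  have e : (List.intercalate [RuleSymbol.semicolon] ws).map TreeSymbol.rule ++ [semi] =
      (List.intercalate [RuleSymbol.semicolon] ws ++ [RuleSymbol.semicolon]).map TreeSymbol.rule := by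
    simp
  rw [e, intercalate_append_semi _ _ hws, List.map_flatMap]
  have : (ws.flatMap fun w => (w ++ [RuleSymbol.semicolon]).map TreeSymbol.rule) =
      (ws.map (List.map TreeSymbol.rule)).flatMap fun w => w ++ [semi] := by
    simp [List.flatMap_map]
  rw [this, hL, List.flatMap_map]
  rfl

theorem append_cons_inj_of_notMem_of_notMem {α : Type} {d : α} {u v x y : List α} (hu : d ∉ u)
    (hv : d ∉ v) (h : u ++ d :: x = v ++ d :: y) : u = v ∧ x = y := by
  induction u generalizing v with
  | nil =>
    cases v with
    | nil => simpa using h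
    | cons b v => simp at h hv; exact absurd h.1 hv.1
  | cons b u ih =>
    cases v with
    | nil => simp at h hu; exact absurd h.1.symm hu.1
    | cons b' v =>
      simp only [List.cons_append, List.cons.injEq, List.mem_cons, not_or] at h hu hv
      obtain ⟨h1, h2⟩ := ih hu.2 hv.2 h.2
      exact ⟨by rw [h.1, h1], h2⟩

theorem itemWord_injective : Injective itemWord := by
  rintro ⟨_ | ⟨i, δ⟩, σ⟩ ⟨_ | ⟨i', δ'⟩, σ'⟩ h
  · simpa [itemWord, bin_injective.eq_iff] using h
  · simp [itemWord] at h
  · simp [itemWord] at h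
  · simp only [itemWord, List.cons.injEq, true_and] at h
    obtain ⟨h1, h2⟩ := append_cons_inj_of_notMem_of_notMem (notMem_bin (by simp) (by simp))
      (notMem_bin (by simp) (by simp)) h
    obtain ⟨h3, h4⟩ := append_cons_inj_of_notMem_of_notMem (notMem_bin (by simp) (by simp))
      (notMem_bin (by simp) (by simp)) h2
    simp at h4
    rw [bin_injective h1, bin_injective h3, bin_injective h4]

/-- The word determines the list of items. Hence an output computed from one decoding is correct for
every system that the word represents. -/
theorem encode_injective : Injective (encode itemWord) := by
  intro L L' h
  induction L generalizing L' with
  | nil =>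
    cases L' with
    | nil => rfl
    | cons c L' => simp [encode] at h
  | cons c L ih =>
    cases L' with
    | nil => simp [encode] at h
    | cons c' L' =>
      simp only [encode, List.flatMap_cons, List.append_assoc, List.cons_append,
        List.nil_append] at h
      obtain ⟨h1, h2⟩ := append_cons_inj_of_notMem_of_notMem (semi_notMem_itemWord c)
        (semi_notMem_itemWord c') h
      rw [itemWord_injective h1, ih h2]

theorem IsItemList.mem_attrs {L : List Item} {S : Finset Rule} (h : IsItemList L S) (i : ℕ) :
    i ∈ attrs S ↔ ∃ δ σ, (some (i, δ), σ) ∈ L := by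
  simp only [attrs, Finset.mem_biUnion, Finset.mem_image, h _]
  constructor
  · rintro ⟨_, ⟨⟨x, σ⟩, hc, rfl⟩, ⟨i, δ⟩, he, rfl⟩
    simp only [Item.toRule, Option.mem_toFinset, Option.mem_def] at he
    subst he
    exact ⟨δ, σ, hc⟩
  · rintro ⟨δ, σ, hc⟩
    exact ⟨_, ⟨_, hc, rfl⟩, (i, δ), by simp [Item.toRule], rfl⟩

theorem IsItemList.mem_values {L : List Item} {S : Finset Rule} (h : IsItemList L S) (i δ : ℕ) :
    δ ∈ values S i ↔ ∃ σ, (some (i, δ), σ) ∈ L := by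
  simp only [values, Finset.mem_biUnion, Finset.mem_image, h _, Finset.mem_filter]
  constructor
  · rintro ⟨_, ⟨⟨x, σ⟩, hc, rfl⟩, ⟨i, δ⟩, ⟨he, rfl⟩, rfl⟩
    simp only [Item.toRule, Option.mem_toFinset, Option.mem_def] at he
    subst he
    exact ⟨σ, hc⟩
  · rintro ⟨σ, hc⟩
    exact ⟨_, ⟨_, hc, rfl⟩, (i, δ), ⟨by simp [Item.toRule], rfl⟩, rfl⟩

/-- An edge: its label, the subtree that it enters and the word of this subtree. -/
abbrev Edge := Option ℕ × DecisionTree × List TreeSymbol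

def mkNode (i : ℕ) (E : List Edge) : DecisionTree :=
  .working i E.length (fun j => (E.get j).1) (fun j => (E.get j).2.1)

def edgesWord (E : List Edge) : List TreeSymbol :=
  E.flatMap fun e => labelWord e.1 ++ [.rule .arrow] ++ e.2.2

theorem representsTree_mkNode (i : ℕ) (E : List Edge)
    (h : ∀ e ∈ E, RepresentsTree e.2.2 e.2.1) :
    RepresentsTree (headerWord i ++ edgesWord E ++ [.rbracket]) (mkNode i E) := by
  have := RepresentsTree.working i E.length (fun j => (E.get j).1) (fun j => (E.get j).2.1)
    (fun j => (E.get j).2.2) (fun j => h _ (List.get_mem ..))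
  have e : (List.ofFn fun j => labelWord (E.get j).1 ++ [.rule .arrow] ++ (E.get j).2.2).flatten =
      edgesWord E := by
    rw [edgesWord, List.flatMap]
    congr 1
    conv_rhs => rw [← List.ofFn_get E, List.map_ofFn]
    rfl
  rw [e] at this
  simpa [headerWord, bin, mkNode] using this

/-- Distinct labels that form exactly the required set have the required number. -/
theorem isOver_mkNode {ext : Prop} {S : Finset Rule} {i : ℕ} {E : List Edge} (hi : i ∈ attrs S)
    (hnd : (E.map Prod.fst).Nodup) (hE : ∀ x, x ∈ E.map Prod.fst ↔ x ∈ edgeLabels ext S i)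
    (h : ∀ e ∈ E, e.2.1.IsOver ext S) : (mkNode i E).IsOver ext S := by
  refine ⟨hi, ?_, ?_, fun j => (hE _).1 (List.mem_map.2 ⟨_, List.get_mem .., rfl⟩),
    fun j => h _ (List.get_mem ..)⟩
  · have : edgeLabels ext S i = ((E.map Prod.fst).toFinset : Set (Option ℕ)) := by
      ext x
      simp [← hE]
    rw [this, Set.ncard_coe_finset, List.toFinset_card_of_nodup hnd, List.length_map]
  · intro j j' hj
    have := (List.nodup_iff_injective_get.1 hnd)
    have h2 := @this (Fin.cast (by simp) j) (Fin.cast (by simp) j') (by simpa using hj)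
    simpa [Fin.ext_iff] using h2

theorem isCompletePath_mkNode {i : ℕ} {E : List Edge} {ξ : List (ℕ × Option ℕ)} {τ : Finset Rule}
    (h : (mkNode i E).IsCompletePath ξ τ) :
    ∃ e ∈ E, ∃ ξ', ξ = (i, e.1) :: ξ' ∧ e.2.1.IsCompletePath ξ' τ := by
  cases h with
  | working _ _ _ _ j ξ' _ h => exact ⟨_, List.get_mem .., ξ', rfl, h⟩

/-- The edge to a terminal node labeled with the rule `a_i = δ → σ`. -/
def leafEdge (i : ℕ) (p : ℕ × ℕ) : Edge :=
  (some p.1, .terminal {Item.toRule (some (i, p.1), p.2)},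
    .lbrace :: (itemWord (some (i, p.1), p.2) ++ [.rbrace]))

theorem representsTree_terminal (c : Item) :
    RepresentsTree (.lbrace :: (itemWord c ++ [.rbrace])) (.terminal {Item.toRule c}) := by
  obtain ⟨w, hw, e⟩ := exists_representsRule c
  have := RepresentsTree.terminal {Item.toRule c} w
    ⟨[Item.toRule c], [w], by simp, by simp, by simpa using hw, by simp⟩
  simpa [e] using this

theorem edgesWord_leafEdge (i : ℕ) (reps : List (ℕ × ℕ)) :
    edgesWord (reps.map (leafEdge i)) = reps.flatMap (branchWord i) := by
  rw [edgesWord, List.flatMap_map]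
  congr 1
  funext p
  simp [leafEdge, branchWord, labelWord, bin]

theorem IsNode.mem_attrs {L : List Item} {S : Finset Rule} (hL : IsItemList L S) {i : ℕ}
    {reps : List (ℕ × ℕ)} (h : IsNode L i reps) : i ∈ attrs S := by
  obtain ⟨p, hp⟩ := List.exists_mem_of_ne_nil _ h.ne_nil
  exact (hL.mem_attrs i).2 ⟨_, _, h.mem p hp⟩

theorem IsNode.mem_map_fst {L : List Item} {S : Finset Rule} (hL : IsItemList L S) {i : ℕ}
    {reps : List (ℕ × ℕ)} (h : IsNode L i reps) (δ : ℕ) :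
    δ ∈ reps.map Prod.fst ↔ δ ∈ values S i := by
  rw [hL.mem_values]
  constructor
  · intro hδ
    obtain ⟨p, hp, rfl⟩ := List.mem_map.1 hδ
    exact ⟨p.2, h.mem p hp⟩
  · rintro ⟨σ, hσ⟩
    exact h.complete δ σ hσ

theorem map_fst_leafEdge (i : ℕ) (reps : List (ℕ × ℕ)) :
    (reps.map (leafEdge i)).map Prod.fst = (reps.map Prod.fst).map some := by
  simp [leafEdge]

theorem eqs_toRule_some (i δ σ : ℕ) : (Item.toRule (some (i, δ), σ)).eqs = {(i, some δ)} := by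
  ext e
  simp [Rule.eqs, Item.toRule]

theorem eqs_toRule_none (σ : ℕ) : (Item.toRule (none, σ)).eqs = ∅ := by
  ext e
  simp [Rule.eqs, Item.toRule]

/-- A tree with one working node solves `SR`. -/
theorem IsNode.solves {L : List Item} {S : Finset Rule} (hL : IsItemList L S) {i : ℕ}
    {reps : List (ℕ × ℕ)} (h : IsNode L i reps) :
    (mkNode i (reps.map (leafEdge i))).Solves .SR S := by
  refine ⟨isOver_mkNode (h.mem_attrs hL) ?_ ?_ ?_, ?_⟩
  · rw [map_fst_leafEdge]
    exact h.nodup.map (Option.some_injective _)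
  · intro x
    rw [map_fst_leafEdge]
    simp only [List.mem_map (l := List.map _ _), h.mem_map_fst hL, edgeLabels, Set.mem_ofPred_eq]
    simp [Problem.IsExtended, eq_comm]
  · intro e he
    obtain ⟨p, hp, rfl⟩ := List.mem_map.1 he
    simp only [leafEdge, DecisionTree.IsOver, Finset.singleton_subset_iff]
    exact (hL _).2 ⟨_, h.mem p hp, rfl⟩
  · intro ξ τ hξ _
    obtain ⟨e, he, ξ', rfl, hξ'⟩ := isCompletePath_mkNode hξ
    obtain ⟨p, hp, rfl⟩ := List.mem_map.1 he
    simp only [leafEdge] at hξ'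
    cases hξ'
    -- The label is nonempty, so the condition of `SR` is vacuous; only the satisfaction of the rule
    -- remains.
    refine ⟨?_, by simp [PathCondition]⟩
    intro r hr
    rw [Finset.mem_singleton.1 hr, eqs_toRule_some]
    simp [pathEqs, leafEdge]

theorem solves_terminal {L : List Item} {S : Finset Rule} (hL : IsItemList L S) {σ : ℕ}
    (h : (none, σ) ∈ L) : (DecisionTree.terminal {Item.toRule (none, σ)}).Solves .SR S := by
  refine ⟨?_, ?_⟩
  · simp only [DecisionTree.IsOver, Finset.singleton_subset_iff]
    exact (hL _).2 ⟨_, h, rfl⟩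
  · intro ξ τ hξ _
    cases hξ
    refine ⟨?_, by simp [PathCondition]⟩
    intro r hr
    rw [Finset.mem_singleton.1 hr, eqs_toRule_none]
    simp

def finLabel : Option ℕ → Finset Rule
  | none => ∅
  | some σ => {Item.toRule (none, σ)}

/-- The tree with a main path along the edges labeled with `∗`, and its word. -/
def chainTree (fin : Option ℕ) : List (ℕ × List (ℕ × ℕ)) → DecisionTree × List TreeSymbol
  | [] => (.terminal (finLabel fin), .lbrace :: (finWord fin ++ [.rbrace]))
  | nd :: nodes => (mkNode nd.1 (nd.2.map (leafEdge nd.1) ++ [(none, chainTree fin nodes)]),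
      nodeWord nd.1 nd.2 ++ [.star, .rule .arrow] ++ (chainTree fin nodes).2 ++ [.rbracket])

theorem chainTree_word (fin : Option ℕ) (nodes : List (ℕ × List (ℕ × ℕ))) :
    (chainTree fin nodes).2 = chainWord nodes ++ (TreeSymbol.lbrace :: finWord fin ++
      [TreeSymbol.rbrace]) ++ List.replicate nodes.length .rbracket := by
  induction nodes with
  | nil => simp [chainTree, chainWord]
  | cons nd nodes ih => simp [chainTree, ih, chainWord, List.replicate_succ']

theorem representsTree_chainTree (fin : Option ℕ) (nodes : List (ℕ × List (ℕ × ℕ))) :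
    RepresentsTree (chainTree fin nodes).2 (chainTree fin nodes).1 := by
  induction nodes with
  | nil =>
    cases fin with
    | none => exact RepresentsTree.terminal ∅ [] ⟨[], [], by simp, by simp, by simp, by simp⟩
    | some σ => exact representsTree_terminal (none, σ)
  | cons nd nodes ih =>
    have := representsTree_mkNode nd.1 (nd.2.map (leafEdge nd.1) ++ [(none, chainTree fin nodes)])
      (by
        intro e he
        rcases List.mem_append.1 he with he | he
        · obtain ⟨p, -, rfl⟩ := List.mem_map.1 he
          exact representsTree_terminal _
        · rw [List.mem_singleton.1 he]
          exact ih)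
    have e : edgesWord (nd.2.map (leafEdge nd.1) ++ [(none, chainTree fin nodes)]) =
        nd.2.flatMap (branchWord nd.1) ++ [.star, .rule .arrow] ++ (chainTree fin nodes).2 := by
      rw [← edgesWord_leafEdge]
      simp [edgesWord, labelWord]
    rw [e] at this
    simpa [chainTree, nodeWord] using this

theorem isOver_chainTree {L : List Item} {S : Finset Rule} (hL : IsItemList L S) {fin : Option ℕ}
    {nodes : List (ℕ × List (ℕ × ℕ))} (h : ∀ nd ∈ nodes, IsNode L nd.1 nd.2)
    (hfin : ∀ σ ∈ fin, (none, σ) ∈ L) : (chainTree fin nodes).1.IsOver True S := by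
  induction nodes with
  | nil =>
    cases fin with
    | none => simp [chainTree, DecisionTree.IsOver, finLabel]
    | some σ =>
      simp only [chainTree, DecisionTree.IsOver, finLabel, Finset.singleton_subset_iff]
      exact (hL _).2 ⟨_, hfin σ rfl, rfl⟩
  | cons nd nodes ih =>
    have hnd := h nd (by simp)
    refine isOver_mkNode (hnd.mem_attrs hL) ?_ ?_ ?_
    · rw [List.map_append, map_fst_leafEdge]
      refine List.Nodup.append (hnd.nodup.map (Option.some_injective _)) (by simp) ?_
      simp only [List.Disjoint, List.mem_map, List.map_cons, List.map_nil, List.mem_singleton]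
      rintro _ ⟨δ, -, rfl⟩ h
      simp at h
    · intro x
      rw [List.map_append, map_fst_leafEdge]
      simp only [List.mem_append, List.mem_map (l := List.map _ _), hnd.mem_map_fst hL, edgeLabels,
        Set.mem_ofPred_eq]
      simp [eq_comm]
    · intro e he
      rcases List.mem_append.1 he with he | he
      · obtain ⟨p, hp, rfl⟩ := List.mem_map.1 he
        simp only [leafEdge, DecisionTree.IsOver, Finset.singleton_subset_iff]
        exact (hL _).2 ⟨_, hnd.mem p hp, rfl⟩
      · rw [List.mem_singleton.1 he]
        exact ih fun nd hnd => h nd (by simp [hnd])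

/-- A path either leaves the chain by an edge whose equation is the whole left-hand side of the
leaf's rule, or takes `∗` at every node. -/
theorem path_chainTree {fin : Option ℕ} {nodes : List (ℕ × List (ℕ × ℕ))}
    {ξ : List (ℕ × Option ℕ)} {τ : Finset Rule}
    (h : (chainTree fin nodes).1.IsCompletePath ξ τ) :
    (∃ i δ σ, τ = {Item.toRule (some (i, δ), σ)} ∧ (i, some δ) ∈ ξ) ∨
      (τ = finLabel fin ∧ ∀ nd ∈ nodes, (nd.1, none) ∈ ξ) := by
  induction nodes generalizing ξ with
  | nil =>
    simp only [chainTree] at h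
    cases h
    exact Or.inr ⟨rfl, by simp⟩
  | cons nd nodes ih =>
    obtain ⟨e, he, ξ', rfl, hξ'⟩ := isCompletePath_mkNode h
    rcases List.mem_append.1 he with he | he
    · obtain ⟨p, hp, rfl⟩ := List.mem_map.1 he
      simp only [leafEdge] at hξ'
      cases hξ'
      exact Or.inl ⟨nd.1, p.1, p.2, rfl, by simp [leafEdge]⟩
    · rw [List.mem_singleton.1 he] at hξ' ⊢
      rcases ih hξ' with ⟨i, δ, σ, h1, h2⟩ | ⟨h1, h2⟩
      · exact Or.inl ⟨i, δ, σ, h1, by simp [h2]⟩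
      · refine Or.inr ⟨h1, fun nd' hnd' => ?_⟩
        rcases List.mem_cons.1 hnd' with rfl | hnd'
        · simp
        · simp [h2 nd' hnd']

theorem IsChain.solves {L : List Item} {S : Finset Rule} (hL : IsItemList L S) {fin : Option ℕ}
    {nodes : List (ℕ × List (ℕ × ℕ))} (h : IsChain L nodes fin) :
    (chainTree fin nodes).1.Solves .ESR S := by
  refine ⟨isOver_chainTree hL h.isNode h.fin_mem, fun ξ τ hξ _ => ?_⟩
  rcases path_chainTree hξ with ⟨i, δ, σ, rfl, h2⟩ | ⟨rfl, h2⟩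
  · refine ⟨?_, by simp [PathCondition]⟩
    intro r hr
    rw [Finset.mem_singleton.1 hr, eqs_toRule_some]
    simpa [pathEqs] using h2
  · cases hf : fin with
    | some σ =>
      refine ⟨?_, by simp [PathCondition, finLabel]⟩
      intro r hr
      rw [Finset.mem_singleton.1 hr, eqs_toRule_none]
      simp
    | none =>
      refine ⟨by simp [finLabel], fun _ r hr hcon => ?_⟩
      obtain ⟨c, hc, rfl⟩ := (hL r).1 hr
      obtain ⟨nd, hnd, δ, hδ⟩ := h.complete hf c hc
      obtain ⟨x, σ⟩ := c
      simp only at hδ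
      subst hδ
      -- Without a final rule, every rule has its attribute on the chain, where the path answered
      -- `∗`, contrary to the value `δ`.
      have := hcon nd.1 (some δ) none (Or.inl (by rw [eqs_toRule_some]; rfl))
        (Or.inr (h2 nd hnd))
      simp at this

theorem trans_stacks {p : Program} {w : List RuleSymbol} {u : List TreeSymbol} {n : ℕ}
    (h : Trans p { t := (w.map .rule).reverse } { out := u } n) :
    Runs p (update (fun _ => []) .t (w.map TreeSymbol.rule).reverse)
      (update (fun _ => []) .out u) n := by
  have e : (fun _ => [] : Stk → List TreeSymbol) = ({} : Stacks).get := by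
    funext k; cases k <;> rfl
  rw [e, Stacks.update_get, Stacks.update_get]
  exact h

theorem length_le_of_encode {w : List TreeSymbol} {L : List Item}
    (h : w ++ [semi] = encode itemWord L) :
    (∀ c ∈ L, (itemWord c).length ≤ w.length + 1) ∧ L.length ≤ w.length + 1 := by
  have e : w.length + 1 = (encode itemWord L).length := by rw [← h]; simp
  rw [e]
  clear h e
  induction L with
  | nil => simp
  | cons c L ih =>
    have e : (encode itemWord (c :: L)).length =
        (itemWord c).length + 1 + (encode itemWord L).length := by simp [encode]; omega
    rw [e]
    refine ⟨fun c' hc' => ?_, by simp; omega⟩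
    rcases List.mem_cons.1 hc' with rfl | hc'
    · omega
    · have := ih.1 c' hc'
      omega

/-- A program that constructs a tree for every system of rules of length at most one. -/
theorem polyTimeConstructible_one {C : Problem} {k : ℕ} (p : Program)
    (h : ∀ (n : ℕ) (w : List TreeSymbol) (L : List Item), L ≠ [] →
      w ++ [semi] = encode itemWord L → (∀ c ∈ L, (itemWord c).length ≤ n) → L.length ≤ n →
      ∃ u, Trans p { t := w.reverse } { out := u } (200 * (n + 1) ^ 4) ∧
        ∀ S, IsItemList L S → ∃ Γ : DecisionTree, RepresentsTree u Γ ∧ Γ.Solves C S) :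
    PolyTimeConstructible C k 1 := by
  have key : ∀ w : InputWord k 1, ∃ u, Trans p { t := (w.1.map TreeSymbol.rule).reverse }
      { out := u } (200 * (w.1.length + 2) ^ 4) ∧
      ∀ S ∈ systems k 1, Represents w.1 S →
        ∃ Γ : DecisionTree, RepresentsTree u Γ ∧ Γ.Solves C S := by
    rintro ⟨w, S₀, ⟨hne, -, h1⟩, hw⟩
    obtain ⟨L, hL, hwL, -⟩ := exists_itemList hw hne h1.le
    obtain ⟨h2, h3⟩ := length_le_of_encode hwL
    obtain ⟨u, hu, hS⟩ := h _ _ L hL hwL h2 h3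
    refine ⟨u, by simpa using hu, fun S hSk hSw => hS S ?_⟩
    -- The output was computed from `S₀`; another system with the same word has the same items.
    obtain ⟨L', -, hwL', hL'⟩ := exists_itemList hSw hSk.1 hSk.2.2.le
    rw [hwL] at hwL'
    rwa [encode_injective hwL']
  choose f hf1 hf2 using key
  refine ⟨f, ?_, hf2⟩
  refine polyTime_of_runs _ f TreeSymbol.rule .t .out (none, none) p
    (200 * (Polynomial.X + 2) ^ 4) fun w => ?_
  simpa using trans_stacks (hf1 w)

theorem polyTimeConstructible_ESR_one (k : ℕ) : PolyTimeConstructible .ESR k 1 := by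
  refine polyTimeConstructible_one chainProgram fun n w L _ hw hn hL => ?_
  obtain ⟨nodes, fin, h1, h2⟩ := trans_chainProgram w L hw hn hL
  rw [← chainTree_word] at h2
  exact ⟨_, h2, fun S hS => ⟨_, representsTree_chainTree fin nodes, h1.solves hS⟩⟩

theorem polyTimeConstructible_SR_one (k : ℕ) : PolyTimeConstructible .SR k 1 := by
  refine polyTimeConstructible_one starProgram fun n w L hne hw hn hL => ?_
  rcases L with _ | ⟨⟨_ | ⟨i, δ⟩, σ⟩, L⟩
  · exact absurd rfl hne
  · refine ⟨_, trans_starProgram_none w σ L hw hn hL, fun S hS => ⟨_, ?_,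
      solves_terminal hS (List.mem_cons_self ..)⟩⟩
    exact representsTree_terminal (none, σ)
  · obtain ⟨reps, h1, h2⟩ := trans_starProgram_some w i δ σ L hw hn hL
    refine ⟨_, h2, fun S hS => ⟨_, ?_, h1.solves hS⟩⟩
    rw [nodeWord, ← edgesWord_leafEdge]
    refine representsTree_mkNode i _ fun e he => ?_
    obtain ⟨p, -, rfl⟩ := List.mem_map.1 he
    exact representsTree_terminal _

/-! ### Systems in which every attribute has one value -/

def eqnWord (e : ℕ × ℕ) : List TreeSymbol := (equationWord e).map .rule

theorem eqnWord_eq (e : ℕ × ℕ) : eqnWord e = .rule .lparen :: (.rule .attr :: (bin e.1 ++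
    .rule .equal :: bin e.2) ++ [.rule .rparen]) := by
  simp [eqnWord, equationWord, bin]

/-- `E` is the list of the equations in the word `w`. -/
inductive HasEquations : List TreeSymbol → List (ℕ × ℕ) → Prop
  | nil : HasEquations [] []
  | symbol (b : TreeSymbol) (w E) (hb : b ≠ .rule .lparen) (h : HasEquations w E) :
      HasEquations (b :: w) E
  | equation (e : ℕ × ℕ) (w E) (h : HasEquations w E) : HasEquations (eqnWord e ++ w) (e :: E)

theorem HasEquations.append {w w' : List TreeSymbol} {E E' : List (ℕ × ℕ)} (h : HasEquations w E)
    (h' : HasEquations w' E') : HasEquations (w ++ w') (E ++ E') := by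
  induction h with
  | nil => exact h'
  | symbol b w E hb _ ih => exact .symbol b _ _ hb ih
  | equation e w E _ ih =>
    rw [List.append_assoc]
    exact .equation e _ _ ih

theorem HasEquations.of_notMem {w : List TreeSymbol} (h : .rule .lparen ∉ w) :
    HasEquations w [] := by
  induction w with
  | nil => exact .nil
  | cons b w ih =>
    simp only [List.mem_cons, not_or] at h
    exact .symbol b w [] (Ne.symm h.1) (ih h.2)

theorem eqnWord_append_inj {e e' : ℕ × ℕ} {w w' : List TreeSymbol}
    (h : eqnWord e ++ w = eqnWord e' ++ w') : e = e' ∧ w = w' := by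
  simp only [eqnWord_eq, List.cons_append, List.append_assoc, List.cons.injEq, true_and,
    List.nil_append] at h
  obtain ⟨h1, h2⟩ := append_cons_inj_of_notMem_of_notMem (notMem_bin (by simp) (by simp))
    (notMem_bin (by simp) (by simp)) h
  obtain ⟨h3, h4⟩ := append_cons_inj_of_notMem_of_notMem (notMem_bin (by simp) (by simp))
    (notMem_bin (by simp) (by simp)) h2
  exact ⟨Prod.ext (bin_injective h1) (bin_injective h3), h4⟩

/-- Parsing is deterministic: an opening parenthesis starts an equation and is excluded from the
other clause, and the fields of an equation end at their delimiters. -/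
theorem HasEquations.unique {w w' : List TreeSymbol} {E E' : List (ℕ × ℕ)} (h : HasEquations w E)
    (h' : HasEquations w' E') (hw : w = w') : E = E' := by
  induction h generalizing w' E' with
  | nil =>
    cases h' with
    | nil => rfl
    | symbol => simp at hw
    | equation e => simp [eqnWord_eq] at hw
  | symbol b w E hb _ ih =>
    cases h' with
    | nil => simp at hw
    | symbol b' w' _ _ h' =>
      simp only [List.cons.injEq] at hw
      exact ih h' hw.2
    | equation e w' =>
      simp only [eqnWord_eq, List.cons_append, List.cons.injEq] at hw
      exact absurd hw.1 hb
  | equation e w E _ ih =>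
    cases h' with
    | nil => simp [eqnWord_eq] at hw
    | symbol b' w' _ hb =>
      simp only [eqnWord_eq, List.cons_append, List.cons.injEq] at hw
      exact absurd hw.1.symm hb
    | equation e' w' _ h' =>
      obtain ⟨rfl, h2⟩ := eqnWord_append_inj hw
      rw [ih h' h2]

theorem HasEquations.intercalate {d : TreeSymbol} (hd : d ≠ .rule .lparen) {α : Type} (l : List α)
    (f : α → List TreeSymbol) (g : α → List (ℕ × ℕ)) (h : ∀ x ∈ l, HasEquations (f x) (g x)) :
    HasEquations (List.intercalate [d] (l.map f)) (l.flatMap g) := by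
  induction l with
  | nil => exact .nil
  | cons x l ih =>
    rcases l with _ | ⟨y, l⟩
    · simpa using h x (by simp)
    · have h2 := ih fun z hz => h z (by simp [hz])
      simp only [List.map_cons, List.intercalate_cons_cons, List.flatMap_cons] at h2 ⊢
      rw [List.append_assoc]
      exact (h x (by simp)).append (.symbol d _ _ hd h2)

theorem map_intercalate {α β : Type} (f : α → β) (s : List α) (l : List (List α)) :
    (List.intercalate s l).map f = List.intercalate (s.map f) (l.map (List.map f)) := by
  induction l with
  | nil => simp
  | cons x l ih =>
    rcases l with _ | ⟨y, l⟩
    · simp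
    · simp only [List.map_cons, List.intercalate_cons_cons, List.map_append] at ih ⊢
      rw [ih]

theorem RepresentsRule.hasEquations {w : List RuleSymbol} {r : Rule} (h : RepresentsRule w r) :
    ∃ E, HasEquations (w.map .rule) E ∧ ∀ e, e ∈ E ↔ e ∈ r.lhs := by
  obtain ⟨l, -, hl, rfl⟩ := h
  refine ⟨l, ?_, fun e => by rw [← hl, List.mem_toFinset]⟩
  have h1 := HasEquations.intercalate (d := .rule .conj) (by simp) l eqnWord (fun e => [e])
    (fun e _ => by simpa using HasEquations.equation e [] [] .nil)
  have h2 := h1.append (HasEquations.of_notMem (w := .rule .arrow :: bin r.rhs)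
    (by simp [notMem_bin]))
  rw [show eqnWord = fun e => (equationWord e).map TreeSymbol.rule from rfl] at h2
  simpa [map_intercalate, bin, Function.comp_def] using h2

/-- For rules of any length the word is not determined by a simple list of items, but the path
program needs only the equations in order of occurrence, with repetitions. -/
theorem Represents.hasEquations {w : List RuleSymbol} {S : Finset Rule} (h : Represents w S) :
    ∃ E, HasEquations (w.map .rule) E ∧ ∀ e, e ∈ E ↔ ∃ r ∈ S, e ∈ r.lhs := by
  obtain ⟨l, ws, -, rfl, hF, rfl⟩ := h
  have key : ∃ L : List (List TreeSymbol × List (ℕ × ℕ)),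
      L.map Prod.fst = ws.map (List.map TreeSymbol.rule) ∧
      (∀ x ∈ L, HasEquations x.1 x.2) ∧
      ∀ e, e ∈ L.flatMap Prod.snd ↔ ∃ r ∈ l, e ∈ r.lhs := by
    induction hF with
    | nil => exact ⟨[], by simp⟩
    | @cons w r ws l hw _ ih =>
      obtain ⟨L, h1, h2, h3⟩ := ih
      obtain ⟨E, h4, h5⟩ := hw.hasEquations
      refine ⟨(w.map .rule, E) :: L, by simp [h1], ?_, ?_⟩
      · intro x hx
        rcases List.mem_cons.1 hx with rfl | hx
        · exact h4
        · exact h2 x hx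
      · intro e
        rw [List.flatMap_cons, List.mem_append, h3, h5]
        simp
  obtain ⟨L, h1, h2, h3⟩ := key
  refine ⟨L.flatMap Prod.snd, ?_, by simpa using h3⟩
  rw [map_intercalate, ← h1]
  exact HasEquations.intercalate (by simp) L _ _ h2

/-- Write the equation at the top of the stack `a`, without its first parenthesis, as the beginning
of a working node with one edge. -/
def emitEquation : Program :=
  .loop [popX .a, pushX .t] (fun v => !decide (v.1 = some (.rule .rparen)))
    (.acts [.push .o fun v => if v.1 = some (.rule .equal) then some .lbracket else v.1])

def scanStep : Program :=
  .ite [peekX .t] (fun v => v.1 = some (.rule .lparen))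
    (.seq (.acts [pushC .c .rbracket]) <| .seq emitEquation (.acts [pushC .o (.rule .arrow)]))
    (.acts [])

def scan : Program := .loop [popX .a, pushX .t] (fun v => v.1.isSome) scanStep

/-- With `=` replaced by an opening bracket, `a i = δ` becomes the beginning of a working node
together with the label of its only edge. -/
def substEqual (b : TreeSymbol) : TreeSymbol := if b = .rule .equal then .lbracket else b

theorem trans_emitEquation (l l' t o c : List TreeSymbol) (h : .rule .rparen ∉ l) :
    Trans emitEquation { a := l ++ .rule .rparen :: l', t := t, o := o, c := c }
      { a := l', t := .rule .rparen :: l.reverse ++ t, o := (l.map substEqual).reverse ++ o,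
        c := c } (2 * l.length + 1) := by
  induction l generalizing t o with
  | nil =>
    refine Runs.loop_false fun v => ⟨(some (.rule .rparen), v.2), ?_, by simp⟩
    simp [runActs, Act.run, Stacks.update_get, Stacks.get, Stacks.set]
  | cons b l ih =>
    simp only [List.mem_cons, not_or] at h
    have h2 := ih (b :: t) (substEqual b :: o) h.2
    -- The body depends on the symbol just popped, so this step is carried out with explicit
    -- registers instead of `Runs`.
    have h3 : ∀ v, ∃ v' n, n ≤ 1 ∧ Exec (.acts [.push .o fun v : Regs =>
        if v.1 = some (.rule .equal) then some .lbracket else v.1]) ((some b, v),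
        Stacks.get { a := l ++ .rule .rparen :: l', t := b :: t, o := o, c := c }) (v',
        Stacks.get
          { a := l ++ .rule .rparen :: l', t := b :: t, o := substEqual b :: o, c := c }) n := by
      intro v
      refine ⟨(some b, v), 1, le_rfl, ?_⟩
      have := Exec.acts [.push .o fun v : Regs =>
        if v.1 = some (.rule .equal) then some .lbracket else v.1] ((some b, v),
        Stacks.get { a := l ++ .rule .rparen :: l', t := b :: t, o := o, c := c })
      convert this using 1
      by_cases hb : b = .rule .equal
      · simp [runActs, Act.run, Stacks.update_get, Stacks.get, Stacks.set, substEqual, hb]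
      · simp [runActs, Act.run, Stacks.update_get, Stacks.get, Stacks.set, substEqual, hb]
    intro v
    obtain ⟨v1, n1, hn1, hE1⟩ := h3 v.2
    obtain ⟨v2, n2, hn2, hE2⟩ := h2 v1
    refine ⟨v2, 1 + n1 + n2, by simp; omega, ?_⟩
    have hr : runActs [popX .a, pushX .t]
        (v, Stacks.get { a := b :: l ++ .rule .rparen :: l', t := t, o := o, c := c }) =
        ((some b, v.2),
          Stacks.get { a := l ++ .rule .rparen :: l', t := b :: t, o := o, c := c }) := by
      simp [runActs, Act.run, Stacks.update_get, Stacks.get, Stacks.set]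
    have := Exec.loop_true (l := [popX .a, pushX .t])
      (b := fun v => !decide (v.1 = some (.rule .rparen)))
      (p := .acts [.push .o fun v => if v.1 = some (.rule .equal) then some .lbracket else v.1])
      (c := (v, Stacks.get { a := b :: l ++ .rule .rparen :: l', t := t, o := o, c := c }))
      (by rw [hr]; simpa using Ne.symm h.1) (by rw [hr]; exact hE1) hE2
    simpa [emitEquation] using this

/-- The beginning of a working node with one edge. -/
def singleHeader (e : ℕ × ℕ) : List TreeSymbol :=
  headerWord e.1 ++ (bin e.2 ++ [.rule .arrow])

theorem map_substEqual_bin (n : ℕ) : (bin n).map substEqual = bin n := by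
  conv_rhs => rw [← List.map_id (bin n)]
  refine List.map_congr_left fun b hb => ?_
  have : b ≠ .rule .equal := by
    rintro rfl
    exact notMem_bin (by simp) (by simp) hb
  simp [substEqual, this]

/-- The scanned word is kept on `t`, because it will be copied as the label of the leaf. -/
theorem trans_scan {w : List TreeSymbol} {E : List (ℕ × ℕ)} (h : HasEquations w E)
    (t o c : List TreeSymbol) :
    Trans scan { a := w, t := t, o := o, c := c }
      { t := w.reverse ++ t, o := (E.flatMap singleHeader).reverse ++ o,
        c := List.replicate E.length .rbracket ++ c } (4 * w.length + 1) := by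
  induction h generalizing t o c with
  | nil =>
    refine Runs.mono (Runs.loop_false fun v => ⟨(none, v.2), ?_, rfl⟩) le_rfl
    simp [runActs, Act.run, Stacks.update_get, Stacks.get, Stacks.set]
  | symbol b w E hb _ ih =>
    have h1 := Runs.loop_true (l := [popX .a, pushX .t]) (c := fun v => v.1.isSome)
      (p := scanStep) (s := Stacks.get { a := b :: w, t := t, o := o, c := c })
      (s₁ := Stacks.get { a := w, t := b :: t, o := o, c := c })
      (fun v => ⟨(some b, v.2), by
        simp [runActs, Act.run, Stacks.update_get, Stacks.get, Stacks.set], rfl⟩)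
      (Runs.ite_false (fun v => ⟨(some b, v.2), rfl, by simpa using hb⟩)
        (fun v => ⟨v, 1, le_rfl, Exec.acts _ _⟩)) (ih (b :: t) o c)
    refine Runs.mono (by simpa [scan] using h1) (by simp; omega)
  | equation e w E _ ih =>
    have h1 := trans_push .c .rbracket
      { a := .rule .attr :: (bin e.1 ++ .rule .equal :: bin e.2) ++ .rule .rparen :: w
        t := .rule .lparen :: t, o := o, c := c }
    have h2 := trans_emitEquation (.rule .attr :: (bin e.1 ++ .rule .equal :: bin e.2)) w
      (.rule .lparen :: t) o (.rbracket :: c) (by simp [notMem_bin])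
    have e1 : (TreeSymbol.rule .attr :: (bin e.1 ++ TreeSymbol.rule .equal :: bin e.2)).map
        substEqual = headerWord e.1 ++ bin e.2 := by
      simp only [List.map_cons, List.map_append, map_substEqual_bin, headerWord]
      simp [substEqual]
    rw [e1] at h2
    have h3 := trans_push .o (.rule .arrow)
      { a := w
        t := .rule .rparen :: (.rule .attr :: (bin e.1 ++ .rule .equal :: bin e.2)).reverse ++
          .rule .lparen :: t
        o := (headerWord e.1 ++ bin e.2).reverse ++ o, c := .rbracket :: c }
    have h4 := Runs.loop_true (l := [popX .a, pushX .t]) (c := fun v => v.1.isSome)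
      (p := scanStep) (s := Stacks.get { a := eqnWord e ++ w, t := t, o := o, c := c })
      (fun v => ⟨(some (.rule .lparen), v.2), by
        simp only [eqnWord_eq]
        simp [runActs, Act.run, Stacks.update_get, Stacks.get, Stacks.set], rfl⟩)
      (Runs.ite_true (s := Stacks.get
        { a := .rule .attr :: (bin e.1 ++ .rule .equal :: bin e.2) ++ .rule .rparen :: w
          t := .rule .lparen :: t, o := o, c := c })
        (fun v => ⟨(some (.rule .lparen), v.2), rfl, by simp⟩)
        (h1.seq (h2.seq h3))) (ih _ _ _)
    refine Runs.mono (by simpa [scan, singleHeader, eqnWord_eq, Stacks.get, Stacks.set,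
      List.replicate_succ'] using h4) ?_
    simp [eqnWord_eq]
    omega

/-- The beginning of a node is one symbol shorter than the equation that it comes from. -/
theorem HasEquations.length_le {w : List TreeSymbol} {E : List (ℕ × ℕ)} (h : HasEquations w E) :
    E.length ≤ w.length ∧ (E.flatMap singleHeader).length ≤ w.length := by
  induction h with
  | nil => simp
  | symbol b w E _ _ ih => simp only [List.length_cons]; omega
  | equation e w E _ ih =>
    simp only [List.length_cons, List.flatMap_cons, List.length_append, eqnWord_eq, singleHeader,
      headerWord, List.length_nil]
    omega

/-- The construction of a tree with one path. -/
def pathProgram : Program :=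
  .seq (move .t .a) <| .seq scan <| .seq (.acts [pushC .o .lbrace]) <| .seq (move .t .a) <|
  .seq (move .a .o) <| .seq (.acts [pushC .o .rbrace]) writeOutput

theorem trans_pathProgram {w : List TreeSymbol} {E : List (ℕ × ℕ)} (h : HasEquations w E) :
    Trans pathProgram { t := w.reverse }
      { out := E.flatMap singleHeader ++ .lbrace :: (w ++ .rbrace ::
        List.replicate E.length .rbracket) } (16 * w.length + 20) := by
  have h1 := trans_move (j := .t) (k := .a) (by decide) { t := w.reverse }
  have h2 := trans_scan h [] [] []
  have h3 := trans_push .o .lbrace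
    { t := w.reverse, o := (E.flatMap singleHeader).reverse
      c := List.replicate E.length .rbracket }
  have h4 := trans_move (j := .t) (k := .a) (by decide)
    { t := w.reverse, o := .lbrace :: (E.flatMap singleHeader).reverse
      c := List.replicate E.length .rbracket }
  have h5 := trans_move (j := .a) (k := .o) (by decide)
    { a := w, o := .lbrace :: (E.flatMap singleHeader).reverse
      c := List.replicate E.length .rbracket }
  have h6 := trans_push .o .rbrace
    { o := w.reverse ++ .lbrace :: (E.flatMap singleHeader).reverse
      c := List.replicate E.length .rbracket }
  have h7 := trans_writeOutput
    (.rbrace :: (w.reverse ++ .lbrace :: (E.flatMap singleHeader).reverse))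
    (List.replicate E.length .rbracket)
  obtain ⟨l1, l2⟩ := h.length_le
  simp only [Stacks.set, Stacks.get, List.append_nil, List.reverse_reverse, List.length_reverse]
    at h1 h2 h3 h4 h5 h6
  refine Runs.mono (h1.seq (h2.seq (h3.seq (h4.seq (h5.seq (h6.seq (by simpa using h7))))))) ?_
  simp only [List.length_flatMap] at l2 ⊢
  omega

/-- The tree with one path, whose equations are those of `E`, and its word. -/
def pathTree (S : Finset Rule) (w : List TreeSymbol) : List (ℕ × ℕ) → DecisionTree × List TreeSymbol
  | [] => (.terminal S, .lbrace :: (w ++ [.rbrace]))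
  | e :: E => (mkNode e.1 [(some e.2, pathTree S w E)],
      singleHeader e ++ (pathTree S w E).2 ++ [.rbracket])

theorem pathTree_word (S : Finset Rule) (w : List TreeSymbol) (E : List (ℕ × ℕ)) :
    (pathTree S w E).2 = E.flatMap singleHeader ++ .lbrace :: (w ++ .rbrace ::
        List.replicate E.length .rbracket) := by
  induction E with
  | nil => simp [pathTree]
  | cons e E ih => simp [pathTree, ih, List.replicate_succ']

/-- The leaf is labeled with all of `S`, so its word is the input word, copied verbatim. -/
theorem representsTree_pathTree {S : Finset Rule} {w : List RuleSymbol} (hw : Represents w S)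
    (E : List (ℕ × ℕ)) :
    RepresentsTree (pathTree S (w.map .rule) E).2 (pathTree S (w.map .rule) E).1 := by
  induction E with
  | nil => simpa [pathTree] using RepresentsTree.terminal S w hw
  | cons e E ih =>
    have := representsTree_mkNode e.1 [(some e.2, pathTree S (w.map .rule) E)] (by simpa using ih)
    simpa [pathTree, edgesWord, singleHeader, labelWord, bin] using this

theorem path_pathTree {S : Finset Rule} {w : List TreeSymbol} {E : List (ℕ × ℕ)}
    {ξ : List (ℕ × Option ℕ)} {τ : Finset Rule} (h : (pathTree S w E).1.IsCompletePath ξ τ) :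
    τ = S ∧ ∀ e ∈ E, (e.1, some e.2) ∈ ξ := by
  induction E generalizing ξ with
  | nil =>
    simp only [pathTree] at h
    cases h
    simp
  | cons e E ih =>
    obtain ⟨e', he', ξ', rfl, hξ'⟩ := isCompletePath_mkNode h
    rw [List.mem_singleton.1 he'] at hξ' ⊢
    obtain ⟨rfl, h2⟩ := ih hξ'
    refine ⟨rfl, fun f hf => ?_⟩
    rcases List.mem_cons.1 hf with rfl | hf
    · simp
    · simp [h2 f hf]

/-- Only because each attribute has exactly one value may a node of an o-tree have a single edge.
Querying an attribute again is allowed and harmless. -/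
theorem isOver_pathTree {S : Finset Rule} {w : List TreeSymbol} {E : List (ℕ × ℕ)}
    (hS : maxValues S = 1) (hE : ∀ e ∈ E, ∃ r ∈ S, e ∈ r.lhs) :
    (pathTree S w E).1.IsOver False S := by
  induction E with
  | nil => simp [pathTree, DecisionTree.IsOver]
  | cons e E ih =>
    obtain ⟨r, hr, her⟩ := hE e (by simp)
    have hi : e.1 ∈ attrs S :=
      Finset.mem_biUnion.2 ⟨r, hr, Finset.mem_image_of_mem _ her⟩
    have hv : e.2 ∈ values S e.1 :=
      Finset.mem_biUnion.2 ⟨r, hr, Finset.mem_image.2 ⟨e, by simp [her], rfl⟩⟩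
    have hc : (values S e.1).card ≤ 1 :=
      (Finset.le_sup (f := fun i => (values S i).card) hi).trans hS.le
    refine isOver_mkNode hi (by simp) ?_ ?_
    · intro x
      simp only [List.map_cons, List.map_nil, List.mem_singleton, edgeLabels, false_and, or_false,
        Set.mem_ofPred_eq]
      constructor
      · rintro rfl
        exact ⟨_, hv, rfl⟩
      · rintro ⟨δ, hδ, rfl⟩
        rw [Finset.card_le_one.1 hc δ hδ _ hv]
    · intro e' he'
      rw [List.mem_singleton.1 he']
      exact ih fun e he => hE e (by simp [he])

/-- The only path contains every equation of `S`, so all rules are satisfied on it; `hP` says that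
with the label `S` nothing else has to be checked. -/
theorem polyTimeConstructible_of_one_value {C : Problem} (hC : C.IsExtended = False)
    (hP : ∀ S K, S.Nonempty → PathCondition C S K S) (d : ℕ) : PolyTimeConstructible C 1 d := by
  have key : ∀ w : InputWord 1 d, ∃ u, Trans pathProgram
      { t := (w.1.map TreeSymbol.rule).reverse } { out := u } (16 * w.1.length + 20) ∧
      ∀ S ∈ systems 1 d, Represents w.1 S →
        ∃ Γ : DecisionTree, RepresentsTree u Γ ∧ Γ.Solves C S := by
    rintro ⟨w, S₀, -, hw⟩
    obtain ⟨E, hE, -⟩ := hw.hasEquations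
    refine ⟨_, by simpa using trans_pathProgram hE, fun S hS hSw => ?_⟩
    obtain ⟨E', hE', hES⟩ := hSw.hasEquations
    obtain rfl := hE'.unique hE rfl
    rw [← List.append_nil (List.replicate _ _), List.append_nil, ← pathTree_word S]
    refine ⟨_, representsTree_pathTree hSw E', ?_, fun ξ τ hξ _ => ?_⟩
    · rw [hC]
      exact isOver_pathTree hS.2.1 fun e he => (hES e).1 he
    · obtain ⟨rfl, h⟩ := path_pathTree hξ
      refine ⟨?_, hP _ _ hS.1⟩
      rintro r hr _ ⟨e, he, rfl⟩
      exact h e ((hES e).2 ⟨r, hr, he⟩)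
  choose f hf1 hf2 using key
  refine ⟨f, ?_, hf2⟩
  refine polyTime_of_runs _ f TreeSymbol.rule .t .out (none, none) pathProgram
    (16 * Polynomial.X + 20) fun w => ?_
  simpa using trans_stacks (hf1 w)

theorem polyTimeConstructible_AR_of_one_value (d : ℕ) : PolyTimeConstructible .AR 1 d :=
  polyTimeConstructible_of_one_value rfl (fun S K _ => by simp [PathCondition]) d

theorem polyTimeConstructible_SR_of_one_value (d : ℕ) : PolyTimeConstructible .SR 1 d :=
  polyTimeConstructible_of_one_value rfl
    (fun S K h => by simp [PathCondition, h.ne_empty]) d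

/-- A tree that solves `AR(S)` solves `AD(S)`, and likewise for the extended problems. -/
theorem PolyTimeConstructible.imp {C C' : Problem} {k d : ℕ}
    (h : ∀ (Γ : DecisionTree) S, Γ.Solves C S → Γ.Solves C' S) (hC : PolyTimeConstructible C k d) :
    PolyTimeConstructible C' k d := by
  obtain ⟨f, hf, hS⟩ := hC
  refine ⟨f, hf, fun w S hSk hSw => ?_⟩
  obtain ⟨Γ, h1, h2⟩ := hS w S hSk hSw
  exact ⟨Γ, h1, h Γ S h2⟩

theorem polyTimeConstructible_AD_of_AR {k d : ℕ} (h : PolyTimeConstructible .AR k d) :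
    PolyTimeConstructible .AD k d :=
  PolyTimeConstructible.imp (C := .AR) (hC := h) fun _ _ hΓ => ⟨hΓ.1, fun ξ τ hξ hc =>
    ⟨(hΓ.2 ξ τ hξ hc).1,
    fun r hr _ => (hΓ.2 ξ τ hξ hc).2 r hr⟩⟩

theorem polyTimeConstructible_EAD_of_EAR {k d : ℕ} (h : PolyTimeConstructible .EAR k d) :
    PolyTimeConstructible .EAD k d :=
  PolyTimeConstructible.imp (C := .EAR) (hC := h) fun _ _ hΓ => ⟨hΓ.1, fun ξ τ hξ hc =>
    ⟨(hΓ.2 ξ τ hξ hc).1,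
    fun r hr _ => (hΓ.2 ξ τ hξ hc).2 r hr⟩⟩

end DecisionRules

/-! ### Lower bounds -/

namespace DecisionRules

open Function Turing

/-! ### Length of the output of a machine -/

section OutputLength

variable {K Λ σ : Type} {Γ : K → Type} [DecidableEq K]

/-- A bound on the number of symbols pushed by a statement. -/
def pushCount : TM2.Stmt Γ Λ σ → ℕ
  | .push _ _ q => pushCount q + 1
  | .peek _ _ q => pushCount q
  | .pop _ _ q => pushCount q
  | .load _ q => pushCount q
  | .branch _ q q' => pushCount q + pushCount q'
  | .goto _ => 0
  | .halt => 0

theorem length_stepAux_le (q : TM2.Stmt Γ Λ σ) (v : σ) (S : ∀ k, List (Γ k)) (k : K) :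
    ((TM2.stepAux q v S).stk k).length ≤ (S k).length + pushCount q := by
  induction q generalizing v S with
  | push k' f q ih =>
    have := ih v (update S k' (f v :: S k'))
    simp only [TM2.stepAux, pushCount]
    by_cases h : k = k'
    · subst h; simp at this; omega
    · simp [h] at this; omega
  | peek k' f q ih => exact ih _ _
  | pop k' f q ih =>
    have := ih (f v (S k').head?) (update S k' (S k').tail)
    simp only [TM2.stepAux, pushCount]
    by_cases h : k = k'
    · subst h; simp at this; omega
    · simp [h] at this; omega
  | load f q ih => exact ih _ _
  | branch f q q' ih ih' =>
    simp only [TM2.stepAux, pushCount]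
    cases f v
    · have := ih' v S; simp only [cond_false]; omega
    · have := ih v S; simp only [cond_true]; omega
  | goto f => simp [TM2.stepAux]
  | halt => simp [TM2.stepAux]

theorem length_iterate_step_le (M : Λ → TM2.Stmt Γ Λ σ) {c : ℕ} (hc : ∀ l, pushCount (M l) ≤ c)
    (t : ℕ) (a b : TM2.Cfg Γ Λ σ) (h : (flip bind (TM2.step M))^[t] (some a) = some b) (k : K) :
    (b.stk k).length ≤ (a.stk k).length + c * t := by
  induction t generalizing a with
  | zero =>
    simp only [iterate_zero, id_eq, Option.some.injEq] at h
    subst h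
    simp
  | succ t ih =>
    rw [iterate_succ_apply] at h
    rcases a with ⟨_ | l, v, S⟩
    -- A halted configuration has no successor, and `none` is never left again, so this case cannot
    -- end in `b`.
    · have : (flip bind (TM2.step M)) (some (⟨none, v, S⟩ : TM2.Cfg Γ Λ σ)) = none := rfl
      rw [this] at h
      have h2 : ∀ t, (flip bind (TM2.step M))^[t] none = none := by
        intro t
        induction t with
        | zero => rfl
        | succ t ih => rw [iterate_succ_apply]; exact ih
      rw [h2] at h
      simp at h
    · have h1 := ih (TM2.stepAux (M l) v S) h
      have h2 := length_stepAux_le (M l) v S k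
      have h3 := hc l
      rw [Nat.mul_add]
      simp only
      omega

end OutputLength

/-- The output of a polynomial time machine has polynomial length. -/
theorem exists_length_le {α A B : Type} {ea : α → List A} {f : α → List B}
    (h : TM2ComputableInPolyTime ea (fun u : List B => u) f) :
    ∃ Q : Polynomial ℕ, ∀ a, (f a).length ≤ Q.eval (ea a).length := by
  have := h.tm.ΛFin
  obtain ⟨c, hc⟩ : ∃ c, ∀ l, pushCount (h.tm.m l) ≤ c :=
    ⟨∑ l, pushCount (h.tm.m l), fun l =>
      Finset.single_le_sum (f := fun l => pushCount (h.tm.m l)) (fun _ _ => Nat.zero_le _)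
        (Finset.mem_univ l)⟩
  -- The term `X` covers what is initially on the output stack, which may coincide with the input
  -- stack.
  refine ⟨Polynomial.X + Polynomial.C c * h.time, fun a => ?_⟩
  obtain ⟨⟨t, ht⟩, htm⟩ := h.outputsFun a
  have h1 := length_iterate_step_le h.tm.m hc t _ _ ht h.tm.k₁
  have h2 : ((haltList h.tm ((f a).map h.outputAlphabet.invFun)).stk h.tm.k₁).length =
      (f a).length := by
    simp [haltList]
  have h3 : ∀ k, ((initList h.tm ((ea a).map h.inputAlphabet.invFun)).stk k).length ≤
      (ea a).length := by
    intro k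
    by_cases hk : k = h.tm.k₀
    · subst hk
      simp [initList]
    · simp [initList, hk]
  have h4 := Nat.mul_le_mul_left c htm
  simp only [Polynomial.eval_add, Polynomial.eval_mul, Polynomial.eval_X, Polynomial.eval_C]
  calc (f a).length ≤ _ := h2.symm.le
    _ ≤ _ := h1
    _ ≤ _ := add_le_add (h3 _) h4

/-- The quotient by `2 ^ n` tends to zero for each monomial, hence for sums. -/
theorem exists_eval_lt_two_pow (p : Polynomial ℕ) : ∃ n : ℕ, p.eval n < 2 ^ n := by
  have h : Filter.Tendsto (fun n : ℕ => ((p.eval n : ℕ) : ℝ) / 2 ^ n) Filter.atTop (nhds 0) := by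
    induction p using Polynomial.induction_on' with
    | add p q hp hq =>
      have := hp.add hq
      simpa [add_div] using this
    | monomial i a =>
      have := (tendsto_pow_const_div_const_pow_of_one_lt i (r := (2 : ℝ)) (by norm_num)).const_mul
        (a : ℝ)
      simpa [mul_div_assoc] using this
  obtain ⟨n, hn⟩ := ((tendsto_order.1 h).2 1 one_pos).exists
  refine ⟨n, ?_⟩
  rw [div_lt_one (by positivity)] at hn
  exact_mod_cast hn

/-! ### Counting complete paths -/

/-- A tree has at most as many complete paths as its word has symbols. -/
theorem RepresentsTree.card_le {u : List TreeSymbol} {Γ : DecisionTree} (h : RepresentsTree u Γ)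
    (P : Finset (List (ℕ × Option ℕ) × Finset Rule)) (hP : ∀ p ∈ P, Γ.IsCompletePath p.1 p.2) :
    P.card ≤ u.length := by
  classical
  induction h generalizing P with
  | terminal τ w h =>
    have : P ⊆ {([], τ)} := by
      intro p hp
      have := hP p hp
      rcases p with ⟨ξ, τ'⟩
      cases this
      simp
    exact (Finset.card_le_card this).trans (by simp)
  | working i m label child u _ ih =>
    -- All tails that are complete paths of the child `j` are collected, whichever edge they came
    -- from; overcounting is harmless, since the induction hypothesis bounds any such set.
    set Q : Fin m → Finset (List (ℕ × Option ℕ) × Finset Rule) := fun j =>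
      (P.image fun p => (p.1.tail, p.2)).filter fun q => (child j).IsCompletePath q.1 q.2 with hQ
    have h1 : P ⊆ Finset.univ.biUnion fun j =>
        (Q j).image fun q => ((i, label j) :: q.1, q.2) := by
      intro p hp
      have := hP p hp
      rcases p with ⟨ξ, τ⟩
      cases this with
      | working _ _ _ _ j ξ _ h =>
        refine Finset.mem_biUnion.2 ⟨j, Finset.mem_univ _, Finset.mem_image.2 ⟨(ξ, τ), ?_, rfl⟩⟩
        exact Finset.mem_filter.2 ⟨Finset.mem_image.2 ⟨_, hp, rfl⟩, h⟩
    calc P.card ≤ _ := Finset.card_le_card h1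
      _ ≤ ∑ j, ((Q j).image fun q => ((i, label j) :: q.1, q.2)).card := Finset.card_biUnion_le
      _ ≤ ∑ j, (u j).length := Finset.sum_le_sum fun j _ =>
        Finset.card_image_le.trans (ih j (Q j) fun q hq => (Finset.mem_filter.1 hq).2)
      _ ≤ (List.ofFn fun j => labelWord (label j) ++ [.rule .arrow] ++ u j).flatten.length := by
        rw [List.length_flatten, List.map_ofFn, List.sum_ofFn]
        refine Finset.sum_le_sum fun j _ => ?_
        simp only [List.length_append, comp_apply]
        omega
      _ ≤ _ := by
        simp only [List.length_append, List.length_cons]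
        omega

/-- The path `ξ` is the path of the tuple `x` of values of attributes. -/
def Follows (x : ℕ → Option ℕ) (ξ : List (ℕ × Option ℕ)) : Prop := ∀ e ∈ ξ, e.2 = x e.1

theorem edgeLabels_finite (ext : Prop) (S : Finset Rule) (i : ℕ) : (edgeLabels ext S i).Finite := by
  refine Set.Finite.subset
    (((values S i).finite_toSet.image some).union (Set.finite_singleton none)) ?_
  rintro x (⟨δ, hδ, rfl⟩ | ⟨-, rfl⟩)
  · exact Or.inl ⟨δ, hδ, rfl⟩
  · exact Or.inr rfl

theorem DecisionTree.IsOver.exists_follows {ext : Prop} {S : Finset Rule} {Γ : DecisionTree}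
    (h : Γ.IsOver ext S) {x : ℕ → Option ℕ} (hx : ∀ i ∈ attrs S, x i ∈ edgeLabels ext S i) :
    ∃ ξ τ, Γ.IsCompletePath ξ τ ∧ Follows x ξ ∧ τ ⊆ S := by
  induction Γ with
  | terminal τ => exact ⟨[], τ, .terminal τ, by simp [Follows], h⟩
  | working i m label child ih =>
    obtain ⟨hi, hm, hinj, hl, hc⟩ := h
    -- Distinct labels, as many as there are values, exhaust the values; so a tuple with admissible
    -- values never gets stuck.
    have hr : Set.range label = edgeLabels ext S i := by
      refine Set.eq_of_subset_of_ncard_le (Set.range_subset_iff.2 hl) ?_ (edgeLabels_finite ext S i)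
      rw [← Set.image_univ, Set.ncard_image_of_injective _ hinj, ← hm]
      simp [Set.ncard_univ]
    obtain ⟨j, hj⟩ : x i ∈ Set.range label := hr ▸ hx i hi
    obtain ⟨ξ, τ, h1, h2, h3⟩ := ih j (hc j)
    refine ⟨(i, label j) :: ξ, τ, .working i m label child j ξ τ h1, ?_, h3⟩
    intro e he
    rcases List.mem_cons.1 he with rfl | he
    · exact hj
    · exact h2 e he

theorem Follows.consistent {x : ℕ → Option ℕ} {ξ : List (ℕ × Option ℕ)} (h : Follows x ξ) :
    Consistent (pathEqs ξ) := fun i _ _ h1 h2 => (h (i, _) h1).trans (h (i, _) h2).symm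

/-- If a rule contradicts a path, then one of its equations is falsified on the path. -/
theorem Follows.exists_of_not_consistent {x : ℕ → Option ℕ} {ξ : List (ℕ × Option ℕ)}
    (h : Follows x ξ) {r : Rule} (hr : ¬ Consistent (r.eqs ∪ pathEqs ξ)) :
    ∃ p ∈ r.lhs, (p.1, x p.1) ∈ ξ ∧ x p.1 ≠ some p.2 := by
  by_contra! hcon
  have key : ∀ i y, (i, y) ∈ pathEqs ξ → ∀ p ∈ r.lhs, p.1 = i → y = some p.2 := by
    rintro i y hy p hp rfl
    have := h _ hy
    simp only at this
    subst this
    exact hcon p hp hy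
  apply hr
  rintro i y z (⟨p, hp, he⟩ | hy) (⟨q, hq, he'⟩ | hz)
  · simp only [Prod.mk.injEq] at he he'
    have := r.attr_ne p hp q hq (he.1.symm.trans he'.1)
    rw [he.2, he'.2, this]
  · simp only [Prod.mk.injEq] at he
    rw [he.2, key i z hz p hp he.1.symm]
  · simp only [Prod.mk.injEq] at he'
    rw [he'.2, key i y hy q hq he'.1.symm]
  · exact h.consistent i y z hy hz

/-- If different tuples of a set `T` cannot have the same path, then the word of the tree has at
least `|T|` symbols. -/
theorem card_le_of_solves {α : Type} {C : Problem} {S : Finset Rule} {Γ : DecisionTree}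
    (hΓ : Γ.Solves C S) {u : List TreeSymbol} (hu : RepresentsTree u Γ) (T : Finset α)
    (x : α → ℕ → Option ℕ)
    (hx : ∀ s ∈ T, ∀ i ∈ attrs S, x s i ∈ edgeLabels C.IsExtended S i)
    (hT : ∀ s ∈ T, ∀ s' ∈ T, ∀ ξ τ, Follows (x s) ξ → Follows (x s') ξ → τ ⊆ S →
      (∀ r ∈ τ, r.eqs ⊆ pathEqs ξ) → PathCondition C S (pathEqs ξ) τ → s = s') :
    T.card ≤ u.length := by
  classical
  have h1 : ∀ s : T, ∃ p : List (ℕ × Option ℕ) × Finset Rule, Γ.IsCompletePath p.1 p.2 ∧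
      Follows (x s) p.1 ∧ p.2 ⊆ S := by
    intro s
    obtain ⟨ξ, τ, h⟩ := hΓ.1.exists_follows (hx s.1 s.2)
    exact ⟨(ξ, τ), h⟩
  choose p hp1 hp2 hp3 using h1
  have hinj : Injective p := by
    intro s s' h
    have hs := hΓ.2 _ _ (hp1 s) (hp2 s).consistent
    exact Subtype.ext (hT s.1 s.2 s'.1 s'.2 (p s).1 (p s).2 (hp2 s) (h ▸ hp2 s') (hp3 s) hs.1 hs.2)
  calc T.card = (Finset.univ.image p).card := by
        rw [Finset.card_image_of_injective _ hinj, Finset.card_univ, Fintype.card_coe]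
    _ ≤ u.length := hu.card_le _ fun q hq => by
        obtain ⟨s, -, rfl⟩ := Finset.mem_image.1 hq
        exact hp1 s

/-! ### Size of the input and the general lower bound -/

theorem length_binary_le (n : ℕ) : (binary n).length ≤ n + 1 := by
  unfold binary
  split_ifs with h
  · simp
  · rw [List.length_map, List.length_reverse, Nat.length_digits 2 n (by norm_num) h]
    have := Nat.log_le_self 2 n
    omega

theorem length_intercalate_le {α : Type} (s : α) (l : List (List α)) {b : ℕ}
    (h : ∀ x ∈ l, x.length ≤ b) : (List.intercalate [s] l).length ≤ l.length * (b + 1) := by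
  induction l with
  | nil => simp
  | cons x l ih =>
    have h1 := h x (by simp)
    have h2 := ih fun y hy => h y (by simp [hy])
    rw [List.length_cons, Nat.add_mul]
    rcases l with _ | ⟨y, l⟩
    · simp; omega
    · simp only [List.intercalate_cons_cons, List.length_append, List.length_cons,
        List.length_nil] at h2 ⊢
      omega

theorem exists_representsRule_length_le (r : Rule) {N d : ℕ} (h : ∀ e ∈ r.lhs, e.1 ≤ N ∧ e.2 ≤ N)
    (hr : r.rhs ≤ N) (hd : r.length ≤ d) :
    ∃ w, RepresentsRule w r ∧ w.length ≤ d * (2 * N + 7) + (N + 2) := by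
  refine ⟨_, ⟨r.lhs.toList, Finset.nodup_toList _, by simp, rfl⟩, ?_⟩
  have h1 := length_intercalate_le RuleSymbol.conj (r.lhs.toList.map equationWord) (b := 2 * N + 6)
    (by
      intro x hx
      obtain ⟨e, he, rfl⟩ := List.mem_map.1 hx
      have := h e (by simpa using he)
      have h2 := length_binary_le e.1
      have h3 := length_binary_le e.2
      simp only [equationWord, List.length_append, List.length_cons, List.length_nil]
      omega)
  have h2 := length_binary_le r.rhs
  have h3 : (r.lhs.toList.map equationWord).length ≤ d := by simpa [Rule.length] using hd
  have h4 := h1.trans (Nat.mul_le_mul_right _ h3)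
  simp only [List.length_append, List.length_cons, List.length_nil]
  have h5 : d * (2 * N + 6 + 1) = d * (2 * N + 7) := rfl
  omega

theorem exists_represents_length_le (S : Finset Rule) {N d : ℕ}
    (h : ∀ r ∈ S, (∀ e ∈ r.lhs, e.1 ≤ N ∧ e.2 ≤ N) ∧ r.rhs ≤ N ∧ r.length ≤ d) :
    ∃ w, Represents w S ∧ w.length ≤ S.card * (d * (2 * N + 7) + (N + 3)) := by
  have key : ∀ l : List Rule, (∀ r ∈ l, r ∈ S) → ∃ ws : List (List RuleSymbol),
      List.Forall₂ RepresentsRule ws l ∧ ∀ w ∈ ws, w.length ≤ d * (2 * N + 7) + (N + 2) := by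
    intro l hl
    induction l with
    | nil => exact ⟨[], .nil, by simp⟩
    | cons r l ih =>
      obtain ⟨ws, h1, h2⟩ := ih fun r hr => hl r (by simp [hr])
      obtain ⟨h3, h4, h5⟩ := h r (hl r (by simp))
      obtain ⟨w, h6, h7⟩ := exists_representsRule_length_le r h3 h4 h5
      refine ⟨w :: ws, .cons h6 h1, fun w' hw' => ?_⟩
      rcases List.mem_cons.1 hw' with rfl | hw'
      · exact h7
      · exact h2 w' hw'
  obtain ⟨ws, h1, h2⟩ := key S.toList (by simp)
  refine ⟨_, ⟨S.toList, ws, Finset.nodup_toList _, by simp, h1, rfl⟩, ?_⟩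
  have := length_intercalate_le RuleSymbol.semicolon ws h2
  rwa [h1.length_eq, Finset.length_toList, Nat.add_assoc, Nat.add_assoc] at this

/-- At most `m ^ 2` rules of at most `m` equations, with numbers up to `m ^ 2`. Even a linear bound
on the length of binary numerals gives `m ^ 4` per rule. -/
theorem exists_represents_length_le_pow (S : Finset Rule) {m d : ℕ} (hm : 10 ≤ m) (hd : d ≤ m)
    (hS : S.card ≤ m ^ 2)
    (h : ∀ r ∈ S, (∀ e ∈ r.lhs, e.1 ≤ m ^ 2 ∧ e.2 ≤ m ^ 2) ∧ r.rhs ≤ m ^ 2 ∧ r.length ≤ d) :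
    ∃ w, Represents w S ∧ w.length ≤ m ^ 6 := by
  obtain ⟨w, h1, h2⟩ := exists_represents_length_le S h
  refine ⟨w, h1, h2.trans ?_⟩
  have h3 : d * (2 * m ^ 2 + 7) + (m ^ 2 + 3) ≤ m ^ 4 := by
    calc d * (2 * m ^ 2 + 7) + (m ^ 2 + 3) ≤ m * (2 * m ^ 2 + 7) + (m ^ 2 + 3) := by gcongr
      _ ≤ m ^ 4 := by
        obtain ⟨j, rfl⟩ := Nat.exists_eq_add_of_le hm
        ring_nf
        nlinarith [Nat.zero_le (j ^ 3), Nat.zero_le (j ^ 4), Nat.zero_le (j ^ 2)]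
  calc S.card * (d * (2 * m ^ 2 + 7) + (m ^ 2 + 3)) ≤ m ^ 2 * m ^ 4 := Nat.mul_le_mul hS h3
    _ = m ^ 6 := by ring

/-- Systems of polynomial size that need trees of exponential size. -/
theorem not_polyTimeConstructible {C : Problem} {k d : ℕ} (c : ℕ)
    (h : ∀ n, ∃ S ∈ systems k d, (∃ w, Represents w S ∧ w.length ≤ (n + c) ^ 6) ∧
      ∀ (Γ : DecisionTree) u, Γ.Solves C S → RepresentsTree u Γ → 2 ^ n ≤ u.length) :
    ¬ PolyTimeConstructible C k d := by
  rintro ⟨f, ⟨hf⟩, hC⟩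
  obtain ⟨Q, hQ⟩ := exists_length_le hf
  obtain ⟨n, hn⟩ := exists_eval_lt_two_pow (Q.comp ((Polynomial.X + Polynomial.C c) ^ 6))
  obtain ⟨S, hS, ⟨w, hw, hwl⟩, hlow⟩ := h n
  obtain ⟨Γ, h1, h2⟩ := hC ⟨w, S, hS, hw⟩ S hS hw
  have h3 := hlow Γ _ h2 h1
  have h4 := hQ ⟨w, S, hS, hw⟩
  -- The coefficients are natural numbers, so a bound on the input length bounds the output length.
  have hmono : Monotone fun n : ℕ => Q.eval n := by
    intro a b hab
    simp only [Polynomial.eval_eq_sum, Polynomial.sum]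
    gcongr
  have h5 : Q.eval w.length ≤ Q.eval ((n + c) ^ 6) := hmono hwl
  simp only [Polynomial.eval_comp, Polynomial.eval_pow, Polynomial.eval_add, Polynomial.eval_X,
    Polynomial.eval_C] at hn
  exact absurd (h3.trans (h4.trans h5)) (not_le.2 hn)

/-- All values lie below `k`, so no attribute has more than `k` of them, and one attribute attaining
every value suffices for equality. -/
theorem mem_systems {S : Finset Rule} {k d : ℕ} (hk : 0 < k)
    (h1 : ∀ r ∈ S, ∀ e ∈ r.lhs, e.2 < k)
    (h2 : ∃ i, ∀ δ < k, ∃ r ∈ S, (i, δ) ∈ r.lhs) (h3 : ∀ r ∈ S, r.length ≤ d)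
    (h4 : ∃ r ∈ S, r.length = d) : S ∈ systems k d := by
  obtain ⟨r₀, hr₀, hd⟩ := h4
  have hval : ∀ i δ, δ ∈ values S i ↔ ∃ r ∈ S, (i, δ) ∈ r.lhs := by
    intro i δ
    simp only [values, Finset.mem_biUnion, Finset.mem_image, Finset.mem_filter]
    constructor
    · rintro ⟨r, hr, ⟨i, δ⟩, ⟨h, rfl⟩, rfl⟩
      exact ⟨r, hr, h⟩
    · rintro ⟨r, hr, h⟩
      exact ⟨r, hr, (i, δ), ⟨h, rfl⟩, rfl⟩
  have hle : ∀ i, values S i ⊆ Finset.range k := by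
    intro i δ hδ
    obtain ⟨r, hr, h⟩ := (hval i δ).1 hδ
    exact Finset.mem_range.2 (h1 r hr _ h)
  refine ⟨⟨r₀, hr₀⟩, le_antisymm ?_ ?_, le_antisymm ?_ ?_⟩
  · refine Finset.sup_le fun i _ => ?_
    simpa using Finset.card_le_card (hle i)
  · obtain ⟨i, hi⟩ := h2
    have hr : Finset.range k ⊆ values S i := fun δ hδ =>
      (hval i δ).2 (hi δ (Finset.mem_range.1 hδ))
    have hia : i ∈ attrs S := by
      obtain ⟨r, hr, h⟩ := hi 0 hk
      exact Finset.mem_biUnion.2 ⟨r, hr, Finset.mem_image.2 ⟨_, h, rfl⟩⟩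
    calc k = (Finset.range k).card := by simp
      _ ≤ (values S i).card := Finset.card_le_card hr
      _ ≤ _ := Finset.le_sup (f := fun i => (values S i).card) hia
  · exact Finset.sup_le h3
  · rw [← hd]
    exact Finset.le_sup (f := Rule.length) hr₀

/-- The rule whose left-hand side assigns `δ` to the attribute `m` and `0` to the other attributes
from `A`. -/
def spikeRule (A : Finset ℕ) (m δ σ : ℕ) : Rule where
  lhs := A.image fun a => (a, if a = m then δ else 0)
  rhs := σ
  attr_ne := by
    intro e he e' he' h
    obtain ⟨a, -, rfl⟩ := Finset.mem_image.1 he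
    obtain ⟨b, -, rfl⟩ := Finset.mem_image.1 he'
    simp only at h
    rw [h]

theorem length_spikeRule (A : Finset ℕ) (m δ σ : ℕ) : (spikeRule A m δ σ).length = A.card :=
  Finset.card_image_of_injective _ fun a b h => by simpa using congrArg Prod.fst h

theorem mem_spikeRule {A : Finset ℕ} {m δ σ : ℕ} {e : ℕ × ℕ} :
    e ∈ (spikeRule A m δ σ).lhs ↔ e.1 ∈ A ∧ e.2 = if e.1 = m then δ else 0 := by
  simp only [spikeRule, Finset.mem_image]
  constructor
  · rintro ⟨a, ha, rfl⟩
    exact ⟨ha, rfl⟩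
  · rintro ⟨h1, h2⟩
    exact ⟨e.1, h1, by rw [← h2]⟩

end DecisionRules

/-! ### Systems without small decision trees -/

namespace DecisionRules

theorem some_mem_edgeLabels {ext : Prop} {S : Finset Rule} {i δ : ℕ}
    (h : ∃ r ∈ S, (i, δ) ∈ r.lhs) : some δ ∈ edgeLabels ext S i := by
  obtain ⟨r, hr, h⟩ := h
  refine Or.inl ⟨δ, ?_, rfl⟩
  exact Finset.mem_biUnion.2 ⟨r, hr, Finset.mem_image.2 ⟨(i, δ), Finset.mem_filter.2 ⟨h, rfl⟩, rfl⟩⟩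

open Classical in
/-- A value of an attribute that differs from `0`. -/
noncomputable def offValue (C : Problem) : Option ℕ := if C.IsExtended then none else some 1

theorem offValue_ne (C : Problem) : offValue C ≠ some 0 := by
  unfold offValue
  split_ifs <;> simp

/-- The only place where `2 ≤ k` is needed: an o-tree has no `∗`, so the value `1` must occur. -/
theorem offValue_mem {C : Problem} {k : ℕ} (hC : C.IsExtended ∨ 2 ≤ k) {S : Finset Rule} {i : ℕ}
    (h : ∀ δ < k, ∃ r ∈ S, (i, δ) ∈ r.lhs) : offValue C ∈ edgeLabels C.IsExtended S i := by
  unfold offValue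
  split_ifs with hE
  · exact Or.inr ⟨hE, rfl⟩
  · exact some_mem_edgeLabels (h 1 (hC.resolve_left hE))

theorem exists_of_mem_attrs {S : Finset Rule} {i : ℕ} (h : i ∈ attrs S) :
    ∃ r ∈ S, ∃ δ, (i, δ) ∈ r.lhs := by
  obtain ⟨r, hr, hi⟩ := Finset.mem_biUnion.1 h
  obtain ⟨⟨a, δ⟩, he, rfl⟩ := Finset.mem_image.1 hi
  exact ⟨r, hr, δ, he⟩

/-- Independent attributes with all values, every equation having its own right-hand side, and one
rule of length `d`. -/
def independentSystem (n k d : ℕ) : Finset Rule :=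
  ((Finset.range (n + 1) ×ˢ Finset.range k).image fun p =>
    spikeRule {p.1} p.1 p.2 (p.1 * k + p.2)) ∪
  {spikeRule (Finset.Ico (n + 1) (n + 1 + d)) (n + 1) 0 ((n + 1) * k)}

theorem mem_independentSystem {n k d : ℕ} {r : Rule} : r ∈ independentSystem n k d ↔
    (∃ i ≤ n, ∃ δ < k, r = spikeRule {i} i δ (i * k + δ)) ∨
      r = spikeRule (Finset.Ico (n + 1) (n + 1 + d)) (n + 1) 0 ((n + 1) * k) := by
  simp only [independentSystem, Finset.mem_union, Finset.mem_image, Finset.mem_product,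
    Finset.mem_range, Prod.exists, Finset.mem_singleton, Nat.lt_succ_iff]
  constructor
  · rintro (⟨i, δ, ⟨h1, h2⟩, rfl⟩ | h)
    · exact Or.inl ⟨i, h1, δ, h2, rfl⟩
    · exact Or.inr h
  · rintro (⟨i, h1, δ, h2, rfl⟩ | h)
    · exact Or.inl ⟨i, δ, ⟨h1, h2⟩, rfl⟩
    · exact Or.inr h

theorem independentSystem_mem_systems (n : ℕ) {k d : ℕ} (hk : 0 < k) (hd : 0 < d) :
    independentSystem n k d ∈ systems k d := by
  -- The system has `n + 1` independent attributes, so attribute `0` takes all `k` values even when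
  -- `n = 0`.
  refine mem_systems hk ?_ ⟨0, fun δ hδ => ?_⟩ ?_ ?_
  · intro r hr e he
    rcases mem_independentSystem.1 hr with ⟨i, -, δ, hδ, rfl⟩ | rfl
    · have := (mem_spikeRule.1 he).2
      split_ifs at this <;> omega
    · have := (mem_spikeRule.1 he).2
      split_ifs at this <;> omega
  · exact ⟨_, mem_independentSystem.2 (Or.inl ⟨0, Nat.zero_le n, δ, hδ, rfl⟩),
      mem_spikeRule.2 (by simp)⟩
  · intro r hr
    rcases mem_independentSystem.1 hr with ⟨i, -, δ, hδ, rfl⟩ | rfl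
    · rw [length_spikeRule, Finset.card_singleton]; exact hd
    · rw [length_spikeRule, Nat.card_Ico]; omega
  · exact ⟨_, mem_independentSystem.2 (Or.inr rfl), by rw [length_spikeRule, Nat.card_Ico]; omega⟩

theorem exists_represents_independentSystem (n k d : ℕ) :
    ∃ w, Represents w (independentSystem n k d) ∧ w.length ≤ (n + (k + d + 10)) ^ 6 := by
  have hm : ∀ a ≤ n + (k + d + 10), a ≤ (n + (k + d + 10)) ^ 2 := fun a ha => by nlinarith
  have hp1 : (n + 1) * k + 1 ≤ (n + (k + d + 10)) ^ 2 := by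
    have := Nat.mul_le_mul (show n + 1 ≤ n + (k + d + 10) by omega)
      (show k + 1 ≤ n + (k + d + 10) by omega)
    rw [sq]
    linarith
  have hp : (n + 1) * k ≤ (n + (k + d + 10)) ^ 2 := (Nat.le_succ _).trans hp1
  refine exists_represents_length_le_pow _ (d := d + 1) (by omega) (by omega) ?_ ?_
  · refine (Finset.card_union_le _ _).trans ?_
    have := Finset.card_image_le (s := Finset.range (n + 1) ×ˢ Finset.range k)
      (f := fun p => spikeRule {p.1} p.1 p.2 (p.1 * k + p.2))
    simp only [Finset.card_product, Finset.card_range] at this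
    rw [Finset.card_singleton]
    omega
  · intro r hr
    rcases mem_independentSystem.1 hr with ⟨i, hi, δ, hδ, rfl⟩ | rfl
    · refine ⟨fun e he => ?_, ?_, by simp [length_spikeRule]⟩
      · obtain ⟨h1, h2⟩ := mem_spikeRule.1 he
        rw [Finset.mem_singleton] at h1
        rw [if_pos h1] at h2
        exact ⟨hm _ (by omega), hm _ (by omega)⟩
      · have h1 : i * k + δ ≤ (n + 1) * k := by
          have := Nat.mul_le_mul_right k hi
          rw [Nat.add_mul]
          omega
        exact h1.trans hp
    · refine ⟨fun e he => ?_, hp, by rw [length_spikeRule, Nat.card_Ico]; omega⟩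
      obtain ⟨h1, h2⟩ := mem_spikeRule.1 he
      rw [Finset.mem_Ico] at h1
      have h2 : e.2 = 0 := by rw [h2]; split_ifs <;> rfl
      exact ⟨hm _ (by omega), hm _ (by omega)⟩

/-- Tuples correspond to subsets of `range n`: attribute `i` is `0` exactly when `i` is in the
subset. The rule `a_i = 0` is the only one with its decision, so it is either in the leaf label,
with its equation on the path, or refuted on the path. In both cases `a_i` was read, so the path
determines the subset. -/
theorem two_pow_le_of_solves_independentSystem {C : Problem} (hC : C = .AD ∨ C = .EAD) {n k d : ℕ}
    (hk : 0 < k) (hCk : C.IsExtended ∨ 2 ≤ k) {Γ : DecisionTree} {u : List TreeSymbol}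
    (hΓ : Γ.Solves C (independentSystem n k d)) (hu : RepresentsTree u Γ) : 2 ^ n ≤ u.length := by
  classical
  set S := independentSystem n k d with hS
  have hr : ∀ i ≤ n, ∀ δ < k, ∃ r ∈ S, (i, δ) ∈ r.lhs := fun i hi δ hδ =>
    ⟨_, mem_independentSystem.2 (Or.inl ⟨i, hi, δ, hδ, rfl⟩), mem_spikeRule.2 (by simp)⟩
  have hcard : (Finset.range n).powerset.card = 2 ^ n := by simp
  rw [← hcard]
  refine card_le_of_solves hΓ hu _
    (fun (s : Finset ℕ) i => if i < n ∧ i ∉ s then offValue C else some 0) ?_ ?_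
  · intro s _ i hi
    split_ifs with h
    · exact offValue_mem hCk (hr i h.1.le)
    · refine some_mem_edgeLabels ?_
      by_cases hin : i ≤ n
      · exact hr i hin 0 hk
      · obtain ⟨r, hr, δ, he⟩ := exists_of_mem_attrs hi
        refine ⟨r, hr, ?_⟩
        rcases mem_independentSystem.1 hr with ⟨j, hj, δ, hδ, rfl⟩ | rfl
        · have := (mem_spikeRule.1 he).1
          simp only [Finset.mem_singleton] at this
          omega
        · exact mem_spikeRule.2 ⟨(mem_spikeRule.1 he).1, by simp⟩
  · intro s hs s' hs' ξ τ h1 h2 hτ h3 h4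
    have hAD : ∀ r ∈ S \ τ, r.rhs ∉ decisions τ → ¬ Consistent (r.eqs ∪ pathEqs ξ) := by
      rcases hC with rfl | rfl <;> exact h4
    have key : ∀ i < n, (i, if i < n ∧ i ∉ s then offValue C else some 0) ∈ ξ := by
      intro i hi
      set r := spikeRule {i} i 0 (i * k + 0) with hrdef
      have hrS : r ∈ S := mem_independentSystem.2 (Or.inl ⟨i, hi.le, 0, hk, rfl⟩)
      have hir : (i, 0) ∈ r.lhs := mem_spikeRule.2 (by simp)
      by_cases hrτ : r ∈ τ
      · have h5 : (i, some 0) ∈ ξ := h3 r hrτ ⟨(i, 0), hir, rfl⟩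
        have h6 := h1 _ h5
        simp only at h6
        rwa [← h6]
      · by_cases hdec : r.rhs ∈ decisions τ
        · obtain ⟨r', hr', he⟩ := Finset.mem_image.1 hdec
          rcases mem_independentSystem.1 (hτ hr') with ⟨j, hj, δ, hδ, rfl⟩ | rfl
          · have he : j * k + δ = i * k + 0 := he
            have hdiv := congrArg (· / k) he
            -- Division by `k` recovers the attribute from the decision `j * k + δ`, as `δ < k`.
            simp only [Nat.add_zero, Nat.mul_div_left _ hk, Nat.add_comm _ δ,
              Nat.add_mul_div_right _ _ hk, Nat.div_eq_of_lt hδ, Nat.zero_add] at hdiv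
            subst hdiv
            obtain rfl : δ = 0 := by omega
            exact absurd hr' hrτ
          · have he : (n + 1) * k = i * k + 0 := he
            have := Nat.eq_of_mul_eq_mul_right hk he
            omega
        · obtain ⟨p, hp, h5, -⟩ :=
            h1.exists_of_not_consistent (hAD r (Finset.mem_sdiff.2 ⟨hrS, hrτ⟩) hdec)
          have := (mem_spikeRule.1 hp).1
          rw [Finset.mem_singleton] at this
          rwa [this] at h5
    have hoff := offValue_ne C
    ext i
    by_cases hi : i < n
    · have := h2 _ (key i hi)
      simp only [hi, true_and] at this
      by_cases ha : i ∈ s <;> by_cases hb : i ∈ s' <;> simp [ha, hb, hoff, hoff.symm] at this ⊢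
    · exact iff_of_false
        (fun h => hi (Finset.mem_range.1 (Finset.mem_powerset.1 hs h)))
        (fun h => hi (Finset.mem_range.1 (Finset.mem_powerset.1 hs' h)))

theorem not_polyTimeConstructible_of_allDecisions {C : Problem} (hC : C = .AD ∨ C = .EAD) {k d : ℕ}
    (hk : 0 < k) (hd : 0 < d) (hCk : C.IsExtended ∨ 2 ≤ k) : ¬ PolyTimeConstructible C k d :=
  not_polyTimeConstructible (k + d + 10) fun n =>
    ⟨independentSystem n k d, independentSystem_mem_systems n hk hd,
      exists_represents_independentSystem n k d,
      fun _ _ h1 h2 => two_pow_le_of_solves_independentSystem hC hk hCk h1 h2⟩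

/-- Pairs of attributes `2 i`, `2 i + 1` together with rules that are falsified when the attributes
`2 n` and `2 n + 1` are not `0`. -/
def pairSystem (n k d : ℕ) : Finset Rule :=
  ((Finset.range n).image fun i => spikeRule {2 * i, 2 * i + 1} (2 * i) 0 0) ∪
  ((Finset.range (2 * n + 1) ×ˢ Finset.range k).image fun p =>
    spikeRule {p.1, 2 * n + 1} p.1 p.2 0) ∪
  ((Finset.range k).image fun δ => spikeRule {2 * n + 1, 2 * n} (2 * n + 1) δ 0) ∪
  {spikeRule (Finset.Ico (2 * n + 1) (2 * n + 1 + d)) (2 * n + 1) 0 0}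

theorem mem_pairSystem {n k d : ℕ} {r : Rule} : r ∈ pairSystem n k d ↔
    (((∃ i < n, r = spikeRule {2 * i, 2 * i + 1} (2 * i) 0 0) ∨
      ∃ m < 2 * n + 1, ∃ δ < k, r = spikeRule {m, 2 * n + 1} m δ 0) ∨
      ∃ δ < k, r = spikeRule {2 * n + 1, 2 * n} (2 * n + 1) δ 0) ∨
      r = spikeRule (Finset.Ico (2 * n + 1) (2 * n + 1 + d)) (2 * n + 1) 0 0 := by
  simp only [pairSystem, Finset.mem_union, Finset.mem_image, Finset.mem_product,
    Finset.mem_range, Prod.exists, Finset.mem_singleton]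
  refine or_congr (or_congr (or_congr ?_ ?_) ?_) Iff.rfl
  · exact exists_congr fun i => and_congr_right fun _ => eq_comm
  · constructor
    · rintro ⟨m, δ, ⟨h1, h2⟩, rfl⟩
      exact ⟨m, h1, δ, h2, rfl⟩
    · rintro ⟨m, h1, δ, h2, rfl⟩
      exact ⟨m, δ, ⟨h1, h2⟩, rfl⟩
  · exact exists_congr fun i => and_congr_right fun _ => eq_comm

/-- The form of the rules of `pairSystem`. -/
theorem exists_eq_spikeRule_of_mem_pairSystem {n k d : ℕ} (hk : 0 < k) (hd : 2 ≤ d) {r : Rule}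
    (hr : r ∈ pairSystem n k d) : ∃ (A : Finset ℕ) (m δ : ℕ), r = spikeRule A m δ 0 ∧ δ < k ∧
      A.card ≤ d ∧ ∀ a ∈ A, a ≤ 2 * n + 1 + d := by
  rcases mem_pairSystem.1 hr with ((⟨i, hi, rfl⟩ | ⟨m, hm, δ, hδ, rfl⟩) | ⟨δ, hδ, rfl⟩) | rfl
  · refine ⟨_, _, _, rfl, hk, Finset.card_le_two.trans hd, fun a ha => ?_⟩
    simp only [Finset.mem_insert, Finset.mem_singleton] at ha
    omega
  · refine ⟨_, _, _, rfl, hδ, Finset.card_le_two.trans hd, fun a ha => ?_⟩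
    simp only [Finset.mem_insert, Finset.mem_singleton] at ha
    omega
  · refine ⟨_, _, _, rfl, hδ, Finset.card_le_two.trans hd, fun a ha => ?_⟩
    simp only [Finset.mem_insert, Finset.mem_singleton] at ha
    omega
  · refine ⟨_, _, _, rfl, hk, by rw [Nat.card_Ico]; omega, fun a ha => ?_⟩
    rw [Finset.mem_Ico] at ha
    omega

/-- The auxiliary rules serve this purpose: they make every value below `k` occur for each attribute
up to `2 * n + 1`, so that the value other than `0` is admissible. Each contains `a_{2n+1} = 0` or
`a_{2n} = 0`, so the tuples used below falsify it. -/
theorem exists_mem_pairSystem {n k d a : ℕ} (ha : a ≤ 2 * n + 1) {δ : ℕ} (hδ : δ < k) :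
    ∃ r ∈ pairSystem n k d, (a, δ) ∈ r.lhs := by
  rcases Nat.lt_or_ge a (2 * n + 1) with h | h
  · exact ⟨_, mem_pairSystem.2 (Or.inl (Or.inl (Or.inr ⟨a, h, δ, hδ, rfl⟩))),
      mem_spikeRule.2 (by simp)⟩
  · obtain rfl := le_antisymm ha h
    exact ⟨_, mem_pairSystem.2 (Or.inl (Or.inr ⟨δ, hδ, rfl⟩)), mem_spikeRule.2 (by simp)⟩

theorem pairSystem_mem_systems (n : ℕ) {k d : ℕ} (hk : 0 < k) (hd : 2 ≤ d) :
    pairSystem n k d ∈ systems k d := by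
  refine mem_systems hk ?_ ⟨2 * n + 1, fun δ hδ => exists_mem_pairSystem le_rfl hδ⟩ ?_
    ⟨_, mem_pairSystem.2 (Or.inr rfl), by rw [length_spikeRule, Nat.card_Ico]; omega⟩
  · intro r hr e he
    obtain ⟨A, m, δ, rfl, hδ, -, -⟩ := exists_eq_spikeRule_of_mem_pairSystem hk hd hr
    have := (mem_spikeRule.1 he).2
    split_ifs at this <;> omega
  · intro r hr
    obtain ⟨A, m, δ, rfl, -, hA, -⟩ := exists_eq_spikeRule_of_mem_pairSystem hk hd hr
    rwa [length_spikeRule]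

theorem exists_represents_pairSystem (n : ℕ) {k d : ℕ} (hk : 0 < k) (hd : 2 ≤ d) :
    ∃ w, Represents w (pairSystem n k d) ∧ w.length ≤ (n + (k + d + 10)) ^ 6 := by
  have hm : ∀ a ≤ 2 * n + 1 + d + k, a ≤ (n + (k + d + 10)) ^ 2 := fun a ha => by nlinarith
  refine exists_represents_length_le_pow _ (d := d) (by omega) (by omega) ?_ ?_
  · have h1 := Finset.card_image_le (s := Finset.range n)
      (f := fun i => spikeRule {2 * i, 2 * i + 1} (2 * i) 0 0)
    have h2 := Finset.card_image_le (s := Finset.range (2 * n + 1) ×ˢ Finset.range k)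
      (f := fun p => spikeRule {p.1, 2 * n + 1} p.1 p.2 0)
    have h3 := Finset.card_image_le (s := Finset.range k)
      (f := fun δ => spikeRule {2 * n + 1, 2 * n} (2 * n + 1) δ 0)
    simp only [Finset.card_product, Finset.card_range] at h1 h2 h3
    have h4 : n + (2 * n + 1) * k + k + 1 ≤ (n + (k + d + 10)) ^ 2 := by nlinarith
    refine (Finset.card_union_le _ _).trans ((Nat.add_le_add_right ((Finset.card_union_le _ _).trans
      (Nat.add_le_add_right (Finset.card_union_le _ _) _)) _).trans ?_)
    rw [Finset.card_singleton]
    omega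
  · intro r hr
    obtain ⟨A, m, δ, rfl, hδ, hA, hA'⟩ := exists_eq_spikeRule_of_mem_pairSystem hk hd hr
    refine ⟨fun e he => ?_, Nat.zero_le _, by rwa [length_spikeRule]⟩
    obtain ⟨h1, h2⟩ := mem_spikeRule.1 he
    have h3 := hA' _ h1
    have h4 : e.2 ≤ δ := by rw [h2]; split_ifs <;> omega
    exact ⟨hm _ (by omega), hm _ (by omega)⟩

open Classical in
/-- The tuple of values that falsifies all rules of `pairSystem`, the attribute `2 i` or `2 i + 1`
being nonzero according to whether `i` belongs to `s`. -/
noncomputable def pairTuple (C : Problem) (n : ℕ) (s : Finset ℕ) (a : ℕ) : Option ℕ :=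
  if a < 2 * n then if a / 2 ∈ s ↔ a % 2 = 0 then some 0 else offValue C
  else if a ≤ 2 * n + 1 then offValue C else some 0

theorem pairTuple_even (C : Problem) {n i : ℕ} (hi : i < n) (s : Finset ℕ) :
    pairTuple C n s (2 * i) = some 0 ↔ i ∈ s := by
  have := offValue_ne C
  have h1 : 2 * i < 2 * n := by omega
  by_cases h : i ∈ s <;> simp [pairTuple, h1, h, this]

theorem pairTuple_odd (C : Problem) {n i : ℕ} (hi : i < n) (s : Finset ℕ) :
    pairTuple C n s (2 * i + 1) = some 0 ↔ i ∉ s := by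
  have := offValue_ne C
  have h1 : 2 * i + 1 < 2 * n := by omega
  have h2 : (2 * i + 1) / 2 = i := by omega
  have h3 : (2 * i + 1) % 2 = 1 := by omega
  by_cases h : i ∈ s <;> simp [pairTuple, h1, h2, h3, h, this]

/-- Every rule of `pairSystem` is falsified by `pairTuple`. -/
theorem exists_pairTuple_ne (C : Problem) {n k d : ℕ} (hd : 2 ≤ d) (s : Finset ℕ) {r : Rule}
    (hr : r ∈ pairSystem n k d) : ∃ p ∈ r.lhs, pairTuple C n s p.1 ≠ some p.2 := by
  have hz : pairTuple C n s (2 * n + 1) ≠ some 0 := by simp [pairTuple, offValue_ne]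
  have hw : pairTuple C n s (2 * n) ≠ some 0 := by simp [pairTuple, offValue_ne]
  rcases mem_pairSystem.1 hr with ((⟨i, hi, rfl⟩ | ⟨m, hm, δ, hδ, rfl⟩) | ⟨δ, hδ, rfl⟩) | rfl
  · by_cases h : i ∈ s
    · exact ⟨(2 * i + 1, 0), mem_spikeRule.2 (by simp),
        fun h' => (pairTuple_odd C hi s).1 h' h⟩
    · exact ⟨(2 * i, 0), mem_spikeRule.2 (by simp), fun h' => h ((pairTuple_even C hi s).1 h')⟩
  · exact ⟨(2 * n + 1, 0), mem_spikeRule.2 (by simp; omega), hz⟩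
  · exact ⟨(2 * n, 0), mem_spikeRule.2 (by simp), hw⟩
  · exact ⟨(2 * n + 1, 0), mem_spikeRule.2 (by simp; omega), hz⟩

/-- No rule holds on these tuples, so the leaf label is empty and each pair rule must be refuted on
the path. Exactly one attribute of a pair is nonzero, so the path contains that one, and a second
tuple on the same path agrees there. -/
theorem two_pow_le_of_solves_pairSystem {C : Problem} (hC : C = .SR ∨ C = .ESR) {n k d : ℕ}
    (hk : 0 < k) (hd : 2 ≤ d) (hCk : C.IsExtended ∨ 2 ≤ k) {Γ : DecisionTree} {u : List TreeSymbol}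
    (hΓ : Γ.Solves C (pairSystem n k d)) (hu : RepresentsTree u Γ) : 2 ^ n ≤ u.length := by
  have hcard : (Finset.range n).powerset.card = 2 ^ n := by simp
  rw [← hcard]
  refine card_le_of_solves hΓ hu _ (pairTuple C n) ?_ ?_
  · intro s _ a ha
    by_cases hle : a ≤ 2 * n + 1
    · have h1 := offValue_mem hCk (S := pairSystem n k d) (i := a)
        fun δ hδ => exists_mem_pairSystem hle hδ
      have h2 : some 0 ∈ edgeLabels C.IsExtended (pairSystem n k d) a :=
        some_mem_edgeLabels (exists_mem_pairSystem hle hk)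
      unfold pairTuple
      split_ifs <;> assumption
    · have h1 : ¬ a < 2 * n := by omega
      simp only [pairTuple, h1, hle, if_false]
      obtain ⟨r, hr, δ, he⟩ := exists_of_mem_attrs ha
      refine some_mem_edgeLabels ⟨r, hr, ?_⟩
      have h3 : ∀ {A m δ'}, (a, δ) ∈ (spikeRule A m δ' 0).lhs → a ∈ A := fun h =>
        (mem_spikeRule.1 h).1
      rcases mem_pairSystem.1 hr with ((⟨i, hi, rfl⟩ | ⟨m, hm, δ, hδ, rfl⟩) | ⟨δ, hδ, rfl⟩) | rfl
      · have := h3 he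
        simp only [Finset.mem_insert, Finset.mem_singleton] at this
        omega
      · have := h3 he
        simp only [Finset.mem_insert, Finset.mem_singleton] at this
        omega
      · have := h3 he
        simp only [Finset.mem_insert, Finset.mem_singleton] at this
        omega
      · exact mem_spikeRule.2 ⟨h3 he, by simp⟩
  · intro s hs s' hs' ξ τ h1 h2 hτ h3 h4
    have hSR : τ = ∅ → ∀ r ∈ pairSystem n k d, ¬ Consistent (r.eqs ∪ pathEqs ξ) := by
      rcases hC with rfl | rfl <;> exact h4
    have hempty : τ = ∅ := by
      refine Finset.eq_empty_of_forall_notMem fun r hr => ?_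
      obtain ⟨p, hp, hne⟩ := exists_pairTuple_ne C hd s (hτ hr)
      exact hne (h1 _ (h3 r hr ⟨p, hp, rfl⟩)).symm
    ext i
    by_cases hi : i < n
    · obtain ⟨p, hp, h5, h6⟩ := h1.exists_of_not_consistent
        (hSR hempty _ (mem_pairSystem.2 (Or.inl (Or.inl (Or.inl ⟨i, hi, rfl⟩)))))
      -- Both tuples follow the path, so they agree at the attribute that refutes the `i`-th rule;
      -- which of the two it is tells whether `i` belongs to the set.
      have h7 : pairTuple C n s p.1 = pairTuple C n s' p.1 := h2 _ h5
      obtain ⟨h8, h9⟩ := mem_spikeRule.1 hp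
      have h9 : p.2 = 0 := by rw [h9]; split_ifs <;> rfl
      rw [h9] at h6
      simp only [Finset.mem_insert, Finset.mem_singleton] at h8
      have h6' := h7 ▸ h6
      rcases h8 with h8 | h8
      · rw [h8, ne_eq, pairTuple_even C hi] at h6 h6'
        exact iff_of_false h6 h6'
      · rw [h8, ne_eq, pairTuple_odd C hi, not_not] at h6 h6'
        exact iff_of_true h6 h6'
    · exact iff_of_false
        (fun h => hi (Finset.mem_range.1 (Finset.mem_powerset.1 hs h)))
        (fun h => hi (Finset.mem_range.1 (Finset.mem_powerset.1 hs' h)))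

theorem not_polyTimeConstructible_of_someRule {C : Problem} (hC : C = .SR ∨ C = .ESR) {k d : ℕ}
    (hk : 0 < k) (hd : 2 ≤ d) (hCk : C.IsExtended ∨ 2 ≤ k) : ¬ PolyTimeConstructible C k d :=
  not_polyTimeConstructible (k + d + 10) fun n =>
    ⟨pairSystem n k d, pairSystem_mem_systems n hk hd,
      exists_represents_pairSystem n hk hd,
      fun _ _ h1 h2 => two_pow_le_of_solves_pairSystem hC hk hd hCk h1 h2⟩

end DecisionRules

/-! ### Combination of the upper and lower bounds -/

theorem theorem1 :
    DecisionRules.PDT .ESR = {p | ∃ k : ℕ, 0 < k ∧ p = (k, 1)} ∧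
    DecisionRules.PDT .SR =
      {p | (∃ k : ℕ, 0 < k ∧ p = (k, 1)) ∨ (∃ d : ℕ, 0 < d ∧ p = (1, d))} ∧
    DecisionRules.PDT .EAD = ∅ ∧
    DecisionRules.PDT .EAR = ∅ ∧
    DecisionRules.PDT .AD = {p | ∃ d : ℕ, 0 < d ∧ p = (1, d)} ∧
    DecisionRules.PDT .AR = {p | ∃ d : ℕ, 0 < d ∧ p = (1, d)} := by
  have hEAD : ∀ k d, 0 < k → 0 < d → ¬ DecisionRules.PolyTimeConstructible .EAD k d :=
    fun k d hk hd => DecisionRules.not_polyTimeConstructible_of_allDecisions (Or.inr rfl) hk hd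
      (Or.inl trivial)
  have hAD : ∀ k d, 0 < k → 0 < d → DecisionRules.PolyTimeConstructible .AD k d → k = 1 := by
    intro k d hk hd h
    by_contra hk1
    exact DecisionRules.not_polyTimeConstructible_of_allDecisions (Or.inl rfl) hk hd
      (Or.inr (by omega)) h
  refine ⟨?_, ?_, ?_, ?_, ?_, ?_⟩ <;> ext ⟨k, d⟩
  · constructor
    · rintro ⟨hk, hd, h⟩
      have hd' : ¬ 2 ≤ d := fun h2 => DecisionRules.not_polyTimeConstructible_of_someRule
        (Or.inr rfl) hk h2 (Or.inl trivial) h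
      obtain rfl : d = 1 := by simp only at hd; omega
      exact ⟨k, hk, rfl⟩
    · rintro ⟨k', hk, h⟩
      cases h
      exact ⟨hk, one_pos, DecisionRules.polyTimeConstructible_ESR_one k⟩
  · constructor
    · rintro ⟨hk, hd, h⟩
      by_cases h2 : 2 ≤ d
      · have hk' : ¬ 2 ≤ k := fun h3 => DecisionRules.not_polyTimeConstructible_of_someRule
          (Or.inl rfl) hk h2 (Or.inr h3) h
        obtain rfl : k = 1 := by simp only at hk; omega
        exact Or.inr ⟨d, hd, rfl⟩
      · obtain rfl : d = 1 := by simp only at hd; omega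
        exact Or.inl ⟨k, hk, rfl⟩
    · rintro (⟨k', hk, h⟩ | ⟨d', hd, h⟩) <;> cases h
      · exact ⟨hk, one_pos, DecisionRules.polyTimeConstructible_SR_one k⟩
      · exact ⟨one_pos, hd, DecisionRules.polyTimeConstructible_SR_of_one_value d⟩
  · exact iff_of_false (fun h => hEAD k d h.1 h.2.1 h.2.2) (Set.notMem_empty _)
  · exact iff_of_false (fun h => hEAD k d h.1 h.2.1
      (DecisionRules.polyTimeConstructible_EAD_of_EAR h.2.2)) (Set.notMem_empty _)
  · constructor
    · rintro ⟨hk, hd, h⟩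
      obtain rfl : k = 1 := hAD k d hk hd h
      exact ⟨d, hd, rfl⟩
    · rintro ⟨d', hd, h⟩
      cases h
      exact ⟨one_pos, hd, DecisionRules.polyTimeConstructible_AD_of_AR
        (DecisionRules.polyTimeConstructible_AR_of_one_value d)⟩
  · constructor
    · rintro ⟨hk, hd, h⟩
      obtain rfl : k = 1 := hAD k d hk hd (DecisionRules.polyTimeConstructible_AD_of_AR h)
      exact ⟨d, hd, rfl⟩
    · rintro ⟨d', hd, h⟩
      cases h
      exact ⟨one_pos, hd, DecisionRules.polyTimeConstructible_AR_of_one_value d⟩
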